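/- Let $1\le j\le k-1$ be integers. A double $k$-graph on a finite vertex set $V$ is a pair $(E_1,E_2)$ of sets of $k$-element subsets of $V$ (red edges and blue edges). The $j$-jigsaw process on it is the following sequence of partitions of the set of all $j$-element subsets of $V$ ($j$-sets) into clusters. At time $0$ every $j$-set is a cluster of its own. At each time, join two distinct clusters $C,C'$ if some red edge contains both a $j$-set of $C$ and a $j$-set of $C'$, and some blue edge contains both a $j$-set of $C$ and a $j$-set of $C'$ (the two pairs of $j$-sets may differ); the clusters at the next time are the unions of the clusters over the connected components of the graph on the clusters so obtained. The double $k$-graph $j$-percolates if at some time there is exactly one cluster. For $p_1,p_2\in[0,1]$ let $H_k(n,p_1,p_2)$ be the random double $k$-graph on $[n]=\{1,\dots,n\}$ in which every $k$-element subset of $[n]$ is a red edge with probability $p_1$ and a blue edge with probability $p_2$, independently of each other and of all other $k$-element subsets. Theorem. For all integers $1\le j\le k-1$ there is a constant $c=c(k,j)>0$ such that for all sequences $p_1=p_1(n)$, $p_2=p_2(n)$ in $[0,1]$ and $H\sim H_k(n,p_1,p_2)$: (i) if $p_1p_2\le \dfrac{1}{c\,n^{2k-2j-1}\log n}$ for all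 sufficiently large $n$, then the probability that $H$ does not $j$-percolate tends to $1$ as $n\to\infty$; (ii) if $p_1p_2\ge \dfrac{c}{n^{2k-2j-1}\log n}$ and $\min\{p_1,p_2\}\ge \dfrac{c\log n}{n^{k-j}}$ for all sufficiently large $n$, then the probability that $H$ $j$-percolates tends to $1$ as $n\to\infty$. (It is in this sense that the threshold for the product $p_1p_2$ is of order $\Theta\bigl(1/(n^{2k-2j-1}\log n)\bigr)$.) -/

import Mathlib

open Filter Topology MeasureTheory ProbabilityTheory
open scoped unitInterval

/-- `V^{(k)}`: the `k`-element subsets of `V`. -/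
abbrev KSet (V : Type*) (k : ℕ) : Type _ := {e : Finset V // e.card = k}

/-- A double `k`-graph on the vertex set `V`: the first component is the set of red edges, the
second component is the set of blue edges (a `k`-set may be both red and blue). -/
abbrev DoubleKGraph (V : Type*) (k : ℕ) : Type _ := Set (KSet V k) × Set (KSet V k)

namespace DoubleKGraph

variable {V : Type*} {k j : ℕ}

/-- Two clusters `C`, `C'` of a partition `P` of the `j`-sets (a partition is given by its
equivalence relation, and its clusters are the elements of `Quotient P`) are joined by an edge of
`E` if some `e ∈ E` contains both a `j`-set of `C` and a `j`-set of `C'`. -/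
def Joined (E : Set (KSet V k)) (P : Setoid (KSet V j)) (C C' : Quotient P) : Prop :=
  ∃ J J' : KSet V j, Quotient.mk P J = C ∧ Quotient.mk P J' = C' ∧
    ∃ e ∈ E, J.1 ⊆ e.1 ∧ J'.1 ⊆ e.1

/-- The auxiliary graph on the clusters of `P`: two distinct clusters are adjacent if they are
joined by a red edge and by a blue edge. -/
def clusterGraph (H : DoubleKGraph V k) (P : Setoid (KSet V j)) : SimpleGraph (Quotient P) where
  Adj C C' := C ≠ C' ∧ Joined H.1 P C C' ∧ Joined H.2 P C C'
  symm := by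
    refine ⟨?_⟩
    rintro C C' ⟨h, ⟨J, J', h1, h2, e, he, h3, h4⟩, ⟨K, K', g1, g2, f, hf, g3, g4⟩⟩
    exact ⟨h.symm, ⟨J', J, h2, h1, e, he, h4, h3⟩, ⟨K', K, g2, g1, f, hf, g4, g3⟩⟩
  loopless := ⟨fun _ h => h.1 rfl⟩

/-- One step of the process: the new clusters are the unions of the old clusters over the connected
components of the auxiliary graph. -/
def step (H : DoubleKGraph V k) (P : Setoid (KSet V j)) : Setoid (KSet V j) :=
  Setoid.comap (Quotient.mk P) (H.clusterGraph P).reachableSetoid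

/-- The partition of the `j`-sets at time `t`. At time `0` every `j`-set is a cluster of its own.
Once no two clusters are adjacent, or only one cluster is left, the sequence is constant. -/
def partition (H : DoubleKGraph V k) (j t : ℕ) : Setoid (KSet V j) :=
  H.step^[t] ⊥

/-- `H` `j`-percolates: at some time there is exactly one cluster. -/
def Percolates (H : DoubleKGraph V k) (j : ℕ) : Prop :=
  ∃ t : ℕ, Nat.card (Quotient (H.partition j t)) = 1

end DoubleKGraph

/-- The law `H_k(n, p₁, p₂)` of the random binomial double `k`-graph on `n` vertices: every `k`-set
is a red edge with probability `p₁` and a blue edge with probability `p₂`, independently of each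
other and of all other `k`-sets. -/
noncomputable def binomialDoubleKGraph (k n : ℕ) (p₁ p₂ : I) :
    Measure (DoubleKGraph (Fin n) k) :=
  (setBernoulli (Set.univ : Set (KSet (Fin n) k)) p₁).prod
    (setBernoulli (Set.univ : Set (KSet (Fin n) k)) p₂)

/-!
The final partition of the jigsaw process is the finest equivalence relation on the `j`-sets that
is closed under joining two classes by a red and a blue edge, so that `H` percolates if and only if
the trivial relation is the only closed one (`DoubleKGraph.percolates_iff`). Both parts work with
this characterization, and with the fact that events determined by disjoint sets of potential edges
are independent (`binomialDoubleKGraph_coordIndep`).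

**Below the threshold.** When clusters are merged two at a time, their size at most doubles, so a
percolating `H` has, for `l` of order `log n`, a set of between `l` and `2 * l` many `j`-sets that
is connected through red edges and connected through blue edges (`exists_doublyConnected`). It is
witnessed by a connected set of `r` red and a connected set of `b` blue edges, both of order `l`.
The edges of one colour span at most `j + (k - j) * r` vertices, and each edge of the other colour
adds at most `k - j - 1`, because it contains two `j`-sets that are already covered
(`DoubleKGraph.Percolates.exists_witness`). Connected sets of edges are few
(`card_cutConnected_through_le`), and the union bound `real_percolates_le_sum` gives about `n ^ j *
(C * log n * n ^ (2 * k - 2 * j - 1) * p₁ * p₂) ^ max r b`, which tends to `0` if the constant in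
the hypothesis is large. If `r ≠ b`, this needs that both probabilities are at least of order `n ^
(-(k - j))`; if one of them is smaller, the edges of that colour do not cover all `j`-sets
(`real_percolates_le_of_sparse`).

**Above the threshold.** It suffices that any two `j`-sets `insert u L` and `insert v L` end in the
same cluster with probability `1 - O (n ^ (-(j + 2)))` (`real_not_percolates_le`). In the link of
`L`, give a pair of vertices the colour `c` if some edge of colour `c` consists of `L`, the pair,
and vertices of a fixed set `B`. Different pairs use different edges, so this is a pair of
independent random graphs (`linkCoord_coordIndep`), and the problem is reduced to `k = 2`, `j = 1`
with edge probabilities `P₁`, `P₂` such that `P₁ * P₂` is at least a large constant over `n * log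
n` and both are at least a large constant times `log n / n` (`bundle_supercritical`). There
`CoordIndep.not_cluster_le_exp` shows that `u` and `v` are in one cluster:

* A cluster with `s` vertices is adjacent in both colours to a fresh vertex with probability at
  least `(s / l) ^ 2 / 2` while `s ≤ l`, where `l` is a small multiple of `log n`. So a vertex
  grows into a cluster of size `l + 1` with probability `exp (-3 * l) ≥ n ^ (-1 / 4)`, and one of
  `√n` attempts succeeds (`CoordIndep.noSeed_le`).
* The neighbourhood of this cluster in the denser graph is so large that the sparser graph has a
  giant component on it, which joins the cluster (`CoordIndep.not_expands_le`). Doing this once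
  more gives a cluster with a constant proportion of the vertices.
* Finally `u` and `v` have neighbours of both colours in that cluster.

The vertices are divided into levels, one for each step, so that every step uses pairs that have
not been exposed. Conditioning is replaced by the inequalities `CoordIndep.le_sum_cond` and
`CoordIndep.le_add_of_exists`.
-/

/-! ### Jigsaw-closed equivalence relations -/

/-- An equivalence relation `Q` is closed for the jigsaw process of the two relations `r` and `b`
if two of its classes that are joined both by `r` and by `b` (possibly through different
representatives) coincide. -/
def JigsawClosed {β : Type*} (r b : β → β → Prop) (Q : Setoid β) : Prop :=
  ∀ ⦃x x' y y' : β⦄, Q x x' → Q y y' → r x y → b x' y' → Q x y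

/-- The finest jigsaw-closed equivalence relation, that is, the final partition of the process. -/
def jigsawClosure {β : Type*} (r b : β → β → Prop) : Setoid β :=
  sInf {Q | JigsawClosed r b Q}

theorem jigsawClosure_iff {β : Type*} {r b : β → β → Prop} {x y : β} :
    jigsawClosure r b x y ↔ ∀ Q, JigsawClosed r b Q → Q x y := by
  rw [jigsawClosure, Setoid.sInf_def]
  simp [sInf_apply, iInf_apply]

theorem jigsawClosed_jigsawClosure {β : Type*} (r b : β → β → Prop) :
    JigsawClosed r b (jigsawClosure r b) := by
  intro x x' y y' h1 h2 h3 h4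
  rw [jigsawClosure_iff] at *
  exact fun Q hQ => hQ (h1 Q hQ) (h2 Q hQ) h3 h4

theorem JigsawClosed.mono {β : Type*} {r r' b b' : β → β → Prop} {Q : Setoid β}
    (h : JigsawClosed r' b' Q) (hr : ∀ x y, r x y → r' x y) (hb : ∀ x y, b x y → b' x y) :
    JigsawClosed r b Q :=
  fun _ _ _ _ h1 h2 h3 h4 => h h1 h2 (hr _ _ h3) (hb _ _ h4)

theorem JigsawClosed.swap {β : Type*} {r b : β → β → Prop} {Q : Setoid β}
    (h : JigsawClosed r b Q) : JigsawClosed b r Q := by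
  intro x x' y y' h1 h2 h3 h4
  have := h (Q.symm h1) (Q.symm h2) h4 h3
  exact Q.trans h1 (Q.trans this (Q.symm h2))

/-- Two `j`-sets are joined by `E` if a common edge of `E` contains both of them. -/
def EdgeJoined {V : Type*} {k j : ℕ} (E : Set (KSet V k)) (J J' : KSet V j) : Prop :=
  ∃ e ∈ E, J.1 ⊆ e.1 ∧ J'.1 ⊆ e.1

namespace DoubleKGraph

variable {V : Type*} {k j : ℕ}

/-- A partition that is closed for the process is coarser than every stage of it. -/
theorem step_le (H : DoubleKGraph V k) {P Q : Setoid (KSet V j)}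
    (hQ : JigsawClosed (EdgeJoined H.1) (EdgeJoined H.2) Q) (hP : P ≤ Q) : H.step P ≤ Q := by
  intro x y hxy
  have hreach : (H.clusterGraph P).Reachable (Quotient.mk P x) (Quotient.mk P y) := hxy
  obtain ⟨w⟩ := hreach
  have key : ∀ (C D : Quotient P), (H.clusterGraph P).Walk C D →
      ∀ x y, Quotient.mk P x = C → Quotient.mk P y = D → Q x y := by
    intro C D w
    induction w with
    | nil =>
      intro x y hx hy
      exact hP (Quotient.exact (hx.trans hy.symm))
    | cons hadj w ih =>
      rename_i u v w'
      intro x y hx hy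
      obtain ⟨-, ⟨J, J', h1, h2, e, he, h3, h4⟩, ⟨K, K', g1, g2, f, hf, g3, g4⟩⟩ := hadj
      have hJ : Q J J' := hQ (hP (Quotient.exact (h1.trans g1.symm)))
        (hP (Quotient.exact (h2.trans g2.symm))) ⟨e, he, h3, h4⟩ ⟨f, hf, g3, g4⟩
      exact Q.trans (hP (Quotient.exact (hx.trans h1.symm))) (Q.trans hJ (ih J' y h2 hy))
  exact key _ _ w x y rfl rfl

theorem partition_le (H : DoubleKGraph V k) {Q : Setoid (KSet V j)}
    (hQ : JigsawClosed (EdgeJoined H.1) (EdgeJoined H.2) Q) (t : ℕ) : H.partition j t ≤ Q := by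
  induction t with
  | zero => exact bot_le
  | succ t ih =>
    rw [partition, Function.iterate_succ_apply']
    exact H.step_le hQ ih

theorem le_step (H : DoubleKGraph V k) (P : Setoid (KSet V j)) : P ≤ H.step P := by
  intro x y hxy
  have : Quotient.mk P x = Quotient.mk P y := Quotient.sound hxy
  change (H.clusterGraph P).Reachable _ _
  rw [this]

theorem jigsawClosed_of_step_eq (H : DoubleKGraph V k) {P : Setoid (KSet V j)}
    (hP : H.step P = P) : JigsawClosed (EdgeJoined H.1) (EdgeJoined H.2) P := by
  intro x x' y y' h1 h2 ⟨e, he, h3, h4⟩ ⟨f, hf, g3, g4⟩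
  by_cases hne : Quotient.mk P x = Quotient.mk P y
  · exact Quotient.exact hne
  · have hadj : (H.clusterGraph P).Adj (Quotient.mk P x) (Quotient.mk P y) :=
      ⟨hne, ⟨x, y, rfl, rfl, e, he, h3, h4⟩,
        ⟨x', y', (Quotient.sound h1).symm, (Quotient.sound h2).symm, f, hf, g3, g4⟩⟩
    have : H.step P x y := hadj.reachable
    rwa [hP] at this

/-- Percolation means that the trivial partition is the only one that is closed for the process. -/
theorem percolates_iff [Finite V] [Nonempty (KSet V j)] (H : DoubleKGraph V k) :
    H.Percolates j ↔
      ∀ Q : Setoid (KSet V j), JigsawClosed (EdgeJoined H.1) (EdgeJoined H.2) Q → Q = ⊤ := by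
  constructor
  · rintro ⟨t, ht⟩ Q hQ
    rw [eq_top_iff]
    refine le_trans ?_ (H.partition_le hQ t)
    intro x y _
    have : Subsingleton (Quotient (H.partition j t)) := (Nat.card_eq_one_iff_unique.1 ht).1
    exact Quotient.exact (Subsingleton.elim _ _)
  · intro h
    have hfin : Finite (Setoid (KSet V j)) :=
      Finite.of_injective (fun s : Setoid (KSet V j) => (fun x y => s x y))
        (fun s t hst => Setoid.ext fun x y => by
          have := congrFun (congrFun hst x) y
          exact iff_of_eq this)
    have hmono : Monotone (fun t => H.partition j t) := by
      refine monotone_nat_of_le_succ fun t => ?_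
      simp only [partition]
      rw [Function.iterate_succ_apply']
      exact H.le_step _
    obtain ⟨t, ht⟩ := WellFoundedGT.monotone_chain_condition ⟨_, hmono⟩
    refine ⟨t, ?_⟩
    have hst : H.step (H.partition j t) = H.partition j t := by
      have := ht (t + 1) (Nat.le_succ t)
      simp only [OrderHom.coe_mk, partition] at this
      rw [Function.iterate_succ_apply'] at this
      exact this.symm
    rw [h _ (H.jigsawClosed_of_step_eq hst), Nat.card_eq_one_iff_unique]
    exact ⟨⟨fun a b => Quotient.inductionOn₂ a b fun x y => Quotient.sound trivial⟩,
      ⟨Quotient.mk _ (Classical.arbitrary _)⟩⟩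

end DoubleKGraph

/-! ### Events determined by independent coordinates -/

/-- The event `E` depends only on the coordinates `X i` with `i ∈ S`. -/
def DetBy {Ω ι : Type*} (X : ι → Ω → Prop) (S : Set ι) (E : Set Ω) : Prop :=
  ∀ ω ω' : Ω, (∀ i ∈ S, X i ω ↔ X i ω') → (ω ∈ E ↔ ω' ∈ E)

/-- The coordinates `X i` are independent: events determined by disjoint sets of coordinates are
independent. It is meant for spaces on which every set is measurable. -/
def CoordIndep {Ω ι : Type*} [MeasurableSpace Ω] (X : ι → Ω → Prop) (μ : Measure Ω) : Prop :=
  ∀ (S T : Set ι) (E F : Set Ω), Disjoint S T → DetBy X S E → DetBy X T F →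
    μ.real (E ∩ F) = μ.real E * μ.real F

section

variable {Ω ι : Type*} {X : ι → Ω → Prop}

theorem DetBy.mono {S T : Set ι} {E : Set Ω} (h : DetBy X S E) (hST : S ⊆ T) : DetBy X T E :=
  fun ω ω' hω => h ω ω' fun i hi => hω i (hST hi)

theorem DetBy.compl {S : Set ι} {E : Set Ω} (h : DetBy X S E) : DetBy X S Eᶜ :=
  fun ω ω' hω => not_congr (h ω ω' hω)

theorem DetBy.biInter {κ : Type*} {S : Set ι} {E : κ → Set Ω} {T : Set κ}
    (h : ∀ t ∈ T, DetBy X S (E t)) : DetBy X S (⋂ t ∈ T, E t) := by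
  intro ω ω' hω
  simp only [Set.mem_iInter]
  exact forall₂_congr fun t ht => h t ht ω ω' hω

theorem detBy_coord (i : ι) : DetBy X {i} {ω | X i ω} :=
  fun _ _ h => h i rfl

variable [MeasurableSpace Ω] {μ : Measure Ω}

/-- Independence passes to the coordinates "some `X i` with `i` in the bundle holds" if the bundles
are disjoint. -/
theorem CoordIndep.bundle {κ : Type*} (h : CoordIndep X μ) (B : κ → Set ι)
    (hB : Pairwise (Function.onFun Disjoint B)) :
    CoordIndep (fun t ω => ∃ i ∈ B t, X i ω) μ := by
  intro S T E F hST hE hF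
  have key : ∀ (S : Set κ) (E : Set Ω), DetBy (fun t ω => ∃ i ∈ B t, X i ω) S E →
      DetBy X (⋃ t ∈ S, B t) E := by
    intro S E hE ω ω' hω
    refine hE ω ω' fun t ht => exists_congr fun i => and_congr_right fun hi => hω i ?_
    exact Set.mem_biUnion ht hi
  refine h _ _ E F ?_ (key S E hE) (key T F hF)
  simp only [Set.disjoint_iUnion_left, Set.disjoint_iUnion_right]
  intro t ht s hs
  refine hB ?_
  rintro rfl
  exact Set.disjoint_left.1 hST hs ht

variable [IsProbabilityMeasure μ]

theorem CoordIndep.biInter {κ : Type*} (h : CoordIndep X μ) (T : Finset κ)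
    (S : κ → Set ι) (E : κ → Set Ω) (hS : (T : Set κ).PairwiseDisjoint S)
    (hE : ∀ t ∈ T, DetBy X (S t) (E t)) :
    μ.real (⋂ t ∈ T, E t) = ∏ t ∈ T, μ.real (E t) := by
  classical
  induction T using Finset.induction_on with
  | empty => simp
  | insert a T ha ih =>
    rw [Finset.prod_insert ha, ← ih (hS.subset (by simp)) fun t ht => hE t (by simp [ht])]
    rw [Finset.set_biInter_insert]
    refine h (S a) (⋃ t ∈ T, S t) _ _ ?_ (hE a (by simp)) ?_
    · simp only [Set.disjoint_iUnion_right]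
      intro t ht
      exact hS (by simp) (by simp [ht]) (fun hat => ha (hat ▸ ht))
    · refine DetBy.biInter (T := (T : Set κ)) fun t ht => ?_
      exact (hE t (by simp [Finset.mem_coe.1 ht])).mono
        (Set.subset_biUnion_of_mem (u := S) (Finset.mem_coe.1 ht))

/-- All of the coordinates in `T` hold. -/
theorem CoordIndep.all_coord (h : CoordIndep X μ) (T : Finset ι) :
    μ.real {ω | ∀ t ∈ T, X t ω} = ∏ t ∈ T, μ.real {ω | X t ω} := by
  have : {ω | ∀ t ∈ T, X t ω} = ⋂ t ∈ T, {ω | X t ω} := by ext; simp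
  rw [this]
  refine h.biInter T (fun i => {i}) (fun i => {ω | X i ω}) ?_ (fun t _ => detBy_coord t)
  intro a _ b _ hab
  simpa using hab

/-- Deferred decisions: expose a random variable `T` that depends on the coordinates in `S`, and
bound the rest of the event `E` by an event determined by other coordinates, for each value of
`T`. -/
theorem CoordIndep.le_sum_cond {τ : Type*} [Fintype τ] (h : CoordIndep X μ)
    {S : Set ι} {T : Ω → τ} (hT : ∀ ω ω', (∀ i ∈ S, X i ω ↔ X i ω') → T ω = T ω')
    {S' : τ → Set ι} (hS : ∀ t, Disjoint S (S' t)) {F : τ → Set Ω}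
    (hF : ∀ t, DetBy X (S' t) (F t)) {E : Set Ω} (hE : ∀ ω ∈ E, ω ∈ F (T ω)) :
    μ.real E ≤ ∑ t, μ.real {ω | T ω = t} * μ.real (F t) := by
  have hsub : E ⊆ ⋃ t ∈ (Finset.univ : Finset τ), ({ω | T ω = t} ∩ F t) := by
    intro ω hω
    simpa using hE ω hω
  refine (measureReal_mono hsub (measure_ne_top _ _)).trans
    ((measureReal_biUnion_finset_le _ _).trans ?_)
  refine Finset.sum_le_sum fun t _ => (h S (S' t) _ _ (hS t) ?_ (hF t)).le
  intro ω ω' hω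
  simp [hT ω ω' hω]

variable [DiscreteMeasurableSpace Ω]

theorem measureReal_compl' (E : Set Ω) : μ.real Eᶜ = 1 - μ.real E :=
  probReal_compl_eq_one_sub (MeasurableSet.of_discrete)

/-- None of independent events, each of probability at least `g`, happens. -/
theorem CoordIndep.none_le {κ : Type*} (h : CoordIndep X μ) (T : Finset κ)
    (S : κ → Set ι) (E : κ → Set Ω) (hS : (T : Set κ).PairwiseDisjoint S)
    (hE : ∀ t ∈ T, DetBy X (S t) (E t)) {g : ℝ} (hg : ∀ t ∈ T, g ≤ μ.real (E t)) :
    μ.real {ω | ∀ t ∈ T, ω ∉ E t} ≤ (1 - g) ^ T.card := by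
  have : {ω | ∀ t ∈ T, ω ∉ E t} = ⋂ t ∈ T, (E t)ᶜ := by ext; simp
  rw [this, h.biInter T S _ hS fun t ht => (hE t ht).compl, ← Finset.prod_const]
  refine Finset.prod_le_prod (fun _ _ => measureReal_nonneg) fun t ht => ?_
  rw [measureReal_compl']
  linarith [hg t ht]

/-- None of the coordinates in `T` holds. -/
theorem CoordIndep.none_coord_le (h : CoordIndep X μ) (T : Finset ι) {p : ℝ}
    (hp : ∀ t ∈ T, p ≤ μ.real {ω | X t ω}) :
    μ.real {ω | ∀ t ∈ T, ¬ X t ω} ≤ (1 - p) ^ T.card := by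
  refine h.none_le T (fun i => {i}) (fun i => {ω | X i ω}) ?_ (fun t _ => detBy_coord t) hp
  intro a _ b _ hab
  simpa using hab

theorem sum_measureReal_fiber {τ : Type*} [Fintype τ] (T : Ω → τ) :
    ∑ t, μ.real {ω | T ω = t} = 1 := by
  classical
  have := measureReal_biUnion_finset (μ := μ) (s := (Finset.univ : Finset τ))
    (f := fun t => {ω | T ω = t}) (fun a _ b _ hab => by
      rw [Function.onFun, Set.disjoint_left]
      rintro ω h1 h2
      exact hab (h1.symm.trans h2)) (fun _ _ => MeasurableSet.of_discrete)
  rw [← this, show (⋃ t ∈ (Finset.univ : Finset τ), {ω | T ω = t}) = Set.univ by ext; simp]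
  simp

/-- Deferred decisions with a bound that is uniform over the exposed value. -/
theorem CoordIndep.le_of_cond {τ : Type*} [Finite τ] (h : CoordIndep X μ)
    {S : Set ι} {T : Ω → τ} (hT : ∀ ω ω', (∀ i ∈ S, X i ω ↔ X i ω') → T ω = T ω')
    {S' : τ → Set ι} (hS : ∀ t, Disjoint S (S' t)) {F : τ → Set Ω}
    (hF : ∀ t, DetBy X (S' t) (F t)) {E : Set Ω} (hE : ∀ ω ∈ E, ω ∈ F (T ω)) {β : ℝ}
    (hβ : ∀ t, μ.real (F t) ≤ β) : μ.real E ≤ β := by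
  have := Fintype.ofFinite τ
  refine (h.le_sum_cond hT hS hF hE).trans ?_
  calc _ ≤ ∑ t, μ.real {ω | T ω = t} * β :=
        Finset.sum_le_sum fun t _ => mul_le_mul_of_nonneg_left (hβ t) measureReal_nonneg
    _ = β := by rw [← Finset.sum_mul, sum_measureReal_fiber, one_mul]

open Classical in
/-- Chernoff-type bound for the number of independent events that happen. -/
theorem CoordIndep.count_lt_le {κ : Type*} (h : CoordIndep X μ) (W : Finset κ)
    (S : κ → Set ι) (E : κ → Set Ω) (hS : (W : Set κ).PairwiseDisjoint S)
    (hE : ∀ t ∈ W, DetBy X (S t) (E t)) {g : ℝ} (hg : ∀ t ∈ W, g ≤ μ.real (E t))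
    (hg1 : g ≤ 1) (m : ℕ) :
    μ.real {ω | (W.filter fun w => ω ∈ E w).card < m} ≤ 2 ^ m * (1 - g / 2) ^ W.card := by
  induction W using Finset.induction_on generalizing m with
  | empty =>
    simp only [Finset.filter_empty, Finset.card_empty, pow_zero, mul_one]
    exact measureReal_le_one.trans (one_le_pow₀ (by norm_num))
  | insert a W ha ih =>
    have hS' := hS.subset (show (W : Set κ) ⊆ _ by simp)
    have ih := ih hS' (fun t ht => hE t (by simp [ht])) (fun t ht => hg t (by simp [ht]))
    have hdet : ∀ m, DetBy X (⋃ t ∈ W, S t) {ω | (W.filter fun w => ω ∈ E w).card < m} := by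
      intro m ω ω' hω
      have : (W.filter fun w => ω ∈ E w) = W.filter fun w => ω' ∈ E w := by
        refine Finset.filter_congr fun w hw => ?_
        refine hE w (by simp [hw]) ω ω' fun i hi => hω i ?_
        exact Set.mem_biUnion (Finset.mem_coe.2 hw) hi
      simp [this]
    have hdis : Disjoint (S a) (⋃ t ∈ W, S t) := by
      simp only [Set.disjoint_iUnion_right]
      intro t ht
      exact hS (by simp) (by simp [ht]) (fun hat => ha (hat ▸ ht))
    have ha1 := hg a (by simp)
    have ha2 : μ.real (E a) ≤ 1 := measureReal_le_one
    have hρ : 0 ≤ (1 - g / 2) ^ W.card := pow_nonneg (by linarith) _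
    rw [Finset.card_insert_of_notMem ha, pow_succ]
    cases m with
    | zero =>
      simp only [not_lt_zero, Set.ofPred_false, measureReal_empty, pow_zero, one_mul]
      exact mul_nonneg hρ (by linarith)
    | succ m =>
      have hsub : {ω | ((insert a W).filter fun w => ω ∈ E w).card < m + 1} ⊆
          (E a ∩ {ω | (W.filter fun w => ω ∈ E w).card < m}) ∪
          ((E a)ᶜ ∩ {ω | (W.filter fun w => ω ∈ E w).card < m + 1}) := by
        intro ω hω
        simp only [Set.mem_ofPred_eq, Finset.filter_insert] at hω
        by_cases hωa : ω ∈ E a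
        · rw [if_pos hωa, Finset.card_insert_of_notMem (by simp [ha])] at hω
          exact Or.inl ⟨hωa, by simp; omega⟩
        · rw [if_neg hωa] at hω
          exact Or.inr ⟨hωa, hω⟩
      refine (measureReal_mono hsub).trans ((measureReal_union_le _ _).trans ?_)
      rw [h _ _ _ _ hdis (hE a (by simp)) (hdet m),
        h _ _ _ _ hdis (hE a (by simp)).compl (hdet (m + 1)), measureReal_compl']
      have h1 := ih m
      have h2 := ih (m + 1)
      calc _ ≤ μ.real (E a) * (2 ^ m * (1 - g / 2) ^ W.card) +
            (1 - μ.real (E a)) * (2 ^ (m + 1) * (1 - g / 2) ^ W.card) := by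
            gcongr
        _ = 2 ^ (m + 1) * (1 - g / 2) ^ W.card * (1 - μ.real (E a) / 2) := by ring
        _ ≤ 2 ^ (m + 1) * (1 - g / 2) ^ W.card * (1 - g / 2) := by gcongr
        _ = _ := by ring

end

/-! ### The random double hypergraph as a family of independent coordinates -/

/-- The coordinate `(c, e)` of a double `k`-graph says that `e` is an edge of colour `c`, where
`true` stands for red and `false` for blue. -/
def edgeCoord {V : Type*} {k : ℕ} (i : Bool × KSet V k) (H : DoubleKGraph V k) : Prop :=
  i.2 ∈ cond i.1 H.1 H.2

/-- The law of a truth value that is true with probability `p`. -/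
noncomputable def bernoulliProp (p : I) : Measure Prop :=
  unitInterval.toNNReal p • Measure.dirac True + unitInterval.toNNReal (σ p) • Measure.dirac False

instance (p : I) : IsProbabilityMeasure (bernoulliProp p) := by
  constructor
  simp [bernoulliProp]

theorem setBernoulli_univ_forall {α : Type*} [Finite α] (p : I) (s : α → Set Prop) :
    setBernoulli (Set.univ : Set α) p {E | ∀ e, (e ∈ E) ∈ s e} =
      ∏ᶠ e, bernoulliProp p (s e) := by
  have := Fintype.ofFinite α
  rw [setBernoulli_apply', finprod_eq_prod_of_fintype]
  have hset : ((fun p : α → Prop => {i | p i}) ⁻¹' {E | ∀ e, (e ∈ E) ∈ s e}) =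
      Set.pi (Finset.univ : Finset α) s := by
    ext f
    simp
  rw [hset, Measure.infinitePi_pi]
  · simp [bernoulliProp]
  · intro i _
    exact MeasurableSet.of_discrete

theorem binomialDoubleKGraph_forall {k n : ℕ} (p₁ p₂ : I) (s : Bool × KSet (Fin n) k → Set Prop) :
    binomialDoubleKGraph k n p₁ p₂ {H | ∀ i, edgeCoord i H ∈ s i} =
      ∏ i : Bool × KSet (Fin n) k, bernoulliProp (cond i.1 p₁ p₂) (s i) := by
  have hset : {H : DoubleKGraph (Fin n) k | ∀ i, edgeCoord i H ∈ s i} =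
      {E | ∀ e, (e ∈ E) ∈ s (true, e)} ×ˢ {E | ∀ e, (e ∈ E) ∈ s (false, e)} := by
    ext H
    simp [edgeCoord, and_comm]
  rw [hset, binomialDoubleKGraph, Measure.prod_prod, setBernoulli_univ_forall,
    setBernoulli_univ_forall, finprod_eq_prod_of_fintype, finprod_eq_prod_of_fintype,
    Fintype.prod_prod_type, Fintype.prod_bool]
  rfl

instance {k n : ℕ} (p₁ p₂ : I) : IsProbabilityMeasure (binomialDoubleKGraph k n p₁ p₂) := by
  unfold binomialDoubleKGraph
  infer_instance

theorem map_edgeCoord {k n : ℕ} (p₁ p₂ : I) :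
    (binomialDoubleKGraph k n p₁ p₂).map (fun H i => edgeCoord i H) =
      Measure.pi fun i : Bool × KSet (Fin n) k => bernoulliProp (cond i.1 p₁ p₂) := by
  refine (Measure.pi_eq fun s hs => ?_).symm
  rw [Measure.map_apply (measurable_of_finite _) MeasurableSet.of_discrete,
    ← binomialDoubleKGraph_forall]
  congr 1
  ext H
  simp

theorem binomialDoubleKGraph_coordIndep {k n : ℕ} (p₁ p₂ : I) :
    CoordIndep (edgeCoord (V := Fin n) (k := k)) (binomialDoubleKGraph k n p₁ p₂) := by
  classical
  have hpi : iIndepFun (fun (i : Bool × KSet (Fin n) k) (f : Bool × KSet (Fin n) k → Prop) => f i)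
      (Measure.pi fun i : Bool × KSet (Fin n) k =>
        bernoulliProp (cond i.1 p₁ p₂)) :=
    iIndepFun_pi (X := fun _ => id) fun i => aemeasurable_id
  intro S T E F hST hE hF
  set ν := Measure.pi fun i : Bool × KSet (Fin n) k =>
        bernoulliProp (cond i.1 p₁ p₂) with hν
  have hpre : ∀ (S : Set (Bool × KSet (Fin n) k)) (E : Set (DoubleKGraph (Fin n) k)),
      DetBy edgeCoord S E →
      ∃ A : Set (S.toFinset → Prop), E = (fun H i => edgeCoord i H) ⁻¹'
        ((fun (f : Bool × KSet (Fin n) k → Prop) (i : S.toFinset) => f i) ⁻¹' A) := by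
    intro S E hE
    refine ⟨(fun H (i : S.toFinset) => edgeCoord i.1 H) '' E, ?_⟩
    ext H
    simp only [Set.mem_preimage, Set.mem_image]
    constructor
    · exact fun h => ⟨H, h, rfl⟩
    · rintro ⟨H', h', hHH⟩
      refine (hE H' H fun i hi => ?_).1 h'
      exact iff_of_eq (congrFun hHH ⟨i, by simpa using hi⟩)
  obtain ⟨A, hA⟩ := hpre S E hE
  obtain ⟨B, hB⟩ := hpre T F hF
  have hind := hpi.indepFun_finset S.toFinset T.toFinset (by simpa using hST)
    (fun i => measurable_pi_apply i)
  have hval : ∀ D : Set (Bool × KSet (Fin n) k → Prop),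
      (binomialDoubleKGraph k n p₁ p₂) ((fun H i => edgeCoord i H) ⁻¹' D) = ν D := by
    intro D
    rw [hν, ← map_edgeCoord, Measure.map_apply (measurable_of_finite _) MeasurableSet.of_discrete]
  simp only [measureReal_def]
  rw [hA, hB, ← Set.preimage_inter, hval, hval, hval, ← ENNReal.toReal_mul]
  congr 1
  exact hind.measure_inter_preimage_eq_mul _ _ MeasurableSet.of_discrete MeasurableSet.of_discrete

theorem binomialDoubleKGraph_real_coord {k n : ℕ} (p₁ p₂ : I) (i : Bool × KSet (Fin n) k) :
    (binomialDoubleKGraph k n p₁ p₂).real {H | edgeCoord i H} = (cond i.1 p₁ p₂ : I) := by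
  classical
  have h := binomialDoubleKGraph_forall (k := k) (n := n) p₁ p₂
    (fun i' => if i' = i then {True} else Set.univ)
  have hset : {H : DoubleKGraph (Fin n) k | ∀ i', edgeCoord i' H ∈
      (if i' = i then {True} else Set.univ : Set Prop)} = {H | edgeCoord i H} := by
    ext H
    simp only [Set.mem_ofPred_eq]
    constructor
    · intro h
      simpa using h i
    · intro h i'
      split_ifs with hi
      · subst hi; simpa using h
      · trivial
  rw [hset] at h
  rw [measureReal_def, h, Finset.prod_eq_single i]
  · simp [bernoulliProp]
  · intro b _ hb
    rw [if_neg hb]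
    exact measure_univ
  · simp

/-! ### Doubly connected sets of `j`-sets and the edges that witness them -/

/-- The finite set `S` is connected for the relation `adj`, expressed through cuts: every proper
nonempty subset has a neighbour in `S` outside itself. -/
def CutConnected {β : Type*} (adj : β → β → Prop) (S : Finset β) : Prop :=
  ∀ A ⊆ S, A.Nonempty → A ≠ S → ∃ a ∈ A, ∃ b ∈ S, b ∉ A ∧ adj a b

theorem cutConnected_singleton {β : Type*} (adj : β → β → Prop) (x : β) :
    CutConnected adj {x} := by
  intro A hA hne hneq
  rcases Finset.subset_singleton_iff.1 hA with h | h
  · exact absurd h hne.ne_empty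
  · exact absurd h hneq

theorem CutConnected.union {β : Type*} [DecidableEq β] {adj : β → β → Prop} {S T : Finset β}
    (hsymm : ∀ x y, adj x y → adj y x) (hS : CutConnected adj S) (hT : CutConnected adj T)
    {x y : β} (hx : x ∈ S) (hy : y ∈ T) (hxy : x = y ∨ adj x y) : CutConnected adj (S ∪ T) := by
  intro A hA hne hneq
  have key : ∀ U : Finset β, U ⊆ S ∪ T → CutConnected adj U → (A ∩ U).Nonempty → ¬ U ⊆ A →
      ∃ a ∈ A, ∃ b ∈ S ∪ T, b ∉ A ∧ adj a b := by
    intro U hU hconn h1 h2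
    obtain ⟨a, ha, b, hb, hbA, hab⟩ := hconn (A ∩ U) Finset.inter_subset_right h1
      (fun h => h2 (h ▸ Finset.inter_subset_left))
    simp only [Finset.mem_inter, not_and] at ha hbA
    exact ⟨a, ha.1, b, hU hb, fun h => hbA h hb, hab⟩
  by_cases h1 : (A ∩ S).Nonempty
  · by_cases h2 : S ⊆ A
    · by_cases h3 : (A ∩ T).Nonempty
      · by_cases h4 : T ⊆ A
        · exact absurd (Finset.Subset.antisymm hA (Finset.union_subset h2 h4)) hneq
        · exact key T Finset.subset_union_right hT h3 h4
      · have hyA : y ∉ A := fun h => h3 ⟨y, Finset.mem_inter.2 ⟨h, hy⟩⟩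
        rcases hxy with rfl | hxy
        · exact absurd (h2 hx) hyA
        · exact ⟨x, h2 hx, y, Finset.mem_union_right _ hy, hyA, hxy⟩
    · exact key S Finset.subset_union_left hS h1 h2
  · obtain ⟨a, ha⟩ := hne
    have haT : a ∈ T := (Finset.mem_union.1 (hA ha)).resolve_left
      fun h => h1 ⟨a, Finset.mem_inter.2 ⟨ha, h⟩⟩
    by_cases h4 : T ⊆ A
    · have hxA : x ∉ A := fun h => h1 ⟨x, Finset.mem_inter.2 ⟨h, hx⟩⟩
      rcases hxy with rfl | hxy
      · exact absurd (h4 hy) hxA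
      · exact ⟨y, h4 hy, x, Finset.mem_union_left _ hx, hxA, hsymm _ _ hxy⟩
    · exact key T Finset.subset_union_right hT ⟨a, Finset.mem_inter.2 ⟨ha, haT⟩⟩ h4

/-- If the trivial relation is the only jigsaw-closed one, then there are sets of any prescribed
order of magnitude that are connected for both relations: a union of two overlapping or joined
doubly connected sets is doubly connected, and its size at most doubles. -/
theorem exists_doublyConnected {β : Type*} [Fintype β] [DecidableEq β] {r b : β → β → Prop}
    (hr : ∀ x y, r x y → r y x) (hb : ∀ x y, b x y → b y x)
    (h : ∀ Q, JigsawClosed r b Q → Q = ⊤) {l : ℕ} (hl : 2 ≤ l) (hl' : l ≤ Fintype.card β) :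
    ∃ S : Finset β, CutConnected r S ∧ CutConnected b S ∧ l ≤ S.card ∧ S.card < 2 * l := by
  by_contra hcon
  push Not at hcon
  have hunion : ∀ S T : Finset β, CutConnected r S ∧ CutConnected b S ∧ S.card < l →
      CutConnected r T ∧ CutConnected b T ∧ T.card < l →
      (∃ x ∈ S, ∃ y ∈ T, x = y ∨ r x y) → (∃ x ∈ S, ∃ y ∈ T, x = y ∨ b x y) →
      CutConnected r (S ∪ T) ∧ CutConnected b (S ∪ T) ∧ (S ∪ T).card < l := by
    rintro S T ⟨hS1, hS2, hS3⟩ ⟨hT1, hT2, hT3⟩ ⟨x, hx, y, hy, hxy⟩ ⟨x', hx', y', hy', hxy'⟩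
    have h1 := hS1.union hr hT1 hx hy hxy
    have h2 := hS2.union hb hT2 hx' hy' hxy'
    refine ⟨h1, h2, ?_⟩
    by_contra h3
    have := hcon _ h1 h2 (not_lt.1 h3)
    have := Finset.card_union_le S T
    omega
  let Q : Setoid β :=
    { r := fun x y => ∃ S : Finset β, (CutConnected r S ∧ CutConnected b S ∧ S.card < l) ∧
        x ∈ S ∧ y ∈ S
      iseqv :=
        { refl := fun x => ⟨{x}, ⟨cutConnected_singleton _ _, cutConnected_singleton _ _, by
            rw [Finset.card_singleton]; omega⟩, by simp, by simp⟩
          symm := fun ⟨S, hS, hx, hy⟩ => ⟨S, hS, hy, hx⟩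
          trans := by
            rintro x y z ⟨S, hS, hx, hy⟩ ⟨T, hT, hy', hz⟩
            exact ⟨S ∪ T, hunion S T hS hT ⟨y, hy, y, hy', Or.inl rfl⟩ ⟨y, hy, y, hy', Or.inl rfl⟩,
              Finset.mem_union_left _ hx, Finset.mem_union_right _ hz⟩ } }
  have hQ : JigsawClosed r b Q := by
    rintro x x' y y' ⟨S, hS, hx, hx'⟩ ⟨T, hT, hy, hy'⟩ h3 h4
    exact ⟨S ∪ T, hunion S T hS hT ⟨x, hx, y, hy, Or.inr h3⟩ ⟨x', hx', y', hy', Or.inr h4⟩,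
      Finset.mem_union_left _ hx, Finset.mem_union_right _ hy⟩
  have htop := h Q hQ
  have : Nonempty β := Fintype.card_pos_iff.1 (by omega)
  obtain ⟨x⟩ := this
  have hall : ∀ T : Finset β, ∃ S : Finset β,
      (CutConnected r S ∧ CutConnected b S ∧ S.card < l) ∧ x ∈ S ∧ T ⊆ S := by
    intro T
    induction T using Finset.induction_on with
    | empty =>
      obtain ⟨S, hS, hx, -⟩ := Q.refl x
      exact ⟨S, hS, hx, by simp⟩
    | insert y T _ ih =>
      obtain ⟨S, hS, hx, hT⟩ := ih
      have hxy : Q x y := by rw [htop]; trivial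
      obtain ⟨S', hS', hx', hy'⟩ := hxy
      refine ⟨S ∪ S', hunion S S' hS hS' ⟨x, hx, x, hx', Or.inl rfl⟩ ⟨x, hx, x, hx', Or.inl rfl⟩,
        Finset.mem_union_left _ hx, ?_⟩
      exact Finset.insert_subset (Finset.mem_union_right _ hy')
        (hT.trans Finset.subset_union_left)
  obtain ⟨S, ⟨-, -, hS⟩, -, hsub⟩ := hall Finset.univ
  have := Finset.card_le_card hsub
  rw [Finset.card_univ] at this
  omega

/-- Two `k`-sets are `j`-adjacent if they share at least `j` vertices. -/
def ShareAtLeast {V : Type*} [DecidableEq V] {k : ℕ} (j : ℕ) (e f : KSet V k) : Prop :=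
  j ≤ (e.1 ∩ f.1).card

/-- The set of vertices covered by a set of edges. -/
def edgeSpan {V : Type*} [DecidableEq V] {k : ℕ} (R : Finset (KSet V k)) : Finset V :=
  R.biUnion Subtype.val

section

variable {V : Type*} [DecidableEq V] {k j : ℕ}

/-- A set `S` of `j`-sets that is connected through edges of `E` is connected through few of them:
each new edge reaches a new `j`-set of `S`, and it adds at most `k - j` new vertices. -/
theorem exists_connecting_edges (hjk : j ≤ k) {E : Set (KSet V k)} {S : Finset (KSet V j)}
    (hS : CutConnected (EdgeJoined E) S) (h2 : 2 ≤ S.card) :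
    ∃ R : Finset (KSet V k), (R : Set (KSet V k)) ⊆ E ∧ R.card + 1 ≤ S.card ∧
      (∀ J ∈ S, ∃ e ∈ R, J.1 ⊆ e.1) ∧
      (∀ e ∈ R, ∃ J ∈ S, ∃ J' ∈ S, J ≠ J' ∧ J.1 ⊆ e.1 ∧ J'.1 ⊆ e.1) ∧
      CutConnected (ShareAtLeast j) R ∧ (edgeSpan R).card ≤ j + (k - j) * R.card := by
  classical
  have key : ∀ m, 2 ≤ m → m ≤ S.card → ∃ A ⊆ S, A.card = m ∧
      ∃ R : Finset (KSet V k), (R : Set (KSet V k)) ⊆ E ∧ R.card + 1 ≤ m ∧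
      (∀ J ∈ A, ∃ e ∈ R, J.1 ⊆ e.1) ∧
      (∀ e ∈ R, ∃ J ∈ S, ∃ J' ∈ S, J ≠ J' ∧ J.1 ⊆ e.1 ∧ J'.1 ⊆ e.1) ∧
      CutConnected (ShareAtLeast j) R ∧ (edgeSpan R).card ≤ j + (k - j) * R.card := by
    intro m hm
    induction m, hm using Nat.le_induction with
    | base =>
      intro _
      obtain ⟨J₀, hJ₀⟩ := Finset.card_pos.1 (by omega : 0 < S.card)
      obtain ⟨J, hJ, J', hJ', hne, e, he, h3, h4⟩ := hS {J₀} (by simpa using hJ₀) (by simp)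
        (by rintro rfl; simp at h2)
      rw [Finset.mem_singleton] at hJ
      subst hJ
      have hne' : J ≠ J' := fun h => hne (by simp [h])
      refine ⟨{J, J'}, ?_, Finset.card_pair hne', {e}, by simpa using he, by simp, ?_, ?_,
        cutConnected_singleton _ _, ?_⟩
      · intro x hx
        simp only [Finset.mem_insert, Finset.mem_singleton] at hx
        rcases hx with rfl | rfl
        · exact hJ₀
        · exact hJ'
      · intro x hx
        simp only [Finset.mem_insert, Finset.mem_singleton] at hx
        rcases hx with rfl | rfl
        · exact ⟨e, by simp, h3⟩
        · exact ⟨e, by simp, h4⟩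
      · intro f hf
        rw [Finset.mem_singleton] at hf
        subst hf
        exact ⟨J, hJ₀, J', hJ', hne', h3, h4⟩
      · simp only [edgeSpan, Finset.singleton_biUnion, Finset.card_singleton, e.2]
        omega
    | succ m hm ih =>
      intro hmS
      obtain ⟨A, hAS, hA, R, hRE, hRm, hcov, htwo, hconn, hspan⟩ := ih (by omega)
      obtain ⟨J, hJ, J', hJ', hne, e, he, h3, h4⟩ := hS A hAS (Finset.card_pos.1 (by omega))
        (by rintro rfl; omega)
      refine ⟨insert J' A, Finset.insert_subset hJ' hAS, ?_, insert e R, ?_, ?_, ?_, ?_, ?_, ?_⟩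
      · rw [Finset.card_insert_of_notMem hne, hA]
      · intro x hx
        simp only [Finset.coe_insert, Set.mem_insert_iff] at hx
        rcases hx with rfl | hx
        · exact he
        · exact hRE hx
      · have := Finset.card_insert_le e R
        omega
      · intro x hx
        rcases Finset.mem_insert.1 hx with rfl | hx
        · exact ⟨e, by simp, h4⟩
        · obtain ⟨f, hf, hxf⟩ := hcov x hx
          exact ⟨f, by simp [hf], hxf⟩
      · intro f hf
        rcases Finset.mem_insert.1 hf with rfl | hf
        · exact ⟨J, hAS hJ, J', hJ', fun h => hne (h ▸ hJ), h3, h4⟩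
        · exact htwo f hf
      · obtain ⟨f, hf, hJf⟩ := hcov J hJ
        rw [Finset.insert_eq]
        refine (cutConnected_singleton _ e).union ?_ hconn (Finset.mem_singleton_self e) hf
          (Or.inr ?_)
        · intro x y h
          rwa [ShareAtLeast, Finset.inter_comm]
        · have := Finset.card_le_card (Finset.subset_inter h3 hJf)
          rwa [J.2] at this
      · obtain ⟨f, hf, hJf⟩ := hcov J hJ
        by_cases heR : e ∈ R
        · rwa [Finset.insert_eq_self.2 heR]
        · rw [Finset.card_insert_of_notMem heR, edgeSpan, Finset.biUnion_insert]
          have h5 : (e.1 ∪ edgeSpan R) = edgeSpan R ∪ (e.1 \ J.1) := by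
            ext v
            simp only [Finset.mem_union, Finset.mem_sdiff]
            have : v ∈ J.1 → v ∈ edgeSpan R := fun h => Finset.mem_biUnion.2 ⟨f, hf, hJf h⟩
            tauto
          have h6 : (e.1 \ J.1).card = k - j := by
            rw [Finset.card_sdiff_of_subset h3, e.2, J.2]
          have := Finset.card_union_le (edgeSpan R) (e.1 \ J.1)
          rw [← h5, h6] at this
          change (e.1 ∪ edgeSpan R).card ≤ _
          rw [mul_add, mul_one]
          omega
  obtain ⟨A, hAS, hA, R, h1, h3, h4, h5⟩ := key S.card h2 le_rfl
  rw [Finset.eq_of_subset_of_card_le hAS hA.ge] at h4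
  exact ⟨R, h1, h3, h4, h5⟩

/-- Edges that contain two of the `j`-sets covered by `R` add at most `k - j - 1` vertices each. -/
theorem card_edgeSpan_union_le (hjk : j < k) {R B : Finset (KSet V k)} {S : Finset (KSet V j)}
    (hR : ∀ J ∈ S, ∃ e ∈ R, J.1 ⊆ e.1)
    (hB : ∀ e ∈ B, ∃ J ∈ S, ∃ J' ∈ S, J ≠ J' ∧ J.1 ⊆ e.1 ∧ J'.1 ⊆ e.1) :
    (edgeSpan R ∪ edgeSpan B).card + B.card ≤ (edgeSpan R).card + (k - j) * B.card := by
  have hsub : ∀ J ∈ S, J.1 ⊆ edgeSpan R := fun J hJ => by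
    obtain ⟨e, he, hJe⟩ := hR J hJ
    exact hJe.trans (Finset.subset_biUnion_of_mem Subtype.val he)
  have h1 : edgeSpan R ∪ edgeSpan B = edgeSpan R ∪ B.biUnion fun f => f.1 \ edgeSpan R := by
    ext v
    simp only [edgeSpan, Finset.mem_union, Finset.mem_biUnion, Finset.mem_sdiff]
    by_cases h : ∃ a ∈ R, v ∈ a.1
    · simp [h]
    · simp [h]
  have h2 : ∀ f ∈ B, (f.1 \ edgeSpan R).card ≤ k - j - 1 := by
    intro f hf
    obtain ⟨J, hJ, J', hJ', hne, h3, h4⟩ := hB f hf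
    have h5 : j + 1 ≤ (J.1 ∪ J'.1).card := by
      by_contra hlt
      have e1 : J.1 = J.1 ∪ J'.1 := Finset.eq_of_subset_of_card_le Finset.subset_union_left
        (by rw [J.2]; omega)
      have e2 : J'.1 = J.1 ∪ J'.1 := Finset.eq_of_subset_of_card_le Finset.subset_union_right
        (by rw [J'.2]; omega)
      exact hne (Subtype.ext (e1.trans e2.symm))
    have h6 : f.1 \ edgeSpan R ⊆ f.1 \ (J.1 ∪ J'.1) :=
      Finset.sdiff_subset_sdiff subset_rfl (Finset.union_subset (hsub J hJ) (hsub J' hJ'))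
    have h7 := Finset.card_le_card h6
    rw [Finset.card_sdiff_of_subset (Finset.union_subset h3 h4), f.2] at h7
    omega
  have h3 := Finset.card_biUnion_le_card_mul B (fun f => f.1 \ edgeSpan R) (k - j - 1) h2
  have h4 := Finset.card_union_le (edgeSpan R) (B.biUnion fun f => f.1 \ edgeSpan R)
  rw [h1]
  have h5 : (k - j) * B.card = B.card * (k - j - 1) + B.card := by
    obtain ⟨d, hd⟩ : ∃ d, k - j = d + 1 := ⟨k - j - 1, by omega⟩
    rw [hd, Nat.add_sub_cancel]
    ring
  omega

theorem card_le_choose_mul {R : Finset (KSet V k)} {S : Finset (KSet V j)}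
    (hR : ∀ J ∈ S, ∃ e ∈ R, J.1 ⊆ e.1) : S.card ≤ k.choose j * R.card := by
  have h1 : S.map (Function.Embedding.subtype _) ⊆ R.biUnion fun e => e.1.powersetCard j := by
    intro s hs
    obtain ⟨J, hJ, rfl⟩ := Finset.mem_map.1 hs
    obtain ⟨e, he, hJe⟩ := hR J hJ
    exact Finset.mem_biUnion.2 ⟨e, he, Finset.mem_powersetCard.2 ⟨hJe, J.2⟩⟩
  have h2 := Finset.card_le_card h1
  rw [Finset.card_map] at h2
  refine h2.trans ?_
  rw [mul_comm]
  refine Finset.card_biUnion_le_card_mul _ _ _ fun e _ => ?_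
  rw [Finset.card_powersetCard, e.2]

/-- A percolating double graph contains, at every scale `l`, a connected set of red edges and a
connected set of blue edges, both of size of order `l`, that span few vertices together. -/
theorem DoubleKGraph.Percolates.exists_witness [Fintype V] (hjk : j < k) {H : DoubleKGraph V k}
    (hH : H.Percolates j) {l : ℕ} (hl : 2 ≤ l) (hl' : l ≤ Fintype.card (KSet V j)) :
    ∃ R B : Finset (KSet V k), (R : Set (KSet V k)) ⊆ H.1 ∧ (B : Set (KSet V k)) ⊆ H.2 ∧
      CutConnected (ShareAtLeast j) R ∧ CutConnected (ShareAtLeast j) B ∧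
      R.card < 2 * l ∧ B.card < 2 * l ∧ l ≤ k.choose j * R.card ∧ l ≤ k.choose j * B.card ∧
      (edgeSpan R ∪ edgeSpan B).card + max R.card B.card ≤ j + (k - j) * (R.card + B.card) := by
  have : Nonempty (KSet V j) := Fintype.card_pos_iff.1 (by omega)
  have hsymm : ∀ (E : Set (KSet V k)) (J J' : KSet V j), EdgeJoined E J J' → EdgeJoined E J' J :=
    fun E J J' ⟨e, he, h1, h2⟩ => ⟨e, he, h2, h1⟩
  obtain ⟨S, hS1, hS2, hS3, hS4⟩ := exists_doublyConnected (hsymm H.1) (hsymm H.2)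
    (H.percolates_iff.1 hH) hl hl'
  obtain ⟨R, hR1, hR2, hR3, hR4, hR5, hR6⟩ := exists_connecting_edges hjk.le hS1 (by omega)
  obtain ⟨B, hB1, hB2, hB3, hB4, hB5, hB6⟩ := exists_connecting_edges hjk.le hS2 (by omega)
  refine ⟨R, B, hR1, hB1, hR5, hB5, by omega, by omega, hS3.trans (card_le_choose_mul hR3),
    hS3.trans (card_le_choose_mul hB3), ?_⟩
  have h1 := card_edgeSpan_union_le hjk hR3 hB4
  have h2 := card_edgeSpan_union_le hjk hB3 hR4
  rw [Finset.union_comm] at h2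
  rw [mul_add]
  rcases le_total R.card B.card with h | h
  · rw [max_eq_right h]; omega
  · rw [max_eq_left h]; omega

end

/-- In a percolating double graph with at least two `j`-sets every `j`-set lies in an edge of each
colour. -/
theorem DoubleKGraph.Percolates.exists_edge {V : Type*} [Finite V] {k j : ℕ} {H : DoubleKGraph V k}
    (hH : H.Percolates j) (h2 : 2 ≤ Nat.card (KSet V j)) (c : Bool) (J : KSet V j) :
    ∃ e, edgeCoord (c, e) H ∧ J.1 ⊆ e.1 := by
  have : Nonempty (KSet V j) := ⟨J⟩
  by_contra hcon
  push Not at hcon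
  let Q : Setoid (KSet V j) := Setoid.ker (fun J' => J' = J)
  have hQ : JigsawClosed (EdgeJoined H.1) (EdgeJoined H.2) Q := by
    rintro x x' y y' hxx hyy ⟨e, he, h3, h4⟩ ⟨f, hf, h5, h6⟩
    cases c with
    | true =>
      have hx : x ≠ J := by rintro rfl; exact hcon e he h3
      have hy : y ≠ J := by rintro rfl; exact hcon e he h4
      simp [Q, Setoid.ker_def, hx, hy]
    | false =>
      have hx : x' ≠ J := by rintro rfl; exact hcon f hf h5
      have hy : y' ≠ J := by rintro rfl; exact hcon f hf h6
      simp only [Q, Setoid.ker_def, hx, hy, eq_iff_iff, iff_false] at hxx hyy ⊢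
      tauto
  have htop := H.percolates_iff.1 hH Q hQ
  have := Fintype.ofFinite (KSet V j)
  rw [Nat.card_eq_fintype_card] at h2
  obtain ⟨J', hJ'⟩ := Fintype.exists_ne_of_one_lt_card (by omega) J
  have : Q J J' := by rw [htop]; trivial
  simp only [Q, Setoid.ker_def, eq_iff_iff, true_iff] at this
  exact hJ' this

/-! ### Counting connected sets of edges -/

/-- The number of connected sets of size `r` through a given point, in a graph of degree at most
`Δ`, is at most `(4 (Δ + 1)) ^ r`. In site percolation with parameter `1 / (2 (Δ + 1))` the events
that `C` is the component of the point are disjoint for different `C`, and each has probability at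
least `(4 (Δ + 1)) ^ (-r)`. -/
theorem card_cutConnected_through_le {β : Type*} [Finite β] [DecidableEq β] {adj : β → β → Prop}
    {U : Finset β} {Δ : ℕ} (hΔ : ∀ x ∈ U, ∀ N ⊆ U, (∀ y ∈ N, adj x y) → N.card ≤ Δ) (x : β) (r : ℕ)
    (𝒞 : Finset (Finset β)) (h𝒞 : ∀ C ∈ 𝒞, C ⊆ U ∧ x ∈ C ∧ C.card = r ∧ CutConnected adj C) :
    𝒞.card ≤ (4 * (Δ + 1)) ^ r := by
  classical
  let q : ℝ := 1 / (2 * (Δ + 1))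
  have hq0 : 0 < q := by positivity
  have hq1 : q ≤ 1 := by
    rw [div_le_one (by positivity)]
    have : (0 : ℝ) ≤ Δ := Nat.cast_nonneg _
    linarith
  let p : I := ⟨q, hq0.le, hq1⟩
  let bd : Finset β → Finset β := fun C => U.filter fun y => y ∉ C ∧ ∃ c ∈ C, adj c y
  let Ev : Finset β → Set (Set β) := fun C => {E | (∀ c ∈ C, c ∈ E) ∧ ∀ y ∈ bd C, y ∉ E}
  have hbd : ∀ C ∈ 𝒞, (bd C).card ≤ Δ * r := by
    intro C hC
    obtain ⟨hCU, -, hCr, -⟩ := h𝒞 C hC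
    have h1 : bd C ⊆ C.biUnion fun c => U.filter fun y => adj c y := by
      intro y hy
      simp only [bd, Finset.mem_filter] at hy
      obtain ⟨hyU, -, c, hc, hcy⟩ := hy
      exact Finset.mem_biUnion.2 ⟨c, hc, Finset.mem_filter.2 ⟨hyU, hcy⟩⟩
    refine (Finset.card_le_card h1).trans ?_
    rw [mul_comm, ← hCr]
    refine Finset.card_biUnion_le_card_mul _ _ _ fun c hc => ?_
    exact hΔ c (hCU hc) _ (Finset.filter_subset _ _) fun y hy => (Finset.mem_filter.1 hy).2
  have hmeas : ∀ C ∈ 𝒞, (1 / (4 * (Δ + 1)) : ℝ) ^ r ≤ (setBernoulli Set.univ p).real (Ev C) := by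
    intro C hC
    have hset : Ev C = {E | ∀ e, (e ∈ E) ∈
        (if e ∈ C then {True} else if e ∈ bd C then {False} else Set.univ : Set Prop)} := by
      ext E
      simp only [Ev, Set.mem_ofPred_eq]
      constructor
      · rintro ⟨h1, h2⟩ e
        split_ifs with h3 h4
        · simpa using h1 e h3
        · simpa using h2 e h4
        · trivial
      · intro h
        refine ⟨fun c hc => by simpa [hc] using h c, fun y hy => ?_⟩
        have hyC : y ∉ C := (Finset.mem_filter.1 hy).2.1
        simpa [hy, hyC] using h y
    have := Fintype.ofFinite β
    rw [measureReal_def, hset, setBernoulli_univ_forall, finprod_eq_prod_of_fintype,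
      ENNReal.toReal_prod]
    have h1 : ∀ e : β, (bernoulliProp p (if e ∈ C then {True} else if e ∈ bd C then {False}
        else Set.univ : Set Prop)).toReal =
        (if e ∈ C then q else 1) * (if e ∈ bd C then 1 - q else 1) := by
      intro e
      by_cases h3 : e ∈ C
      · have h4 : e ∉ bd C := fun h => (Finset.mem_filter.1 h).2.1 h3
        simp [h3, h4, bernoulliProp, p]
      · by_cases h4 : e ∈ bd C
        · simp [h3, h4, bernoulliProp, p]
        · simp [h3, h4]
    rw [Finset.prod_congr rfl fun e _ => h1 e, Finset.prod_mul_distrib, Finset.prod_ite_mem,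
      Finset.prod_ite_mem, Finset.univ_inter, Finset.univ_inter, Finset.prod_const,
      Finset.prod_const, (h𝒞 C hC).2.2.1]
    have h2 : (1 / 2 : ℝ) ≤ (1 - q) ^ Δ := by
      have h3 := one_add_mul_le_pow (a := -q) (by linarith) Δ
      have h4 : (Δ : ℝ) * q ≤ 1 / 2 := by
        simp only [q]
        rw [mul_one_div, div_le_div_iff₀ (by positivity) (by norm_num)]
        linarith
      rw [← sub_eq_add_neg] at h3
      linarith
    calc (1 / (4 * (Δ + 1)) : ℝ) ^ r = q ^ r * (1 / 2) ^ r := by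
          rw [← mul_pow]
          congr 1
          simp only [q]
          field_simp
          norm_num
      _ ≤ q ^ r * ((1 - q) ^ Δ) ^ r := by gcongr
      _ = q ^ r * (1 - q) ^ (Δ * r) := by rw [pow_mul]
      _ ≤ q ^ r * (1 - q) ^ (bd C).card := by
          have := pow_le_pow_of_le_one (a := 1 - q) (by linarith) (by linarith) (hbd C hC)
          gcongr
  have hdisj : (𝒞 : Set (Finset β)).PairwiseDisjoint Ev := by
    have hsub : ∀ C ∈ 𝒞, ∀ D ∈ 𝒞, ∀ E, E ∈ Ev C → E ∈ Ev D → D ⊆ C := by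
      intro C hC D hD E hEC hED
      obtain ⟨hCU, hxC, -, -⟩ := h𝒞 C hC
      obtain ⟨hDU, hxD, -, hD⟩ := h𝒞 D hD
      by_contra hnot
      obtain ⟨a, ha, b, hb, hb', hab⟩ := hD (C ∩ D) Finset.inter_subset_right
        ⟨x, Finset.mem_inter.2 ⟨hxC, hxD⟩⟩ (fun h => hnot (h ▸ Finset.inter_subset_left))
      simp only [Finset.mem_inter, not_and] at ha hb'
      refine hEC.2 b ?_ (hED.1 b hb)
      exact Finset.mem_filter.2 ⟨hDU hb, fun h => hb' h hb, a, ha.1, hab⟩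
    intro C hC D hD hne
    rw [Function.onFun, Set.disjoint_left]
    intro E hEC hED
    exact hne (Finset.Subset.antisymm (hsub D hD C hC E hED hEC) (hsub C hC D hD E hEC hED))
  have h1 : (𝒞.card : ℝ) * (1 / (4 * (Δ + 1)) : ℝ) ^ r ≤ 1 := by
    rw [← nsmul_eq_mul]
    refine (Finset.card_nsmul_le_sum 𝒞 _ _ hmeas).trans ?_
    rw [← measureReal_biUnion_finset hdisj fun _ _ => MeasurableSet.of_discrete]
    exact measureReal_le_one
  rw [one_div, inv_pow, ← div_eq_mul_inv, div_le_one (by positivity)] at h1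
  exact_mod_cast h1

theorem card_cutConnected_le {β : Type*} [Finite β] [DecidableEq β] {adj : β → β → Prop}
    {U : Finset β} {Δ : ℕ} (hΔ : ∀ x ∈ U, ∀ N ⊆ U, (∀ y ∈ N, adj x y) → N.card ≤ Δ) {r : ℕ}
    (hr : 1 ≤ r) (𝒞 : Finset (Finset β))
    (h𝒞 : ∀ C ∈ 𝒞, C ⊆ U ∧ C.card = r ∧ CutConnected adj C) :
    𝒞.card ≤ U.card * (4 * (Δ + 1)) ^ r := by
  have h1 : 𝒞 ⊆ U.biUnion fun x => 𝒞.filter fun C => x ∈ C := by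
    intro C hC
    obtain ⟨hCU, hCr, -⟩ := h𝒞 C hC
    obtain ⟨x, hx⟩ := Finset.card_pos.1 (by omega : 0 < C.card)
    exact Finset.mem_biUnion.2 ⟨x, hCU hx, Finset.mem_filter.2 ⟨hC, hx⟩⟩
  refine (Finset.card_le_card h1).trans (Finset.card_biUnion_le_card_mul _ _ _ fun x _ => ?_)
  refine card_cutConnected_through_le hΔ x r _ fun C hC => ?_
  obtain ⟨hC, hx⟩ := Finset.mem_filter.1 hC
  obtain ⟨h1, h2, h3⟩ := h𝒞 C hC
  exact ⟨h1, hx, h2, h3⟩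

section

variable {V : Type*} [Fintype V] [DecidableEq V] {k j : ℕ}

/-- The `k`-sets inside `W`. -/
def edgesInside (k : ℕ) (W : Finset V) : Finset (KSet V k) :=
  Finset.univ.filter fun e => e.1 ⊆ W

theorem card_edgesInside_le (k : ℕ) (W : Finset V) : (edgesInside k W).card ≤ W.card ^ k := by
  have h1 : (edgesInside k W).map (Function.Embedding.subtype _) ⊆ W.powersetCard k := by
    intro s hs
    obtain ⟨e, he, rfl⟩ := Finset.mem_map.1 hs
    exact Finset.mem_powersetCard.2 ⟨(Finset.mem_filter.1 he).2, e.2⟩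
  have h2 := Finset.card_le_card h1
  rw [Finset.card_map, Finset.card_powersetCard] at h2
  exact h2.trans (Nat.choose_le_pow _ _)

theorem card_shareAtLeast_le (W : Finset V) (e : KSet V k) (N : Finset (KSet V k))
    (hN : N ⊆ edgesInside k W) (hadj : ∀ f ∈ N, ShareAtLeast j e f) :
    N.card ≤ k.choose j * W.card ^ (k - j) := by
  have h1 : N.map (Function.Embedding.subtype _) ⊆ (e.1.powersetCard j).biUnion
      fun J => (W.powersetCard (k - j)).image fun T => J ∪ T := by
    intro s hs
    obtain ⟨f, hf, rfl⟩ := Finset.mem_map.1 hs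
    obtain ⟨J, hJ, hJc⟩ := Finset.exists_subset_card_eq (hadj f hf)
    refine Finset.mem_biUnion.2 ⟨J, Finset.mem_powersetCard.2
      ⟨hJ.trans Finset.inter_subset_left, hJc⟩, Finset.mem_image.2 ⟨f.1 \ J, ?_, ?_⟩⟩
    · refine Finset.mem_powersetCard.2
        ⟨Finset.sdiff_subset.trans (Finset.mem_filter.1 (hN hf)).2, ?_⟩
      rw [Finset.card_sdiff_of_subset (hJ.trans Finset.inter_subset_right), f.2, hJc]
    · exact Finset.union_sdiff_of_subset (hJ.trans Finset.inter_subset_right)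
  have h2 := Finset.card_le_card h1
  rw [Finset.card_map] at h2
  refine h2.trans ((Finset.card_biUnion_le_card_mul _ _ _ fun J _ => ?_).trans_eq
    (by rw [Finset.card_powersetCard, e.2]))
  refine Finset.card_image_le.trans ?_
  rw [Finset.card_powersetCard]
  exact Nat.choose_le_pow _ _

theorem card_cutConnected_edges_le (hjk : j ≤ k) (W : Finset V) (hW : 1 ≤ W.card) {r : ℕ}
    (hr : 1 ≤ r) (𝒞 : Finset (Finset (KSet V k)))
    (h𝒞 : ∀ C ∈ 𝒞, C ⊆ edgesInside k W ∧ C.card = r ∧ CutConnected (ShareAtLeast j) C) :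
    𝒞.card ≤ W.card ^ k * (8 * k.choose j * W.card ^ (k - j)) ^ r := by
  refine (card_cutConnected_le (Δ := k.choose j * W.card ^ (k - j))
    (fun e _ N hN h => card_shareAtLeast_le W e N hN h) hr 𝒞 h𝒞).trans ?_
  refine Nat.mul_le_mul (card_edgesInside_le k W) (Nat.pow_le_pow_left ?_ r)
  have h1 : 1 ≤ k.choose j * W.card ^ (k - j) :=
    Nat.mul_pos (Nat.choose_pos hjk) (Nat.pow_pos hW)
  nlinarith

end

/-! ### The union bounds for non-percolation -/

theorem real_edges_subset {k n : ℕ} (p₁ p₂ : I) (R B : Finset (KSet (Fin n) k)) :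
    (binomialDoubleKGraph k n p₁ p₂).real
      {H | (R : Set (KSet (Fin n) k)) ⊆ H.1 ∧ (B : Set (KSet (Fin n) k)) ⊆ H.2} =
      (p₁ : ℝ) ^ R.card * (p₂ : ℝ) ^ B.card := by
  have hset : {H : DoubleKGraph (Fin n) k | (R : Set (KSet (Fin n) k)) ⊆ H.1 ∧
      (B : Set (KSet (Fin n) k)) ⊆ H.2} =
      {H | ∀ i ∈ R.map (Function.Embedding.sectR true _) ∪
        B.map (Function.Embedding.sectR false _), edgeCoord i H} := by
    ext H
    simp only [Set.mem_ofPred_eq, Finset.mem_union, Finset.mem_map,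
      Function.Embedding.sectR_apply, or_imp, forall_and]
    refine and_congr ⟨?_, ?_⟩ ⟨?_, ?_⟩
    · rintro h _ ⟨e, he, rfl⟩
      exact h he
    · exact fun h e he => h _ ⟨e, he, rfl⟩
    · rintro h _ ⟨e, he, rfl⟩
      exact h he
    · exact fun h e he => h _ ⟨e, he, rfl⟩
  rw [hset, (binomialDoubleKGraph_coordIndep p₁ p₂).all_coord, Finset.prod_union]
  · rw [Finset.prod_map, Finset.prod_map]
    simp only [Function.Embedding.sectR_apply, binomialDoubleKGraph_real_coord, cond_true,
      cond_false, Finset.prod_const]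
  · rw [Finset.disjoint_left]
    simp

open Classical in
/-- The union bound over all witnesses of percolation at scale `l`. -/
theorem real_percolates_le_sum {k j n : ℕ} (hjk : j < k) (p₁ p₂ : I) {l : ℕ} (hl : 2 ≤ l)
    (hl' : l ≤ n.choose j) (hn : j + (k - j) * (4 * l) ≤ n) :
    (binomialDoubleKGraph k n p₁ p₂).real {H | H.Percolates j} ≤
      ∑ x ∈ (Finset.range (2 * l) ×ˢ Finset.range (2 * l)).filter
          (fun x => l ≤ k.choose j * x.1 ∧ l ≤ k.choose j * x.2),
        (n.choose (j + (k - j) * (x.1 + x.2) - max x.1 x.2) : ℝ) *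
          (((j + (k - j) * (x.1 + x.2) - max x.1 x.2 : ℕ) : ℝ) ^ k) ^ 2 *
          (8 * k.choose j * ((j + (k - j) * (x.1 + x.2) - max x.1 x.2 : ℕ) : ℝ) ^ (k - j)) ^
            (x.1 + x.2) * ((p₁ : ℝ) ^ x.1 * (p₂ : ℝ) ^ x.2) := by
  set v : ℕ × ℕ → ℕ := fun x => j + (k - j) * (x.1 + x.2) - max x.1 x.2 with hv
  let F : ℕ → Finset (Fin n) → Finset (Finset (KSet (Fin n) k)) := fun r W =>
    Finset.univ.filter fun C => C ⊆ edgesInside k W ∧ C.card = r ∧ CutConnected (ShareAtLeast j) C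
  let I' := (Finset.range (2 * l) ×ˢ Finset.range (2 * l)).filter
          (fun x => l ≤ k.choose j * x.1 ∧ l ≤ k.choose j * x.2)
  have hpos : ∀ x ∈ I', 1 ≤ x.1 ∧ 1 ≤ x.2 := by
    intro x hx
    obtain ⟨-, h1, h2⟩ := Finset.mem_filter.1 hx
    constructor
    · rcases Nat.eq_zero_or_pos x.1 with h | h
      · rw [h] at h1; omega
      · exact h
    · rcases Nat.eq_zero_or_pos x.2 with h | h
      · rw [h] at h2; omega
      · exact h
  have hsub : {H : DoubleKGraph (Fin n) k | H.Percolates j} ⊆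
      ⋃ x ∈ I', ⋃ W ∈ (Finset.univ : Finset (Fin n)).powersetCard (v x),
        ⋃ y ∈ F x.1 W ×ˢ F x.2 W,
          {H | (y.1 : Set (KSet (Fin n) k)) ⊆ H.1 ∧ (y.2 : Set (KSet (Fin n) k)) ⊆ H.2} := by
    intro H hH
    have hcard : Fintype.card (KSet (Fin n) j) = n.choose j := by
      simp [KSet, Fintype.card_finset_len]
    obtain ⟨R, B, hR, hB, hRc, hBc, hR2, hB2, hRl, hBl, hspan⟩ :=
      DoubleKGraph.Percolates.exists_witness hjk hH hl (hcard ▸ hl')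
    have hle : v (R.card, B.card) ≤ (Finset.univ : Finset (Fin n)).card := by
      rw [Finset.card_univ, Fintype.card_fin]
      refine (Nat.sub_le _ _).trans (le_trans ?_ hn)
      have : R.card + B.card ≤ 4 * l := by omega
      have := Nat.mul_le_mul_left (k - j) this
      simp only
      omega
    obtain ⟨W, hW, -, hWc⟩ := Finset.exists_subsuperset_card_eq
      (Finset.subset_univ (edgeSpan R ∪ edgeSpan B)) (n := v (R.card, B.card))
      (by simp only [hv]; omega) hle
    have hin : ∀ e ∈ R ∪ B, e ∈ edgesInside k W := by
      intro e he
      refine Finset.mem_filter.2 ⟨Finset.mem_univ _, ?_⟩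
      rcases Finset.mem_union.1 he with he | he
      · exact ((Finset.subset_biUnion_of_mem Subtype.val he).trans
          Finset.subset_union_left).trans hW
      · exact ((Finset.subset_biUnion_of_mem Subtype.val he).trans
          Finset.subset_union_right).trans hW
    simp only [Set.mem_iUnion]
    refine ⟨(R.card, B.card), ?_, W, ?_, (R, B), ?_, hR, hB⟩
    · exact Finset.mem_filter.2 ⟨by simp [hR2, hB2], hRl, hBl⟩
    · exact Finset.mem_powersetCard.2 ⟨Finset.subset_univ _, hWc⟩
    · rw [Finset.mem_product]
      exact ⟨Finset.mem_filter.2 ⟨Finset.mem_univ _, fun e he => hin e (by simp [he]), rfl, hRc⟩,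
        Finset.mem_filter.2 ⟨Finset.mem_univ _, fun e he => hin e (by simp [he]), rfl, hBc⟩⟩
  refine (measureReal_mono hsub (measure_ne_top _ _)).trans
    ((measureReal_biUnion_finset_le _ _).trans (Finset.sum_le_sum fun x hx => ?_))
  obtain ⟨hx1, hx2⟩ := hpos x hx
  have hp1 : (0 : ℝ) ≤ p₁ := p₁.2.1
  have hp2 : (0 : ℝ) ≤ p₂ := p₂.2.1
  have hv1 : 1 ≤ v x := by
    have h1 : x.1 + x.2 ≤ (k - j) * (x.1 + x.2) := Nat.le_mul_of_pos_left _ (by omega)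
    have h2 : max x.1 x.2 + 1 ≤ x.1 + x.2 := by omega
    simp only [hv]
    omega
  have hW : ∀ W ∈ (Finset.univ : Finset (Fin n)).powersetCard (v x),
      (binomialDoubleKGraph k n p₁ p₂).real (⋃ y ∈ F x.1 W ×ˢ F x.2 W,
        {H | (y.1 : Set (KSet (Fin n) k)) ⊆ H.1 ∧ (y.2 : Set (KSet (Fin n) k)) ⊆ H.2}) ≤
      ((v x : ℝ) ^ k) ^ 2 * (8 * k.choose j * (v x : ℝ) ^ (k - j)) ^ (x.1 + x.2) *
        ((p₁ : ℝ) ^ x.1 * (p₂ : ℝ) ^ x.2) := by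
    intro W hW
    have hWc := (Finset.mem_powersetCard.1 hW).2
    refine (measureReal_biUnion_finset_le _ _).trans ?_
    have h1 : ∀ y ∈ F x.1 W ×ˢ F x.2 W, (binomialDoubleKGraph k n p₁ p₂).real
        {H | (y.1 : Set (KSet (Fin n) k)) ⊆ H.1 ∧ (y.2 : Set (KSet (Fin n) k)) ⊆ H.2} =
        (p₁ : ℝ) ^ x.1 * (p₂ : ℝ) ^ x.2 := by
      intro y hy
      obtain ⟨hy1, hy2⟩ := Finset.mem_product.1 hy
      rw [real_edges_subset, (Finset.mem_filter.1 hy1).2.2.1, (Finset.mem_filter.1 hy2).2.2.1]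
    rw [Finset.sum_congr rfl h1, Finset.sum_const, nsmul_eq_mul, Finset.card_product, Nat.cast_mul]
    refine mul_le_mul_of_nonneg_right ?_ (by positivity)
    have h2 : ∀ r, 1 ≤ r → ((F r W).card : ℝ) ≤
        (v x : ℝ) ^ k * (8 * k.choose j * (v x : ℝ) ^ (k - j)) ^ r := by
      intro r hr
      have := card_cutConnected_edges_le hjk.le W (hWc ▸ hv1) hr (F r W)
        (fun C hC => (Finset.mem_filter.1 hC).2)
      rw [hWc] at this
      exact_mod_cast this
    calc _ ≤ ((v x : ℝ) ^ k * (8 * k.choose j * (v x : ℝ) ^ (k - j)) ^ x.1) *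
          ((v x : ℝ) ^ k * (8 * k.choose j * (v x : ℝ) ^ (k - j)) ^ x.2) :=
          mul_le_mul (h2 _ hx1) (h2 _ hx2) (Nat.cast_nonneg _) (by positivity)
      _ = _ := by rw [pow_add]; ring
  refine (measureReal_biUnion_finset_le _ _).trans ((Finset.sum_le_sum hW).trans_eq ?_)
  rw [Finset.sum_const, Finset.card_powersetCard, Finset.card_univ, Fintype.card_fin, nsmul_eq_mul]
  ring

/-- The union bound over the sets of `t` edges of colour `c`. -/
theorem real_percolates_le_choose {k j n : ℕ} (p₁ p₂ : I) (c : Bool) {t : ℕ}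
    (hN : 2 ≤ n.choose j) (ht : k.choose j * t < n.choose j + k.choose j) :
    (binomialDoubleKGraph k n p₁ p₂).real {H | H.Percolates j} ≤
      (n.choose k).choose t * ((cond c p₁ p₂ : I) : ℝ) ^ t := by
  classical
  have hcard : Fintype.card (KSet (Fin n) j) = n.choose j := by
    simp [KSet, Fintype.card_finset_len]
  have hcard' : Fintype.card (KSet (Fin n) k) = n.choose k := by
    simp [KSet, Fintype.card_finset_len]
  have hsub : {H : DoubleKGraph (Fin n) k | H.Percolates j} ⊆
      ⋃ T ∈ (Finset.univ : Finset (KSet (Fin n) k)).powersetCard t,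
        {H | ∀ i ∈ T.map (Function.Embedding.sectR c _), edgeCoord i H} := by
    intro H hH
    let E : Finset (KSet (Fin n) k) := Finset.univ.filter fun e => edgeCoord (c, e) H
    have h1 : (Finset.univ : Finset (KSet (Fin n) j)).card ≤ k.choose j * E.card := by
      refine card_le_choose_mul fun J _ => ?_
      obtain ⟨e, he, hJe⟩ := DoubleKGraph.Percolates.exists_edge hH
        (by rw [Nat.card_eq_fintype_card, hcard]; exact hN) c J
      exact ⟨e, Finset.mem_filter.2 ⟨Finset.mem_univ _, he⟩, hJe⟩
    rw [Finset.card_univ, hcard] at h1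
    have h2 : t ≤ E.card := by
      by_contra h
      have : E.card + 1 ≤ t := by omega
      have := Nat.mul_le_mul_left (k.choose j) this
      rw [mul_add, mul_one] at this
      omega
    obtain ⟨T, hT, hTc⟩ := Finset.exists_subset_card_eq h2
    simp only [Set.mem_iUnion]
    refine ⟨T, Finset.mem_powersetCard.2 ⟨Finset.subset_univ _, hTc⟩, ?_⟩
    intro i hi
    obtain ⟨e, he, rfl⟩ := Finset.mem_map.1 hi
    exact (Finset.mem_filter.1 (hT he)).2
  refine (measureReal_mono hsub (measure_ne_top _ _)).trans
    ((measureReal_biUnion_finset_le _ _).trans_eq ?_)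
  have h1 : ∀ T ∈ (Finset.univ : Finset (KSet (Fin n) k)).powersetCard t,
      (binomialDoubleKGraph k n p₁ p₂).real
        {H | ∀ i ∈ T.map (Function.Embedding.sectR c _), edgeCoord i H} =
      ((cond c p₁ p₂ : I) : ℝ) ^ t := by
    intro T hT
    rw [(binomialDoubleKGraph_coordIndep p₁ p₂).all_coord, Finset.prod_map]
    simp only [Function.Embedding.sectR_apply, binomialDoubleKGraph_real_coord,
      Finset.prod_const, (Finset.mem_powersetCard.1 hT).2]
  rw [Finset.sum_congr rfl h1, Finset.sum_const, Finset.card_powersetCard, Finset.card_univ,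
    hcard', nsmul_eq_mul]

/-! ### The subcritical regime -/

theorem pow_le_exp_mul_factorial (t : ℕ) : (t : ℝ) ^ t ≤ Real.exp t * t.factorial := by
  have h := Real.pow_div_factorial_le_exp (t : ℝ) (Nat.cast_nonneg t) t
  rwa [div_le_iff₀ (by exact_mod_cast t.factorial_pos)] at h

theorem choose_mul_pow_le_exp_neg {N t : ℕ} {p : ℝ} (hp : 0 ≤ p)
    (h : N * p ≤ t * Real.exp (-2)) : (N.choose t : ℝ) * p ^ t ≤ Real.exp (-t) := by
  have ht : (0 : ℝ) < t.factorial := by exact_mod_cast t.factorial_pos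
  calc (N.choose t : ℝ) * p ^ t ≤ (N : ℝ) ^ t / t.factorial * p ^ t := by
        gcongr
        exact Nat.choose_le_pow_div t N
    _ = (N * p) ^ t / t.factorial := by rw [mul_pow]; ring
    _ ≤ (t * Real.exp (-2)) ^ t / t.factorial := by gcongr
    _ = (t : ℝ) ^ t * Real.exp (-2) ^ t / t.factorial := by rw [mul_pow]
    _ ≤ (Real.exp t * t.factorial) * Real.exp (-2) ^ t / t.factorial := by
        gcongr
        exact pow_le_exp_mul_factorial t
    _ = Real.exp (-t) := by
        rw [mul_right_comm, mul_div_assoc, div_self ht.ne', mul_one, ← Real.exp_nat_mul,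
          ← Real.exp_add]
        congr 1
        ring

theorem pow_le_mul_choose {n j : ℕ} (hn : 2 * j ≤ n) :
    (n : ℝ) ^ j ≤ (2 ^ j * j.factorial : ℕ) * n.choose j := by
  have h1 := Nat.pow_sub_le_descFactorial n j
  rw [Nat.descFactorial_eq_factorial_mul_choose] at h1
  have h2 : n ≤ 2 * (n + 1 - j) := by omega
  have h3 := Nat.pow_le_pow_left h2 j
  rw [mul_pow] at h3
  have h4 : n ^ j ≤ 2 ^ j * j.factorial * n.choose j := by
    rw [mul_assoc]
    exact h3.trans (Nat.mul_le_mul_left _ h1)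
  exact_mod_cast h4

/-- One colour with too few edges to cover all `j`-sets. -/
theorem real_percolates_le_of_sparse {k j n : ℕ} (hj : 1 ≤ j) (hjk : j < k) (p₁ p₂ : I) (c : Bool)
    (hn : 2 * j ≤ n) (hN : 2 ≤ n.choose j)
    (hp : ((cond c p₁ p₂ : I) : ℝ) * (n : ℝ) ^ (k - j) ≤
      Real.exp (-2) / (k.choose j * (2 ^ j * j.factorial : ℕ))) :
    (binomialDoubleKGraph k n p₁ p₂).real {H | H.Percolates j} ≤
      Real.exp (-(n / (k.choose j * (2 ^ j * j.factorial : ℕ)))) := by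
  set K := k.choose j with hK
  set D := 2 ^ j * j.factorial with hD
  have hKpos : 0 < K := Nat.choose_pos hjk.le
  have hDpos : 0 < D := Nat.mul_pos (by positivity) j.factorial_pos
  have hK' : (0 : ℝ) < K := by exact_mod_cast hKpos
  have hD' : (0 : ℝ) < D := by exact_mod_cast hDpos
  set p : ℝ := ((cond c p₁ p₂ : I) : ℝ) with hpdef
  have hp0 : 0 ≤ p := (cond c p₁ p₂).2.1
  set t := (n.choose j + (K - 1)) / K with ht
  have ht1 : K * t < n.choose j + K := by
    have := Nat.mul_div_le (n.choose j + (K - 1)) K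
    rw [← ht] at this
    omega
  have ht2 : n.choose j ≤ K * t := by
    have := Nat.lt_mul_div_succ (n.choose j + (K - 1)) hKpos
    rw [← ht, mul_add, mul_one] at this
    omega
  have ht3 : (n : ℝ) ^ j / (K * D) ≤ t := by
    rw [div_le_iff₀ (by positivity)]
    have h2 : (n.choose j : ℝ) ≤ K * t := by exact_mod_cast ht2
    calc (n : ℝ) ^ j ≤ D * n.choose j := pow_le_mul_choose hn
      _ ≤ D * (K * t) := by gcongr
      _ = t * (K * D) := by ring
  refine (real_percolates_le_choose p₁ p₂ c hN ht1).trans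
    ((choose_mul_pow_le_exp_neg hp0 ?_).trans ?_)
  · calc ((n.choose k : ℕ) : ℝ) * p ≤ (n : ℝ) ^ k * p := by
          gcongr
          exact_mod_cast Nat.choose_le_pow n k
      _ = (n : ℝ) ^ j * (p * (n : ℝ) ^ (k - j)) := by
          rw [mul_comm p, ← mul_assoc, ← pow_add]
          congr 3
          omega
      _ ≤ (n : ℝ) ^ j * (Real.exp (-2) / (K * D)) := by gcongr
      _ = (n : ℝ) ^ j / (K * D) * Real.exp (-2) := by ring
      _ ≤ t * Real.exp (-2) := by gcongr
  · rw [Real.exp_le_exp, neg_le_neg_iff]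
    refine le_trans ?_ ht3
    gcongr
    exact_mod_cast Nat.le_self_pow (by omega) n

/-- One term of the union bound. The lower bounds on `p₁` and `p₂` make up for the different
numbers of red and blue edges. -/
theorem witness_term_le {k j d n r b v : ℕ} {K ε c L p₁ p₂ : ℝ} (hr : 1 ≤ r) (hd : 1 ≤ d)
    (hv : v + max r b = j + d * (r + b)) (hv1 : 1 ≤ v) (hK : 1 ≤ K) (hε : 0 < ε) (hε1 : ε ≤ 1)
    (hp₁ : 0 ≤ p₁) (hp₂ : 0 ≤ p₂) (h₁ : ε ≤ p₁ * (n : ℝ) ^ d) (h₂ : ε ≤ p₂ * (n : ℝ) ^ d)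
    (hp : p₁ * p₂ * (n : ℝ) ^ (2 * d - 1) ≤ 1 / (c * L)) :
    (n.choose v : ℝ) * ((v : ℝ) ^ k) ^ 2 * (8 * K * (v : ℝ) ^ d) ^ (r + b) * (p₁ ^ r * p₂ ^ b) ≤
      (n : ℝ) ^ j * ((v : ℝ) ^ k) ^ 2 *
        (Real.exp (j + 2 * d) * (8 * K) ^ 2 * (1 / ε) ^ 2 * v * (1 / (c * L))) ^ max r b := by
  set M := max r b with hM
  have hrM : r ≤ M := le_max_left _ _
  have hbM : b ≤ M := le_max_right _ _
  have hv0 : (1 : ℝ) ≤ v := by exact_mod_cast hv1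
  have hε' : 1 ≤ 1 / ε := by rw [le_div_iff₀ hε]; linarith
  have hn0 : (0 : ℝ) ≤ n := Nat.cast_nonneg n
  -- missing edges of either colour are paid for by the lower bound on the probability
  have hpow : ∀ p : ℝ, 0 ≤ p → ε ≤ p * (n : ℝ) ^ d → ∀ s ≤ M,
      p ^ s ≤ p ^ M * ((n : ℝ) ^ d * (1 / ε)) ^ (M - s) := by
    intro p hp0 hp1 s hs
    have h1 : 1 ≤ p * ((n : ℝ) ^ d * (1 / ε)) := by
      rw [← mul_assoc, mul_one_div, le_div_iff₀ hε]
      linarith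
    calc p ^ s ≤ p ^ s * (p * ((n : ℝ) ^ d * (1 / ε))) ^ (M - s) :=
          le_mul_of_one_le_right (pow_nonneg hp0 _) (one_le_pow₀ h1)
      _ = p ^ M * ((n : ℝ) ^ d * (1 / ε)) ^ (M - s) := by
          rw [mul_pow, ← mul_assoc, ← pow_add]
          congr 3
          omega
  have hpp : p₁ ^ r * p₂ ^ b ≤ (p₁ * p₂) ^ M * ((n : ℝ) ^ d * (1 / ε)) ^ (M - r + (M - b)) := by
    calc p₁ ^ r * p₂ ^ b ≤ (p₁ ^ M * ((n : ℝ) ^ d * (1 / ε)) ^ (M - r)) *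
          (p₂ ^ M * ((n : ℝ) ^ d * (1 / ε)) ^ (M - b)) :=
          mul_le_mul (hpow p₁ hp₁ h₁ r hrM) (hpow p₂ hp₂ h₂ b hbM) (by positivity) (by positivity)
      _ = _ := by rw [pow_add, mul_pow]; ring
  have hchoose : (n.choose v : ℝ) * (v : ℝ) ^ v ≤ (n : ℝ) ^ v * Real.exp v := by
    have hfac : (0 : ℝ) < v.factorial := by exact_mod_cast v.factorial_pos
    calc (n.choose v : ℝ) * (v : ℝ) ^ v ≤
          ((n : ℝ) ^ v / v.factorial) * (Real.exp v * v.factorial) := by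
          gcongr
          · exact Nat.choose_le_pow_div v n
          · exact pow_le_exp_mul_factorial v
      _ = _ := by field_simp
  have hvM : v ≤ (j + 2 * d) * M := by
    have h1 : d * (r + b) ≤ d * (2 * M) := Nat.mul_le_mul_left d (by omega)
    have h2 : j ≤ j * M := Nat.le_mul_of_pos_right j (by omega)
    have h3 : (j + 2 * d) * M = j * M + d * (2 * M) := by ring
    omega
  have hexp : Real.exp v ≤ Real.exp (j + 2 * d) ^ M := by
    rw [← Real.exp_nat_mul, Real.exp_le_exp]
    have : (v : ℝ) ≤ (j + 2 * d) * M := by exact_mod_cast hvM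
    linarith
  have hvpow : (v : ℝ) ^ (d * (r + b)) ≤ (v : ℝ) ^ v * (v : ℝ) ^ M := by
    rw [← pow_add]
    exact pow_le_pow_right₀ hv0 (by omega)
  have hK8 : (8 * K) ^ (r + b) ≤ ((8 * K) ^ 2) ^ M := by
    rw [← pow_mul]
    exact pow_le_pow_right₀ (by linarith) (by omega)
  have hεpow : (1 / ε) ^ (M - r + (M - b)) ≤ ((1 / ε) ^ 2) ^ M := by
    rw [← pow_mul]
    exact pow_le_pow_right₀ hε' (by omega)
  have hnpow : (n : ℝ) ^ v * ((n : ℝ) ^ d) ^ (M - r + (M - b)) =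
      (n : ℝ) ^ j * ((n : ℝ) ^ (2 * d - 1)) ^ M := by
    rw [← pow_mul, ← pow_mul, ← pow_add, ← pow_add]
    congr 1
    zify [hrM, hbM, (by omega : 1 ≤ 2 * d)]
    have : (v : ℤ) + M = j + d * (r + b) := by exact_mod_cast hv
    linear_combination this
  calc (n.choose v : ℝ) * ((v : ℝ) ^ k) ^ 2 * (8 * K * (v : ℝ) ^ d) ^ (r + b) * (p₁ ^ r * p₂ ^ b)
      = (n.choose v : ℝ) * (v : ℝ) ^ (d * (r + b)) * ((v : ℝ) ^ k) ^ 2 *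
          (8 * K) ^ (r + b) * (p₁ ^ r * p₂ ^ b) := by rw [mul_pow, ← pow_mul]; ring
    _ ≤ (n.choose v : ℝ) * ((v : ℝ) ^ v * (v : ℝ) ^ M) * ((v : ℝ) ^ k) ^ 2 *
          ((8 * K) ^ 2) ^ M *
          ((p₁ * p₂) ^ M * ((n : ℝ) ^ d * (1 / ε)) ^ (M - r + (M - b))) := by
        gcongr
    _ = ((n.choose v : ℝ) * (v : ℝ) ^ v) * (v : ℝ) ^ M * ((v : ℝ) ^ k) ^ 2 * ((8 * K) ^ 2) ^ M *
          ((p₁ * p₂) ^ M * (((n : ℝ) ^ d) ^ (M - r + (M - b)) *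
            (1 / ε) ^ (M - r + (M - b)))) := by
        rw [mul_pow ((n : ℝ) ^ d)]; ring
    _ ≤ ((n : ℝ) ^ v * Real.exp (j + 2 * d) ^ M) * (v : ℝ) ^ M * ((v : ℝ) ^ k) ^ 2 *
          ((8 * K) ^ 2) ^ M *
          ((p₁ * p₂) ^ M * (((n : ℝ) ^ d) ^ (M - r + (M - b)) * ((1 / ε) ^ 2) ^ M)) := by
        have hc := hchoose.trans (mul_le_mul_of_nonneg_left hexp (pow_nonneg hn0 v))
        gcongr
    _ = ((n : ℝ) ^ v * ((n : ℝ) ^ d) ^ (M - r + (M - b))) * ((v : ℝ) ^ k) ^ 2 *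
          (Real.exp (j + 2 * d) * (8 * K) ^ 2 * (1 / ε) ^ 2 * v) ^ M * (p₁ * p₂) ^ M := by
        rw [mul_pow, mul_pow, mul_pow]; ring
    _ = (n : ℝ) ^ j * ((v : ℝ) ^ k) ^ 2 *
          (Real.exp (j + 2 * d) * (8 * K) ^ 2 * (1 / ε) ^ 2 * v) ^ M *
          (p₁ * p₂ * (n : ℝ) ^ (2 * d - 1)) ^ M := by
        rw [hnpow, mul_pow (p₁ * p₂)]; ring
    _ ≤ (n : ℝ) ^ j * ((v : ℝ) ^ k) ^ 2 *
          (Real.exp (j + 2 * d) * (8 * K) ^ 2 * (1 / ε) ^ 2 * v) ^ M * (1 / (c * L)) ^ M := by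
        gcongr
    _ = _ := by rw [mul_pow (_ * (v : ℝ))]; ring

/-- The union bound over witnesses of logarithmic size, when both colours have enough edges. -/
theorem real_percolates_le_of_dense {k j n : ℕ} (hj : 1 ≤ j) (hjk : j < k) (p₁ p₂ : I)
    {ε c : ℝ} (hε : 0 < ε) (hε1 : ε ≤ 1)
    (hc : Real.exp ((j + 1) * k.choose j) * (8 * k * (Real.exp (j + 2 * (k - j : ℕ)) *
      (8 * k.choose j) ^ 2 * (1 / ε) ^ 2)) ≤ c)
    (h₁ : ε ≤ (p₁ : ℝ) * (n : ℝ) ^ (k - j)) (h₂ : ε ≤ (p₂ : ℝ) * (n : ℝ) ^ (k - j))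
    (hp : (p₁ : ℝ) * (p₂ : ℝ) ≤ 1 / (c * (n : ℝ) ^ (2 * k - 2 * j - 1) * Real.log n))
    (hL : 2 ≤ Real.log n) (hLn : 8 * k * Real.log n ≤ n)
    (hLN : 2 * Real.log n ≤ n.choose j) :
    (binomialDoubleKGraph k n p₁ p₂).real {H | H.Percolates j} ≤
      16 * (8 * k) ^ (2 * k) * Real.log n ^ (2 * k + 2) / n := by
  set L := Real.log n with hLdef
  set K : ℝ := ((k.choose j : ℕ) : ℝ) with hK
  set l := ⌈L⌉₊ with hl
  set A : ℝ := Real.exp (j + 2 * (k - j : ℕ)) * (8 * K) ^ 2 * (1 / ε) ^ 2 with hA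
  have hK1 : 1 ≤ K := Nat.one_le_cast.2 (Nat.choose_pos hjk.le)
  have hL0 : 0 < L := by linarith
  have hlL : L ≤ l := Nat.le_ceil L
  have hlL2 : (l : ℝ) ≤ 2 * L := by
    have := (Nat.ceil_lt_add_one hL0.le).le
    linarith
  have hl2 : 2 ≤ l := by exact_mod_cast hL.trans hlL
  have hk1 : (1 : ℝ) ≤ k := by exact_mod_cast (by omega : 1 ≤ k)
  have hlN : l ≤ n.choose j := by exact_mod_cast hlL2.trans hLN
  have hkl : 4 * k * l ≤ n := by
    have : (4 * k * l : ℝ) ≤ n := by nlinarith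
    exact_mod_cast this
  have hn : j + (k - j) * (4 * l) ≤ n := by
    refine le_trans ?_ hkl
    calc j + (k - j) * (4 * l) ≤ j * (4 * l) + (k - j) * (4 * l) := by
          gcongr
          exact Nat.le_mul_of_pos_right j (by omega)
      _ = 4 * k * l := by rw [← add_mul, Nat.add_sub_cancel' hjk.le]; ring
  have hn1 : 1 ≤ n := by
    have : 1 ≤ 4 * k * l := Nat.mul_pos (by omega) (by omega)
    omega
  have hn0 : (0 : ℝ) < n := by exact_mod_cast hn1
  have hA0 : 0 < A := by positivity
  have hc0 : 0 < c := lt_of_lt_of_le (by positivity) hc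
  have hp' : (p₁ : ℝ) * (p₂ : ℝ) * (n : ℝ) ^ (2 * (k - j) - 1) ≤ 1 / (c * L) := by
    have h1 : 2 * k - 2 * j - 1 = 2 * (k - j) - 1 := by omega
    rw [h1] at hp
    calc _ ≤ 1 / (c * (n : ℝ) ^ (2 * (k - j) - 1) * L) * (n : ℝ) ^ (2 * (k - j) - 1) := by gcongr
      _ = _ := by field_simp
  classical
  refine (real_percolates_le_sum hjk p₁ p₂ hl2 hlN hn).trans ?_
  have hterm : ∀ x ∈ (Finset.range (2 * l) ×ˢ Finset.range (2 * l)).filter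
          (fun x => l ≤ k.choose j * x.1 ∧ l ≤ k.choose j * x.2),
        (n.choose (j + (k - j) * (x.1 + x.2) - max x.1 x.2) : ℝ) *
          (((j + (k - j) * (x.1 + x.2) - max x.1 x.2 : ℕ) : ℝ) ^ k) ^ 2 *
          (8 * K * ((j + (k - j) * (x.1 + x.2) - max x.1 x.2 : ℕ) : ℝ) ^ (k - j)) ^
            (x.1 + x.2) * ((p₁ : ℝ) ^ x.1 * (p₂ : ℝ) ^ x.2) ≤ (8 * k * L) ^ (2 * k) / n := by
    rintro ⟨r, b⟩ hx
    simp only [Finset.mem_filter, Finset.mem_product, Finset.mem_range] at hx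
    obtain ⟨⟨hr, hb⟩, hrl, hbl⟩ := hx
    simp only
    have hr1 : 1 ≤ r := by
      rcases Nat.eq_zero_or_pos r with h | h
      · rw [h] at hrl; omega
      · exact h
    have hb1 : 1 ≤ b := by
      rcases Nat.eq_zero_or_pos b with h | h
      · rw [h] at hbl; omega
      · exact h
    have hsum : r + b ≤ (k - j) * (r + b) := Nat.le_mul_of_pos_left _ (by omega)
    obtain ⟨v, hv⟩ : ∃ v, v = j + (k - j) * (r + b) - max r b := ⟨_, rfl⟩
    have hv' : v + max r b = j + (k - j) * (r + b) := by omega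
    rw [← hv]
    refine (witness_term_le (k := k) hr1 (by omega : 1 ≤ k - j) hv' (by omega) hK1 hε hε1
      p₁.2.1 p₂.2.1 h₁ h₂ hp').trans ?_
    have hvl : (v : ℝ) ≤ 8 * k * L := by
      have h1 : v ≤ 4 * k * l := by
        have h2 : (k - j) * (r + b) ≤ (k - j) * (4 * l) := Nat.mul_le_mul_left _ (by omega)
        have h3 : j ≤ j * (4 * l) := Nat.le_mul_of_pos_right j (by omega)
        have h4 : 4 * k * l = j * (4 * l) + (k - j) * (4 * l) := by
          rw [← add_mul, Nat.add_sub_cancel' hjk.le]; ring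
        omega
      have h2 : (v : ℝ) ≤ 4 * k * l := by exact_mod_cast h1
      nlinarith
    have hbase : A * v * (1 / (c * L)) ≤ Real.exp (-((j + 1) * K)) := by
      rw [Real.exp_neg, mul_one_div, div_le_iff₀ (by positivity), inv_mul_eq_div,
        le_div_iff₀ (Real.exp_pos _)]
      calc A * v * Real.exp ((j + 1) * K) ≤ A * (8 * k * L) * Real.exp ((j + 1) * K) := by gcongr
        _ = (Real.exp ((j + 1) * K) * (8 * k * A)) * L := by ring
        _ ≤ c * L := by gcongr
    have hM : (A * v * (1 / (c * L))) ^ max r b ≤ ((n : ℝ) ^ (j + 1))⁻¹ := by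
      calc _ ≤ Real.exp (-((j + 1) * K)) ^ max r b := by gcongr
        _ = Real.exp (-((j + 1) * (K * max r b))) := by
          rw [← Real.exp_nat_mul]; congr 1; push_cast; ring
        _ ≤ Real.exp (-((j + 1) * L)) := by
          rw [Real.exp_le_exp, neg_le_neg_iff]
          gcongr
          refine hlL.trans ?_
          have h1 : l ≤ k.choose j * max r b :=
            hrl.trans (Nat.mul_le_mul_left _ (le_max_left _ _))
          have h2 : (l : ℝ) ≤ K * (max r b : ℕ) := by rw [hK]; exact_mod_cast h1
          exact_mod_cast h2
        _ = ((n : ℝ) ^ (j + 1))⁻¹ := by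
          rw [Real.exp_neg, hLdef, ← Real.exp_log (pow_pos hn0 (j + 1)), Real.log_pow]
          push_cast
          rfl
    calc _ ≤ (n : ℝ) ^ j * ((8 * k * L) ^ k) ^ 2 * ((n : ℝ) ^ (j + 1))⁻¹ := by gcongr
      _ = _ := by
        rw [← pow_mul, mul_comm k 2, pow_succ]
        field_simp
  refine (Finset.sum_le_sum hterm).trans ?_
  rw [Finset.sum_const, nsmul_eq_mul]
  have hcard : (((Finset.range (2 * l) ×ˢ Finset.range (2 * l)).filter
          (fun x => l ≤ k.choose j * x.1 ∧ l ≤ k.choose j * x.2)).card : ℝ) ≤ 16 * L ^ 2 := by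
    have h1 := Finset.card_filter_le (Finset.range (2 * l) ×ˢ Finset.range (2 * l))
      (fun x => l ≤ k.choose j * x.1 ∧ l ≤ k.choose j * x.2)
    rw [Finset.card_product, Finset.card_range] at h1
    have h2 : (((Finset.range (2 * l) ×ˢ Finset.range (2 * l)).filter
          (fun x => l ≤ k.choose j * x.1 ∧ l ≤ k.choose j * x.2)).card : ℝ) ≤
          (2 * l) * (2 * l) := by exact_mod_cast h1
    nlinarith
  calc _ ≤ 16 * L ^ 2 * ((8 * k * L) ^ (2 * k) / n) := by gcongr
    _ = _ := by rw [mul_pow (8 * (k : ℝ)), pow_add]; ring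

theorem eventually_mul_log_le (a : ℝ) : ∀ᶠ n : ℕ in atTop, a * Real.log n ≤ n := by
  have h := (Real.isLittleO_log_id_atTop.comp_tendsto tendsto_natCast_atTop_atTop).bound
    (c := 1 / (|a| + 1)) (by positivity)
  filter_upwards [h, eventually_ge_atTop 1] with n hn hn1
  have hlog : 0 ≤ Real.log n := Real.log_natCast_nonneg n
  simp only [Function.comp, id, Real.norm_eq_abs, abs_of_nonneg hlog, Nat.abs_cast] at hn
  rw [one_div, inv_mul_eq_div, le_div_iff₀ (by positivity)] at hn
  nlinarith [le_abs_self a]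

theorem tendsto_real_one_of_le {k : ℕ} {p₁ p₂ : ℕ → I} {A : ∀ n, Set (DoubleKGraph (Fin n) k)}
    {δ : ℕ → ℝ} (hδ : Tendsto δ atTop (𝓝 0))
    (h : ∀ᶠ n : ℕ in atTop, (binomialDoubleKGraph k n (p₁ n) (p₂ n)).real (A n)ᶜ ≤ δ n) :
    Tendsto (fun n : ℕ => binomialDoubleKGraph k n (p₁ n) (p₂ n) (A n)) atTop (𝓝 1) := by
  have h0 : Tendsto (fun n : ℕ => (binomialDoubleKGraph k n (p₁ n) (p₂ n)).real (A n)ᶜ)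
      atTop (𝓝 0) :=
    tendsto_of_tendsto_of_tendsto_of_le_of_le' tendsto_const_nhds hδ
      (Eventually.of_forall fun n => measureReal_nonneg) h
  have h1 : Tendsto (fun n : ℕ => (binomialDoubleKGraph k n (p₁ n) (p₂ n)).real (A n))
      atTop (𝓝 1) := by
    have := h0.const_sub 1
    rw [sub_zero] at this
    refine this.congr fun n => ?_
    rw [measureReal_compl']
    ring
  rw [← ENNReal.ofReal_one]
  refine (ENNReal.tendsto_ofReal h1).congr fun n => ?_
  exact ENNReal.ofReal_toReal (measure_ne_top _ _)

/-- Below the threshold the process does not percolate with high probability. If one colour has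
fewer than `ε * n ^ j` edges on average, then its edges do not even cover the `j`-sets; otherwise
the union bound over witnesses of logarithmic size applies. -/
theorem not_percolates_of_subcritical {k j : ℕ} (hj : 1 ≤ j) (hjk : j < k) :
    ∃ c₀ : ℝ, 0 < c₀ ∧ ∀ c, c₀ ≤ c → ∀ p₁ p₂ : ℕ → I,
      (∀ᶠ n : ℕ in atTop,
        (p₁ n : ℝ) * (p₂ n : ℝ) ≤ 1 / (c * (n : ℝ) ^ (2 * k - 2 * j - 1) * Real.log n)) →
      Tendsto (fun n : ℕ => binomialDoubleKGraph k n (p₁ n) (p₂ n) {H | ¬ H.Percolates j})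
        atTop (𝓝 1) := by
  set D : ℕ := 2 ^ j * j.factorial with hD
  have hDpos : 0 < D := Nat.mul_pos (by positivity) j.factorial_pos
  have hD' : (1 : ℝ) ≤ D := by exact_mod_cast hDpos
  set K : ℝ := ((k.choose j : ℕ) : ℝ) with hK
  have hK1 : 1 ≤ K := Nat.one_le_cast.2 (Nat.choose_pos hjk.le)
  set ε : ℝ := Real.exp (-2) / (K * D) with hε
  have hε0 : 0 < ε := by positivity
  have hε1 : ε ≤ 1 := by
    rw [hε, div_le_one (by positivity)]
    have : Real.exp (-2) ≤ 1 := Real.exp_le_one_iff.2 (by norm_num)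
    nlinarith
  have hk0 : (0 : ℝ) < k := by exact_mod_cast (by omega : 0 < k)
  refine ⟨Real.exp ((j + 1) * K) * (8 * k * (Real.exp (j + 2 * (k - j : ℕ)) *
      (8 * K) ^ 2 * (1 / ε) ^ 2)), by positivity, fun c hc p₁ p₂ hp => ?_⟩
  refine tendsto_real_one_of_le (δ := fun n => Real.exp (-(n / (K * D))) +
    16 * (8 * k) ^ (2 * k) * (Real.log n ^ (2 * k + 2) / n)) ?_ ?_
  · have h1 : Tendsto (fun n : ℕ => Real.exp (-((n : ℝ) / (K * D)))) atTop (𝓝 0) :=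
      Real.tendsto_exp_neg_atTop_nhds_zero.comp
        (tendsto_natCast_atTop_atTop.atTop_div_const (by positivity))
    have h2 : Tendsto (fun n : ℕ => Real.log n ^ (2 * k + 2) / (n : ℝ)) atTop (𝓝 0) :=
      ((Real.isLittleO_pow_log_id_atTop (n := 2 * k + 2)).comp_tendsto
        tendsto_natCast_atTop_atTop).tendsto_div_nhds_zero
    simpa using h1.add (h2.const_mul (16 * (8 * (k : ℝ)) ^ (2 * k)))
  · have hlog : Tendsto (fun n : ℕ => Real.log n) atTop atTop :=
      Real.tendsto_log_atTop.comp tendsto_natCast_atTop_atTop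
    filter_upwards [hp, eventually_ge_atTop (2 * j), hlog.eventually_ge_atTop 2,
      eventually_mul_log_le (8 * k), eventually_mul_log_le (2 * D),
      eventually_ge_atTop 1] with n hpn hn hL hLn hLD hn1
    have hset : {H : DoubleKGraph (Fin n) k | ¬ H.Percolates j}ᶜ = {H | H.Percolates j} := by
      ext; simp
    rw [hset]
    have hlog0 : 0 ≤ Real.log n := by linarith
    have hLN : 2 * Real.log n ≤ n.choose j := by
      have h1 := pow_le_mul_choose hn
      have h2 : (n : ℝ) ≤ (n : ℝ) ^ j := by exact_mod_cast Nat.le_self_pow (by omega) n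
      rw [← hD] at h1
      have h3 : (D : ℝ) * (2 * Real.log n) ≤ D * n.choose j := by nlinarith
      exact le_of_mul_le_mul_left h3 (by positivity)
    have hN : 2 ≤ n.choose j := by
      have : (2 : ℝ) ≤ n.choose j := by linarith
      exact_mod_cast this
    have e1 : 0 ≤ Real.exp (-((n : ℝ) / (K * D))) := (Real.exp_pos _).le
    have e2 : 0 ≤ 16 * (8 * (k : ℝ)) ^ (2 * k) * (Real.log n ^ (2 * k + 2) / n) := by positivity
    by_cases h₁ : ε ≤ (p₁ n : ℝ) * (n : ℝ) ^ (k - j)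
    · by_cases h₂ : ε ≤ (p₂ n : ℝ) * (n : ℝ) ^ (k - j)
      · have := real_percolates_le_of_dense hj hjk (p₁ n) (p₂ n) hε0 hε1 hc h₁ h₂ hpn hL hLn hLN
        rw [mul_div_assoc] at this
        linarith
      · have := real_percolates_le_of_sparse hj hjk (p₁ n) (p₂ n) false hn hN (not_le.1 h₂).le
        simp only [← hD, ← hK] at this
        linarith
    · have := real_percolates_le_of_sparse hj hjk (p₁ n) (p₂ n) true hn hN (not_le.1 h₁).le
      simp only [← hD, ← hK] at this
      linarith

/-! ### Exposing a random object and continuing from it -/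

section

variable {Ω ι : Type*} {X : ι → Ω → Prop} [MeasurableSpace Ω] {μ : Measure Ω}
  [IsProbabilityMeasure μ] [DiscreteMeasurableSpace Ω]

/-- If with probability at least `1 - δ` some object `t` has the property `P t`, which is
determined by the coordinates in `S`, and for each such object the event `F t`, determined by other
coordinates, has probability at most `β`, then `F t` holds for all these objects with probability
at most `δ + β`. -/
theorem CoordIndep.le_add_of_exists {τ : Type*} [Finite τ] (h : CoordIndep X μ) {S S' : Set ι}
    (hS : Disjoint S S') {P : τ → Ω → Prop} {F : τ → Set Ω} {δ β : ℝ}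
    (hP : ∀ t ω ω', (∀ i ∈ S, X i ω ↔ X i ω') → (P t ω ↔ P t ω'))
    (hF : ∀ t, (∃ ω, P t ω) → DetBy X S' (F t)) (hβ : 0 ≤ β)
    (hFβ : ∀ t, (∃ ω, P t ω) → μ.real (F t) ≤ β) (hδ : μ.real {ω | ∀ t, ¬ P t ω} ≤ δ) :
    μ.real {ω | ∀ t, P t ω → ω ∈ F t} ≤ δ + β := by
  classical
  let T : Ω → Option τ := fun ω => if hω : ∃ t, P t ω then some hω.choose else none
  let G : Option τ → Set Ω := fun o => {ω | ∃ t, o = some t ∧ (∃ ω', P t ω') ∧ ω ∈ F t}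
  have hT : ∀ ω ω', (∀ i ∈ S, X i ω ↔ X i ω') → T ω = T ω' := by
    intro ω ω' hω
    have : (fun t => P t ω) = fun t => P t ω' := funext fun t => propext (hP t ω ω' hω)
    simp only [T]
    have h2 : ∀ p q : τ → Prop, p = q →
        (if hω : ∃ t, p t then some hω.choose else none) =
        (if hω : ∃ t, q t then some hω.choose else none) := by
      rintro p _ rfl
      rfl
    exact h2 _ _ this
  have hG : ∀ o, DetBy X S' (G o) := by
    intro o ω ω' hω
    refine exists_congr fun t => and_congr_right fun _ => and_congr_right fun ht => ?_
    exact hF t ht ω ω' hω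
  have hGβ : ∀ o, μ.real (G o) ≤ β := by
    intro o
    by_cases ho : ∃ t, o = some t ∧ ∃ ω', P t ω'
    · obtain ⟨t, rfl, ht⟩ := ho
      refine (measureReal_mono ?_).trans (hFβ t ht)
      rintro ω ⟨t', htt, -, hω⟩
      rwa [Option.some.inj htt]
    · have : G o = ∅ := by
        ext ω
        simp only [G, Set.mem_ofPred_eq, Set.mem_empty_iff_false, iff_false]
        rintro ⟨t, h1, h2, -⟩
        exact ho ⟨t, h1, h2⟩
      rw [this, measureReal_empty]
      exact hβ
  have hcond := h.le_of_cond (S := S) (T := T) hT (S' := fun _ => S') (fun _ => hS) (F := G) hG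
    (E := {ω | (∃ t, P t ω) ∧ ∀ t, P t ω → ω ∈ F t}) (fun ω hω => by
      obtain ⟨h1, h2⟩ := hω
      refine ⟨h1.choose, ?_, ⟨ω, h1.choose_spec⟩, h2 _ h1.choose_spec⟩
      simp only [T]
      rw [dif_pos h1]) hGβ
  have hsub : {ω | ∀ t, P t ω → ω ∈ F t} ⊆
      {ω | ∀ t, ¬ P t ω} ∪ {ω | (∃ t, P t ω) ∧ ∀ t, P t ω → ω ∈ F t} := by
    intro ω hω
    by_cases h1 : ∃ t, P t ω
    · exact Or.inr ⟨h1, hω⟩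
    · exact Or.inl (not_exists.1 h1)
  exact (measureReal_mono hsub).trans ((measureReal_union_le _ _).trans (add_le_add hδ hcond))

end

/-! ### Two random graphs: edges between sets -/

section

variable {Ω α : Type*} {X : Bool × Sym2 α → Ω → Prop}

/-- The vertex `w` has both a red and a blue neighbour in `S`. -/
def JoinsTo (X : Bool × Sym2 α → Ω → Prop) (ω : Ω) (S : Finset α) (w : α) : Prop :=
  ∀ c, ∃ a ∈ S, X (c, s(a, w)) ω

theorem detBy_neighbor (X : Bool × Sym2 α → Ω → Prop) (c : Bool) (S : Finset α) (w : α) :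
    DetBy X {i | i.1 = c ∧ ∃ a ∈ S, i.2 = s(a, w)} {ω | ∃ a ∈ S, X (c, s(a, w)) ω} :=
  fun _ _ hω => exists_congr fun a => and_congr_right fun ha => hω _ ⟨rfl, a, ha, rfl⟩

/-- The pairs between a fixed set and different outside vertices are different. -/
theorem pairwiseDisjoint_pairs {S W : Finset α} (hSW : Disjoint S W) (C : Bool → Prop) :
    (W : Set α).PairwiseDisjoint
      fun w => {i : Bool × Sym2 α | C i.1 ∧ ∃ a ∈ S, i.2 = s(a, w)} := by
  intro w hw w' hw' hne
  rw [Function.onFun, Set.disjoint_left]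
  rintro i ⟨-, a, ha, h1⟩ ⟨-, b, hb, h2⟩
  rw [h1, Sym2.eq_iff] at h2
  rcases h2 with ⟨-, h2⟩ | ⟨h2, -⟩
  · exact hne h2
  · exact Finset.disjoint_left.1 hSW ha (h2 ▸ hw')

variable [MeasurableSpace Ω] {μ : Measure Ω} [IsProbabilityMeasure μ] [DiscreteMeasurableSpace Ω]

theorem CoordIndep.no_neighbor_le (h : CoordIndep X μ) (c : Bool) {S : Finset α} {w : α}
    {p : ℝ} (hp : ∀ a ∈ S, p ≤ μ.real {ω | X (c, s(a, w)) ω}) :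
    μ.real {ω | ∀ a ∈ S, ¬ X (c, s(a, w)) ω} ≤ (1 - p) ^ S.card := by
  have hinj : Function.Injective fun a => (c, s(a, w)) := by
    intro a b hab
    exact Sym2.congr_left.1 (Prod.mk.inj hab).2
  have := h.none_coord_le (S.map ⟨_, hinj⟩) (p := p) (by simpa using hp)
  simpa using this

theorem CoordIndep.neighbor_ge (h : CoordIndep X μ) (c : Bool) {S : Finset α} {w : α}
    {p : ℝ} (hp : ∀ a ∈ S, p ≤ μ.real {ω | X (c, s(a, w)) ω}) :
    1 - (1 - p) ^ S.card ≤ μ.real {ω | ∃ a ∈ S, X (c, s(a, w)) ω} := by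
  have h1 := h.no_neighbor_le c hp
  have h2 : {ω | ∃ a ∈ S, X (c, s(a, w)) ω} = {ω | ∀ a ∈ S, ¬ X (c, s(a, w)) ω}ᶜ := by
    ext ω; simp
  rw [h2, measureReal_compl']
  linarith

theorem CoordIndep.joinsTo_ge (h : CoordIndep X μ) {S : Finset α} {w : α}
    {p : Bool → ℝ} (hp0 : ∀ c, 0 ≤ p c) (hp1 : ∀ c, p c ≤ 1)
    (hp : ∀ c, ∀ a ∈ S, p c ≤ μ.real {ω | X (c, s(a, w)) ω}) :
    (1 - (1 - p true) ^ S.card) * (1 - (1 - p false) ^ S.card) ≤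
      μ.real {ω | JoinsTo X ω S w} := by
  have hset : {ω | JoinsTo X ω S w} =
      {ω | ∃ a ∈ S, X (true, s(a, w)) ω} ∩ {ω | ∃ a ∈ S, X (false, s(a, w)) ω} := by
    ext ω
    simp [JoinsTo, and_comm]
  rw [hset, h _ _ _ _ ?_ (detBy_neighbor X true S w) (detBy_neighbor X false S w)]
  · have h1 : ∀ c, 0 ≤ 1 - (1 - p c) ^ S.card := fun c => by
      have := pow_le_one₀ (n := S.card) (by linarith [hp1 c] : 0 ≤ 1 - p c) (by linarith [hp0 c])
      linarith
    exact mul_le_mul (h.neighbor_ge true (hp true)) (h.neighbor_ge false (hp false)) (h1 _)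
      measureReal_nonneg
  · rw [Set.disjoint_left]
    rintro i ⟨h1, -⟩ ⟨h2, -⟩
    rw [h1] at h2
    exact absurd h2 (by simp)

theorem CoordIndep.no_joinsTo_le (h : CoordIndep X μ) {S W : Finset α} (hSW : Disjoint S W)
    {p : Bool → ℝ} (hp0 : ∀ c, 0 ≤ p c) (hp1 : ∀ c, p c ≤ 1)
    (hp : ∀ c, ∀ a ∈ S, ∀ w ∈ W, p c ≤ μ.real {ω | X (c, s(a, w)) ω}) :
    μ.real {ω | ∀ w ∈ W, ¬ JoinsTo X ω S w} ≤
      (1 - (1 - (1 - p true) ^ S.card) * (1 - (1 - p false) ^ S.card)) ^ W.card := by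
  refine h.none_le W (fun w => {i | True ∧ ∃ a ∈ S, i.2 = s(a, w)}) (fun w => {ω | JoinsTo X ω S w})
    (pairwiseDisjoint_pairs hSW fun _ => True) ?_ ?_
  · intro w _ ω ω' hω
    exact forall_congr' fun c => exists_congr fun a => and_congr_right fun ha =>
      hω _ ⟨trivial, a, ha, rfl⟩
  · intro w hw
    exact h.joinsTo_ge hp0 hp1 fun c a ha => hp c a ha w hw

/-- No edge of colour `c` between two disjoint sets. -/
theorem CoordIndep.no_edge_between_le (h : CoordIndep X μ) (c : Bool) {S W : Finset α}
    (hSW : Disjoint S W) {p : ℝ} (hp : ∀ a ∈ S, ∀ w ∈ W, p ≤ μ.real {ω | X (c, s(a, w)) ω}) :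
    μ.real {ω | ∀ a ∈ S, ∀ w ∈ W, ¬ X (c, s(a, w)) ω} ≤ (1 - p) ^ (S.card * W.card) := by
  classical
  have hinj : Set.InjOn (fun x : α × α => (c, s(x.1, x.2))) (S ×ˢ W : Finset (α × α)) := by
    rintro ⟨a, w⟩ h1 ⟨b, w'⟩ h2 hab
    simp only [Finset.coe_product, Set.mem_prod, Finset.mem_coe] at h1 h2
    simp only [Prod.mk.injEq, true_and, Sym2.eq_iff] at hab
    rcases hab with ⟨h3, h4⟩ | ⟨h3, -⟩
    · rw [h3, h4]
    · exact absurd h2.2 (Finset.disjoint_left.1 hSW (h3 ▸ h1.1))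
  have := h.none_coord_le ((S ×ˢ W).image fun x => (c, s(x.1, x.2))) (p := p) (by
    intro t ht
    obtain ⟨⟨a, w⟩, hx, rfl⟩ := Finset.mem_image.1 ht
    obtain ⟨ha, hw⟩ := Finset.mem_product.1 hx
    exact hp a ha w hw)
  rw [Finset.card_image_of_injOn hinj, Finset.card_product] at this
  refine le_trans (measureReal_mono ?_) this
  intro ω hω t ht
  obtain ⟨⟨a, w⟩, hx, rfl⟩ := Finset.mem_image.1 ht
  obtain ⟨ha, hw⟩ := Finset.mem_product.1 hx
  exact hω a ha w hw

end

/-! ### Growing a small cluster vertex by vertex -/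

section

variable {Ω α : Type*} [DecidableEq α] {X : Bool × Sym2 α → Ω → Prop}

/-- Starting from the cluster `S`, one can add `t` vertices one after the other, from the levels
`i, i + 1, …`, avoiding the vertices in `U`, such that each of them has a red and a blue neighbour
among its predecessors. -/
def Grows (X : Bool × Sym2 α → Ω → Prop) (lev : α → ℕ) (ω : Ω) (U : Finset α) :
    ℕ → ℕ → Finset α → Prop
  | 0, _, _ => True
  | t + 1, i, S => ∃ w, lev w = i ∧ w ∉ U ∧ JoinsTo X ω S w ∧ Grows X lev ω U t (i + 1) (insert w S)

theorem Grows.mono {lev : α → ℕ} {ω : Ω} {U U' : Finset α} (hU : U ⊆ U') {t i : ℕ} {S : Finset α}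
    (h : Grows X lev ω U' t i S) : Grows X lev ω U t i S := by
  induction t generalizing i S with
  | zero => trivial
  | succ t ih =>
    obtain ⟨w, h1, h2, h3, h4⟩ := h
    exact ⟨w, h1, fun hw => h2 (hU hw), h3, ih h4⟩

theorem grows_congr {lev : α → ℕ} {ω ω' : Ω} {U : Finset α} {t i : ℕ} {S : Finset α}
    (h : ∀ c a b, i ≤ lev b → b ∉ U → (a ∈ S ∨ a ∉ U) →
      (X (c, s(a, b)) ω ↔ X (c, s(a, b)) ω')) :
    Grows X lev ω U t i S ↔ Grows X lev ω' U t i S := by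
  induction t generalizing i S with
  | zero => exact Iff.rfl
  | succ t ih =>
    refine exists_congr fun w => and_congr_right fun h1 => and_congr_right fun h2 => and_congr ?_ ?_
    · exact forall_congr' fun c => exists_congr fun a => and_congr_right fun ha =>
        h c a w h1.ge h2 (Or.inl ha)
    · refine ih fun c a b hb hbU ha => h c a b (by omega) hbU ?_
      rcases ha with ha | ha
      · rcases Finset.mem_insert.1 ha with rfl | ha
        · exact Or.inr h2
        · exact Or.inl ha
      · exact Or.inr ha

/-- No vertex of `M` grows into a cluster with `l` more vertices from the levels `1, …, l` outside
`U`. -/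
def NoSeed (X : Bool × Sym2 α → Ω → Prop) (lev : α → ℕ) (l : ℕ) (M U : Finset α) : Set Ω :=
  {ω | ∀ r ∈ M, ¬ Grows X lev ω U l 1 {r}}

variable [Fintype α] [MeasurableSpace Ω] {μ : Measure Ω} [IsProbabilityMeasure μ]
  [DiscreteMeasurableSpace Ω]

/-- One attempt to grow a cluster, followed by the remaining attempts, which must avoid the vertices
used so far. The exposed pairs all meet the current cluster, so that the remaining attempts are
independent of them. -/
theorem CoordIndep.not_grows_le (h : CoordIndep X μ) {lev : α → ℕ} {l N : ℕ} {q : ℕ → ℝ}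
    (hq0 : ∀ i, 0 ≤ q i) (hq1 : ∀ i, q i ≤ 1)
    (hq : ∀ S U : Finset α, 1 ≤ S.card → S.card ≤ l → (∀ a ∈ S, lev a < S.card) → U.card ≤ N →
      μ.real {ω | ∀ w, lev w = S.card → w ∉ U → ¬ JoinsTo X ω S w} ≤ 1 - q S.card)
    {M U : Finset α} (hM : ∀ r ∈ M, lev r = 0) (hU : U.card ≤ N) {N' : ℕ} {β : ℝ} (hβ0 : 0 ≤ β)
    (hβ : ∀ U' : Finset α, U'.card ≤ N' → μ.real (NoSeed X lev l M U') ≤ β)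
    (t : ℕ) (S : Finset α) (hS1 : 1 ≤ S.card) (ht : t + S.card = l + 1)
    (hlev : ∀ a ∈ S, lev a < S.card) (hMS : Disjoint M S) (hN' : (U ∪ S).card + t ≤ N') :
    μ.real {ω | ¬ Grows X lev ω U t S.card S ∧ ω ∈ NoSeed X lev l M (U ∪ S)} ≤
      (1 - ∏ i ∈ Finset.range t, q (S.card + i)) * β := by
  classical
  induction t generalizing S with
  | zero =>
    simp [Grows]
  | succ t ih =>
    set i := S.card with hi
    set Q := ∏ x ∈ Finset.range t, q (i + 1 + x) with hQ
    have hQ0 : 0 ≤ Q := Finset.prod_nonneg fun _ _ => hq0 _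
    have hQ1 : Q ≤ 1 := Finset.prod_le_one (fun _ _ => hq0 _) fun _ _ => hq1 _
    have hprod : ∏ x ∈ Finset.range (t + 1), q (i + x) = q i * Q := by
      rw [Finset.prod_range_succ', mul_comm, add_zero]
      congr 1
      exact Finset.prod_congr rfl fun x _ => by congr 1; ring
    let J : Ω → α → Prop := fun ω w => lev w = i ∧ w ∉ U ∧ JoinsTo X ω S w
    let D : Set (Bool × Sym2 α) := {x | ∃ a ∈ S, ∃ b, lev b = i ∧ x.2 = s(a, b)}
    have hJ : ∀ ω ω', (∀ x ∈ D, X x ω ↔ X x ω') → J ω = J ω' := by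
      intro ω ω' hω
      funext w
      refine propext (and_congr_right fun h1 => and_congr_right fun h2 => ?_)
      exact forall_congr' fun c => exists_congr fun a => and_congr_right fun ha =>
        hω _ ⟨a, ha, w, h1, rfl⟩
    let pick : (α → Prop) → Option α := fun P => if hP : ∃ w, P w then some hP.choose else none
    let T : Ω → Option α := fun ω => pick (J ω)
    have hTsome : ∀ ω w, T ω = some w → J ω w := by
      intro ω w hw
      simp only [T, pick] at hw
      split_ifs at hw with hP
      rw [← Option.some.inj hw]
      exact hP.choose_spec
    have hTnone : ∀ ω, T ω = none → ∀ w, ¬ J ω w := by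
      intro ω hw
      simp only [T, pick] at hw
      split_ifs at hw with hP
      exact not_exists.1 hP
    let F : Option α → Set Ω := fun o => match o with
      | none => NoSeed X lev l M (U ∪ S)
      | some w => {ω | (lev w = i ∧ w ∉ U) ∧ ¬ Grows X lev ω U t (i + 1) (insert w S) ∧
          ω ∈ NoSeed X lev l M (U ∪ insert w S)}
    -- the remaining attempts do not touch the vertices of the current cluster
    have hdetM : ∀ U' : Finset α, S ⊆ U' → DetBy X Dᶜ (NoSeed X lev l M U') := by
      intro U' hU' ω ω' hω
      refine forall₂_congr fun r hr => not_congr (grows_congr fun c a b _ hbU ha => hω _ ?_)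
      rintro ⟨a', ha', b', hb', hab⟩
      simp only [Sym2.eq_iff] at hab
      have hr' : r ∉ S := fun hrS => Finset.disjoint_left.1 hMS hr hrS
      rcases hab with ⟨rfl, rfl⟩ | ⟨rfl, rfl⟩
      · rcases ha with ha | ha
        · rw [Finset.mem_singleton] at ha
          exact hr' (ha ▸ ha')
        · exact ha (hU' ha')
      · exact hbU (hU' ha')
    have hdet : ∀ o, DetBy X Dᶜ (F o) := by
      intro o
      cases o with
      | none => exact hdetM _ Finset.subset_union_right
      | some w =>
        intro ω ω' hω
        refine and_congr_right fun hw => and_congr (not_congr (grows_congr ?_)) ?_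
        · intro c a b hb hbU ha
          refine hω _ ?_
          rintro ⟨a', ha', b', hb', hab⟩
          have := hlev a' ha'
          simp only [Sym2.eq_iff] at hab
          rcases hab with ⟨rfl, rfl⟩ | ⟨rfl, rfl⟩
          · omega
          · omega
        · exact hdetM _ ((Finset.subset_insert _ _).trans Finset.subset_union_right) ω ω' hω
    have hsum := h.le_sum_cond (S := D) (T := T) (fun ω ω' hω => congrArg pick (hJ ω ω' hω))
      (S' := fun _ => Dᶜ) (fun _ => disjoint_compl_right) (F := F) hdet
      (E := {ω | ¬ Grows X lev ω U (t + 1) i S ∧ ω ∈ NoSeed X lev l M (U ∪ S)}) (by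
        rintro ω ⟨h1, h2⟩
        cases hT : T ω with
        | none => exact h2
        | some w =>
          obtain ⟨hw1, hw2, hw3⟩ := hTsome ω w hT
          refine ⟨⟨hw1, hw2⟩, fun hg => h1 ⟨w, hw1, hw2, hw3, hg⟩, fun r hr hg => h2 r hr ?_⟩
          exact hg.mono (Finset.union_subset_union_right (Finset.subset_insert _ _)))
    refine hsum.trans ?_
    have hnone : μ.real {ω | T ω = none} ≤ 1 - q i := by
      refine (measureReal_mono ?_).trans (hq S U hS1 (by omega) hlev hU)
      intro ω hω w hw1 hw2 hw3
      exact hTnone ω hω w ⟨hw1, hw2, hw3⟩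
    have hFnone : μ.real (F none) ≤ β := hβ _ (by omega)
    have hFsome : ∀ w, μ.real (F (some w)) ≤ (1 - Q) * β := by
      intro w
      by_cases hw : lev w = i ∧ w ∉ U
      · have hwS : w ∉ S := fun hwS => by have := hlev w hwS; omega
        have hcard : (insert w S).card = i + 1 := Finset.card_insert_of_notMem hwS
        have hih := ih (insert w S) (by omega) (by omega) (by
            intro a ha
            rw [hcard]
            rcases Finset.mem_insert.1 ha with rfl | ha
            · omega
            · have := hlev a ha; omega) (by
            rw [Finset.disjoint_insert_right]
            refine ⟨fun hwM => ?_, hMS⟩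
            have := hM w hwM
            omega) (by
            have : U ∪ insert w S = insert w (U ∪ S) := Finset.union_insert w U S
            rw [this]
            have := Finset.card_insert_le w (U ∪ S)
            omega)
        rw [hcard] at hih
        refine (measureReal_mono ?_).trans hih
        rintro ω ⟨-, h1⟩
        exact h1
      · have : F (some w) = ∅ := by
          ext ω
          simp only [F, Set.mem_ofPred_eq, Set.mem_empty_iff_false, iff_false]
          exact fun h => hw h.1
        rw [this, measureReal_empty]
        exact mul_nonneg (by linarith) hβ0
    have htot := sum_measureReal_fiber (μ := μ) T
    rw [Fintype.sum_option] at htot ⊢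
    calc _ ≤ μ.real {ω | T ω = none} * β + ∑ w, μ.real {ω | T ω = some w} * ((1 - Q) * β) := by
          gcongr with w _
          exact hFsome w
      _ = (1 - Q + Q * μ.real {ω | T ω = none}) * β := by
          rw [← Finset.sum_mul, eq_sub_of_add_eq' htot]
          ring
      _ ≤ (1 - Q + Q * (1 - q i)) * β := by gcongr
      _ = _ := by rw [hprod]; ring

/-- Many attempts to grow a small cluster fail only with exponentially small probability. -/
theorem CoordIndep.noSeed_le (h : CoordIndep X μ) {lev : α → ℕ} {l N : ℕ} {q : ℕ → ℝ}
    (hq0 : ∀ i, 0 ≤ q i) (hq1 : ∀ i, q i ≤ 1)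
    (hq : ∀ S U : Finset α, 1 ≤ S.card → S.card ≤ l → (∀ a ∈ S, lev a < S.card) → U.card ≤ N →
      μ.real {ω | ∀ w, lev w = S.card → w ∉ U → ¬ JoinsTo X ω S w} ≤ 1 - q S.card)
    (M U : Finset α) (hM : ∀ r ∈ M, lev r = 0) (hN : U.card + M.card * (l + 1) ≤ N) :
    μ.real (NoSeed X lev l M U) ≤ (1 - ∏ i ∈ Finset.range l, q (1 + i)) ^ M.card := by
  induction M using Finset.induction_on generalizing U with
  | empty => simp
  | insert r M hr ih =>
    have hQ1 : ∏ i ∈ Finset.range l, q (1 + i) ≤ 1 :=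
      Finset.prod_le_one (fun _ _ => hq0 _) fun _ _ => hq1 _
    rw [Finset.card_insert_of_notMem hr] at hN ⊢
    have hN2 : U.card + (l + 1) + M.card * (l + 1) ≤ N := by
      rw [add_mul] at hN; omega
    have hM' : ∀ r ∈ M, lev r = 0 := fun r hr => hM r (Finset.mem_insert_of_mem hr)
    have hr0 := hM r (Finset.mem_insert_self r M)
    have key := h.not_grows_le hq0 hq1 hq hM' (U := U) (by omega) (N' := U.card + (l + 1))
      (pow_nonneg (by linarith) _) (fun U' hU' => ih U' hM' (by omega)) l {r} (by simp) (by simp)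
      (by simp [hr0]) (by simpa using hr) (by
        have := Finset.card_union_le U {r}
        rw [Finset.card_singleton] at this
        omega)
    rw [Finset.card_singleton] at key
    rw [pow_succ, mul_comm]
    refine (measureReal_mono ?_).trans key
    intro ω hω
    refine ⟨hω r (Finset.mem_insert_self r M), fun r' hr' hg => ?_⟩
    exact hω r' (Finset.mem_insert_of_mem hr') (hg.mono Finset.subset_union_left)

end

/-! ### Expanding a cluster through a component of the sparser graph -/

theorem one_sub_pow_le_exp {p : ℝ} (hp1 : p ≤ 1) (n : ℕ) : (1 - p) ^ n ≤ Real.exp (-(p * n)) := by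
  calc (1 - p) ^ n ≤ Real.exp (-p) ^ n := by
        have := Real.one_sub_le_exp_neg p
        gcongr
    _ = Real.exp (-(p * n)) := by rw [← Real.exp_nat_mul]; congr 1; ring

/-- If there is an edge across every cut of `Y` whose smaller side has at least a quarter of the
vertices, then some connected set contains three quarters of `Y`: take a smallest union of
components with this many vertices. -/
theorem exists_large_cutConnected {α : Type*} [DecidableEq α] {adj : α → α → Prop}
    (hsymm : ∀ a b, adj a b → adj b a) {Y : Finset α}
    (hY : ∀ A ⊆ Y, Y.card ≤ 4 * A.card → 4 * A.card ≤ 3 * Y.card → ∃ a ∈ A, ∃ b ∈ Y \ A, adj a b) :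
    ∃ Z ⊆ Y, 3 * Y.card ≤ 4 * Z.card ∧ CutConnected adj Z := by
  classical
  let 𝒰 := Y.powerset.filter fun U => 3 * Y.card ≤ 4 * U.card ∧ ∀ a ∈ U, ∀ b ∈ Y \ U, ¬ adj a b
  have hne : 𝒰.Nonempty := ⟨Y, Finset.mem_filter.2 ⟨Finset.mem_powerset_self Y, by omega, by simp⟩⟩
  obtain ⟨U, hU, hmin⟩ := 𝒰.exists_min_image Finset.card hne
  simp only [𝒰, Finset.mem_filter, Finset.mem_powerset] at hU hmin
  obtain ⟨hUY, hUc, hUcl⟩ := hU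
  refine ⟨U, hUY, hUc, ?_⟩
  intro A hA hAne hAU
  by_contra hcon
  push Not at hcon
  have hAcl : ∀ a ∈ A, ∀ b ∈ Y \ A, ¬ adj a b := by
    intro a ha b hb
    rw [Finset.mem_sdiff] at hb
    by_cases hbU : b ∈ U
    · exact hcon a ha b hbU hb.2
    · exact hUcl a (hA ha) b (Finset.mem_sdiff.2 ⟨hb.1, hbU⟩)
  have hBcl : ∀ a ∈ U \ A, ∀ b ∈ Y \ (U \ A), ¬ adj a b := by
    intro a ha b hb hab
    rw [Finset.mem_sdiff] at ha hb
    by_cases hbU : b ∈ U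
    · have hbA : b ∈ A := by
        by_contra h
        exact hb.2 (Finset.mem_sdiff.2 ⟨hbU, h⟩)
      exact hcon b hbA a ha.1 ha.2 (hsymm _ _ hab)
    · exact hUcl a ha.1 b (Finset.mem_sdiff.2 ⟨hb.1, hbU⟩) hab
  have hcard : (U \ A).card + A.card = U.card := Finset.card_sdiff_add_card_eq_card hA
  have hA1 := Finset.card_pos.2 hAne
  have hA2 := Finset.card_lt_card (Finset.ssubset_iff_subset_ne.2 ⟨hA, hAU⟩)
  have hAs : 4 * A.card < 3 * Y.card := by
    by_contra h
    have := hmin A ⟨hA.trans hUY, by omega, hAcl⟩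
    omega
  have hBs : 4 * (U \ A).card < 3 * Y.card := by
    by_contra h
    have := hmin (U \ A) ⟨Finset.sdiff_subset.trans hUY, by omega, hBcl⟩
    omega
  by_cases hAl : Y.card ≤ 4 * A.card
  · obtain ⟨a, ha, b, hb, hab⟩ := hY A (hA.trans hUY) hAl hAs.le
    exact hAcl a ha b hb hab
  · obtain ⟨a, ha, b, hb, hab⟩ := hY (U \ A) (Finset.sdiff_subset.trans hUY) (by omega) hBs.le
    exact hBcl a ha b hb hab

/-- The set `S` expands to `Z`: every vertex of `Z` has a blue neighbour in `S`, the red graph on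
`Z` is connected, and some red edge joins `S` and `Z`. If `S` lies in one cluster, then so does
`S ∪ Z`. -/
def Expands {Ω α : Type*} (X : Bool × Sym2 α → Ω → Prop) (ω : Ω) (S Z : Finset α) : Prop :=
  (∀ z ∈ Z, ∃ x ∈ S, X (false, s(x, z)) ω) ∧
    CutConnected (fun a b => X (true, s(a, b)) ω) Z ∧ ∃ x ∈ S, ∃ z ∈ Z, X (true, s(x, z)) ω

theorem cutConnected_congr {α : Type*} {adj adj' : α → α → Prop} {Z : Finset α}
    (h : ∀ a ∈ Z, ∀ b ∈ Z, adj a b ↔ adj' a b) : CutConnected adj Z ↔ CutConnected adj' Z := by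
  refine forall₄_congr fun A hA _ _ => ?_
  exact exists_congr fun a => and_congr_right fun ha => exists_congr fun b =>
    and_congr_right fun hb => and_congr_right fun _ => h a (hA ha) b hb

section

variable {Ω α : Type*} [DecidableEq α] {X : Bool × Sym2 α → Ω → Prop}
  [MeasurableSpace Ω] {μ : Measure Ω} [IsProbabilityMeasure μ] [DiscreteMeasurableSpace Ω]

/-- A random graph of large constant average degree has a connected set with three quarters of the
vertices, up to exponentially small probability. Each of the at most `exp Y.card` cuts whose smaller
side has at least a quarter of the vertices contains `3 / 16 * Y.card ^ 2` pairs, and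
`11 * 3 / 16 ≥ 2`. -/
theorem CoordIndep.no_large_cutConnected_le (h : CoordIndep X μ) {Y : Finset α} {p : ℝ}
    (hp1 : p ≤ 1) (hp : ∀ a ∈ Y, ∀ b ∈ Y, a ≠ b → p ≤ μ.real {ω | X (true, s(a, b)) ω})
    (hY : 11 ≤ p * Y.card) :
    μ.real {ω | ∀ Z, ¬ (Z ⊆ Y ∧ 3 * Y.card ≤ 4 * Z.card ∧
      CutConnected (fun a b => X (true, s(a, b)) ω) Z)} ≤ Real.exp (-Y.card) := by
  classical
  have hsub : {ω | ∀ Z, ¬ (Z ⊆ Y ∧ 3 * Y.card ≤ 4 * Z.card ∧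
      CutConnected (fun a b => X (true, s(a, b)) ω) Z)} ⊆
      ⋃ A ∈ Y.powerset.filter (fun A => Y.card ≤ 4 * A.card ∧ 4 * A.card ≤ 3 * Y.card),
        {ω | ∀ a ∈ A, ∀ b ∈ Y \ A, ¬ X (true, s(a, b)) ω} := by
    intro ω hω
    by_contra hcon
    simp only [Set.mem_iUnion, not_exists, Finset.mem_filter, Finset.mem_powerset,
      Set.mem_ofPred_eq] at hcon
    obtain ⟨Z, hZ⟩ := exists_large_cutConnected (adj := fun a b => X (true, s(a, b)) ω) (Y := Y)
      (fun a b hab => by rwa [Sym2.eq_swap]) (fun A hA h1 h2 => by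
        have := hcon A ⟨hA, h1, h2⟩
        push Not at this
        exact this)
    exact hω Z hZ
  refine (measureReal_mono hsub (measure_ne_top _ _)).trans
    ((measureReal_biUnion_finset_le _ _).trans ?_)
  have hterm : ∀ A ∈ Y.powerset.filter (fun A => Y.card ≤ 4 * A.card ∧ 4 * A.card ≤ 3 * Y.card),
      μ.real {ω | ∀ a ∈ A, ∀ b ∈ Y \ A, ¬ X (true, s(a, b)) ω} ≤ Real.exp (-(2 * Y.card)) := by
    intro A hA
    simp only [Finset.mem_filter, Finset.mem_powerset] at hA
    obtain ⟨hAY, h1, h2⟩ := hA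
    refine (h.no_edge_between_le true Finset.disjoint_sdiff (p := p) ?_).trans
      ((one_sub_pow_le_exp hp1 _).trans ?_)
    · intro a ha b hb
      rw [Finset.mem_sdiff] at hb
      exact hp a (hAY ha) b hb.1 (by rintro rfl; exact hb.2 ha)
    · rw [Real.exp_le_exp, neg_le_neg_iff, Finset.card_sdiff_of_subset hAY, Nat.cast_mul,
        Nat.cast_sub (Finset.card_le_card hAY)]
      have h1' : (Y.card : ℝ) ≤ 4 * A.card := by exact_mod_cast h1
      have h2' : (4 * A.card : ℝ) ≤ 3 * Y.card := by exact_mod_cast h2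
      have hY0 : (0 : ℝ) ≤ Y.card := Nat.cast_nonneg _
      have hp0 : 0 ≤ p := by
        by_contra hneg
        nlinarith
      have h3 : 3 / 16 * (Y.card : ℝ) ^ 2 ≤ A.card * (Y.card - A.card) := by
        nlinarith [mul_nonneg (sub_nonneg.2 h1') (sub_nonneg.2 h2')]
      have h4 := mul_le_mul_of_nonneg_left h3 hp0
      have h5 := mul_le_mul_of_nonneg_right hY hY0
      nlinarith
  refine (Finset.sum_le_sum hterm).trans ?_
  rw [Finset.sum_const, nsmul_eq_mul]
  have hcard : ((Y.powerset.filter (fun A => Y.card ≤ 4 * A.card ∧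
      4 * A.card ≤ 3 * Y.card)).card : ℝ) ≤ Real.exp Y.card := by
    have h1 := Finset.card_filter_le Y.powerset
      (fun A => Y.card ≤ 4 * A.card ∧ 4 * A.card ≤ 3 * Y.card)
    rw [Finset.card_powerset] at h1
    calc _ ≤ (2 : ℝ) ^ Y.card := by exact_mod_cast h1
      _ ≤ Real.exp 1 ^ Y.card := by
          gcongr
          have := Real.add_one_le_exp (1 : ℝ)
          linarith
      _ = Real.exp Y.card := by rw [← Real.exp_nat_mul, mul_one]
  calc _ ≤ Real.exp Y.card * Real.exp (-(2 * Y.card)) := by gcongr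
    _ = Real.exp (-Y.card) := by rw [← Real.exp_add]; congr 1; ring

/-- A fixed set `S` expands into a fresh set `W` of vertices: its blue neighbourhood `Y` in `W` is
large, the red graph on `Y` has a large connected set, and this set has a red edge to `S`. -/
theorem CoordIndep.not_expands_le [Finite α] (h : CoordIndep X μ) {S W : Finset α}
    (hSW : Disjoint S W) {p₁ p₂ g y : ℝ} (hp₁ : 0 ≤ p₁) (hp₁' : p₁ ≤ 1)
    (hred : ∀ a ∈ S ∪ W, ∀ b ∈ W, a ≠ b → p₁ ≤ μ.real {ω | X (true, s(a, b)) ω})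
    (hblue : ∀ a ∈ S, ∀ b ∈ W, p₂ ≤ μ.real {ω | X (false, s(a, b)) ω})
    (hg1 : g ≤ 1) (hg : g ≤ 1 - (1 - p₂) ^ S.card) (hy0 : 0 ≤ y) (hy : y ≤ W.card * g / 4)
    (hpy : 11 ≤ p₁ * y) :
    μ.real {ω | ∀ Z, ¬ (Z ⊆ W ∧ 3 / 4 * y ≤ Z.card ∧ Expands X ω S Z)} ≤
      3 * Real.exp (-y) + Real.exp (-(p₁ * S.card * (3 / 4 * y))) := by
  classical
  let nb : Ω → Finset α := fun ω => W.filter fun w => ∃ x ∈ S, X (false, s(x, w)) ω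
  let F : Finset α → Set Ω := fun Y => {ω | ∀ Z, (Z ⊆ Y ∧ 3 * Y.card ≤ 4 * Z.card ∧
      CutConnected (fun a b => X (true, s(a, b)) ω) Z) →
        ω ∈ {ω | ∀ x ∈ S, ∀ z ∈ Z, ¬ X (true, s(x, z)) ω}}
  -- the red structure inside a fixed blue neighbourhood
  have hF : ∀ Y, (Y ⊆ W ∧ y ≤ Y.card) →
      μ.real (F Y) ≤ Real.exp (-y) + Real.exp (-(p₁ * S.card * (3 / 4 * y))) := by
    rintro Y ⟨hYW, hYc⟩
    have hSY : Disjoint S Y := hSW.mono_right hYW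
    refine h.le_add_of_exists (S := {i | ∃ a ∈ Y, ∃ b ∈ Y, i.2 = s(a, b)})
      (S' := {i | ∃ a ∈ S, ∃ b ∈ Y, i.2 = s(a, b)}) ?_ ?_ ?_ (Real.exp_pos _).le ?_ ?_
    · rw [Set.disjoint_left]
      rintro i ⟨a, ha, b, hb, h1⟩ ⟨a', ha', b', hb', h2⟩
      rw [h1, Sym2.eq_iff] at h2
      rcases h2 with ⟨rfl, rfl⟩ | ⟨rfl, rfl⟩
      · exact Finset.disjoint_left.1 hSY ha' ha
      · exact Finset.disjoint_left.1 hSY ha' hb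
    · intro Z ω ω' hω
      refine and_congr_right fun hZ => and_congr_right fun _ => cutConnected_congr ?_
      intro a ha b hb
      exact hω _ ⟨a, hZ ha, b, hZ hb, rfl⟩
    · rintro Z ⟨-, hZ, -, -⟩ ω ω' hω
      exact forall₂_congr fun x hx => forall₂_congr fun z hz =>
        not_congr (hω _ ⟨x, hx, z, hZ hz, rfl⟩)
    · rintro Z ⟨-, hZ, hZc, -⟩
      refine (h.no_edge_between_le true (hSY.mono_right hZ) (p := p₁) ?_).trans
        ((one_sub_pow_le_exp hp₁' _).trans ?_)
      · intro a ha b hb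
        refine hred a (Finset.mem_union_left _ ha) b (hYW (hZ hb)) ?_
        rintro rfl
        exact Finset.disjoint_left.1 hSY ha (hZ hb)
      · rw [Real.exp_le_exp, neg_le_neg_iff, Nat.cast_mul, ← mul_assoc p₁ (S.card : ℝ) (Z.card : ℝ)]
        have h1 : (3 * Y.card : ℝ) ≤ 4 * Z.card := by exact_mod_cast hZc
        exact mul_le_mul_of_nonneg_left (by linarith) (by positivity)
    · refine (h.no_large_cutConnected_le hp₁' ?_ ?_).trans ?_
      · intro a ha b hb hab
        exact hred a (Finset.mem_union_right _ (hYW ha)) b (hYW hb) hab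
      · exact hpy.trans (by gcongr)
      · rw [Real.exp_le_exp]
        linarith
  have hmain := h.le_add_of_exists (S := {i | i.1 = false}) (S' := {i | i.1 = true})
    (P := fun Y ω => Y = nb ω ∧ y ≤ Y.card) (F := F) (δ := 2 * Real.exp (-y))
    (β := Real.exp (-y) + Real.exp (-(p₁ * S.card * (3 / 4 * y)))) ?_ ?_ ?_
    (add_nonneg (Real.exp_pos _).le (Real.exp_pos _).le) ?_ ?_
  · refine (measureReal_mono ?_).trans (hmain.trans_eq (by ring))
    rintro ω hω Y ⟨rfl, hY⟩ Z ⟨hZ, hZc, hZconn⟩ x hx z hz hxz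
    refine hω Z ⟨hZ.trans (Finset.filter_subset _ _), ?_, ?_, hZconn, x, hx, z, hz, hxz⟩
    · have h1 : (3 * (nb ω).card : ℝ) ≤ 4 * Z.card := by exact_mod_cast hZc
      linarith
    · intro z hz
      exact (Finset.mem_filter.1 (hZ hz)).2
  · rw [Set.disjoint_left]
    intro i h1 h2
    simp only [Set.mem_ofPred_eq] at h1 h2
    rw [h1] at h2
    exact absurd h2 (by simp)
  · intro Y ω ω' hω
    have : nb ω = nb ω' := by
      refine Finset.filter_congr fun w _ => exists_congr fun x => and_congr_right fun _ => ?_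
      exact hω _ rfl
    rw [this]
  · intro Y _ ω ω' hω
    refine forall_congr' fun Z => imp_congr ?_ ?_
    · refine and_congr_right fun _ => and_congr_right fun _ => cutConnected_congr ?_
      intro a _ b _
      exact hω _ rfl
    · exact forall₂_congr fun x _ => forall₂_congr fun z _ => not_congr (hω _ rfl)
  · rintro Y ⟨ω, rfl, hY⟩
    exact hF _ ⟨Finset.filter_subset _ _, hY⟩
  · have hcount := h.count_lt_le W (fun w => {i | i.1 = false ∧ ∃ a ∈ S, i.2 = s(a, w)})
      (fun w => {ω | ∃ x ∈ S, X (false, s(x, w)) ω}) (pairwiseDisjoint_pairs hSW fun c => c = false)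
      (fun w _ => detBy_neighbor X false S w) (g := g)
      (fun w hw => hg.trans (h.neighbor_ge false fun a ha => hblue a ha w hw)) hg1 ⌈y⌉₊
    refine (measureReal_mono ?_).trans (hcount.trans ?_)
    · intro ω hω
      have h1 := hω (nb ω)
      simp only [true_and, not_le] at h1
      refine lt_of_le_of_lt (Finset.card_le_card fun w hw => ?_) (Nat.lt_ceil.2 h1)
      simpa [nb] using hw
    · have h1 : (2 : ℝ) ^ ⌈y⌉₊ ≤ 2 * Real.exp y := by
        have h2 : (⌈y⌉₊ : ℝ) ≤ y + 1 := (Nat.ceil_lt_add_one hy0).le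
        calc (2 : ℝ) ^ ⌈y⌉₊ = (2 : ℝ) ^ (⌈y⌉₊ : ℝ) := (Real.rpow_natCast _ _).symm
          _ ≤ (2 : ℝ) ^ (y + 1) := Real.rpow_le_rpow_of_exponent_le (by norm_num) h2
          _ = 2 * (2 : ℝ) ^ y := by rw [Real.rpow_add (by norm_num), Real.rpow_one, mul_comm]
          _ ≤ 2 * Real.exp 1 ^ y := by
              have := Real.add_one_le_exp (1 : ℝ)
              gcongr
              linarith
          _ = 2 * Real.exp y := by rw [← Real.exp_mul, one_mul]
      have h2 := one_sub_pow_le_exp (p := g / 2) (by linarith) W.card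
      have h3 : Real.exp (-(g / 2 * W.card)) ≤ Real.exp (-(2 * y)) := by
        rw [Real.exp_le_exp]
        linarith
      calc _ ≤ (2 * Real.exp y) * Real.exp (-(2 * y)) :=
            mul_le_mul h1 (h2.trans h3) (pow_nonneg (by linarith) _) (by positivity)
        _ = 2 * Real.exp (-y) := by
            rw [mul_assoc, ← Real.exp_add]
            congr 2
            ring

end

/-! ### From a small cluster to all vertices -/

section

variable {Ω α : Type*} {X : Bool × Sym2 α → Ω → Prop} {lev : α → ℕ}

/-- The edges of colour `c` between vertices of level at most `t`. -/
def levelAdj (X : Bool × Sym2 α → Ω → Prop) (lev : α → ℕ) (ω : Ω) (t : ℕ) (c : Bool) (a b : α) :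
    Prop :=
  lev a ≤ t ∧ lev b ≤ t ∧ X (c, s(a, b)) ω

/-- The final clusters of the jigsaw process on the vertices of level at most `t`. -/
def levelCluster (X : Bool × Sym2 α → Ω → Prop) (lev : α → ℕ) (ω : Ω) (t : ℕ) : Setoid α :=
  jigsawClosure (levelAdj X lev ω t true) (levelAdj X lev ω t false)

/-- All vertices of `S` are in one cluster. -/
def Linked (X : Bool × Sym2 α → Ω → Prop) (lev : α → ℕ) (ω : Ω) (t : ℕ) (S : Finset α) : Prop :=
  ∀ x ∈ S, ∀ y ∈ S, levelCluster X lev ω t x y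

theorem levelCluster_join {ω : Ω} {t : ℕ} {x x' y : α} (hxx : levelCluster X lev ω t x x')
    (hx : lev x ≤ t) (hx' : lev x' ≤ t) (hy : lev y ≤ t) (hr : X (true, s(x, y)) ω)
    (hb : X (false, s(x', y)) ω) : levelCluster X lev ω t x y :=
  jigsawClosed_jigsawClosure _ _ hxx (Setoid.refl' _ y) ⟨hx, hy, hr⟩ ⟨hx', hy, hb⟩

theorem Linked.mono {ω : Ω} {t t' : ℕ} (htt : t ≤ t') {S : Finset α} (h : Linked X lev ω t S) :
    Linked X lev ω t' S := by
  intro x hx y hy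
  have hxy := h x hx y hy
  rw [levelCluster, jigsawClosure_iff] at hxy ⊢
  intro Q hQ
  exact hxy Q (hQ.mono (fun _ _ hab => ⟨hab.1.trans htt, hab.2.1.trans htt, hab.2.2⟩)
    (fun _ _ hab => ⟨hab.1.trans htt, hab.2.1.trans htt, hab.2.2⟩))

theorem linked_congr {ω ω' : Ω} {t : ℕ} {S : Finset α}
    (h : ∀ c a b, lev a ≤ t → lev b ≤ t → (X (c, s(a, b)) ω ↔ X (c, s(a, b)) ω')) :
    Linked X lev ω t S ↔ Linked X lev ω' t S := by
  have : levelAdj X lev ω t = levelAdj X lev ω' t := by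
    funext c a b
    exact propext (and_congr_right fun ha => and_congr_right fun hb => h c a b ha hb)
  rw [Linked, Linked, levelCluster, levelCluster, this]

theorem Linked.cluster_of_joinsTo {ω : Ω} {t : ℕ} {S : Finset α} (h : Linked X lev ω t S)
    (hS : ∀ a ∈ S, lev a ≤ t) {w : α} (hw : lev w ≤ t) (hjoin : JoinsTo X ω S w) :
    ∀ x ∈ S, levelCluster X lev ω t x w := by
  intro x hx
  obtain ⟨r, hr, hrw⟩ := hjoin true
  obtain ⟨b, hb, hbw⟩ := hjoin false
  exact Setoid.trans' _ (h x hx r hr) (levelCluster_join (h r hr b hb) (hS r hr) (hS b hb) hw hrw hbw)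

theorem Grows.exists_linked [DecidableEq α] {ω : Ω} {U : Finset α} {l t : ℕ} {S : Finset α}
    (h : Grows X lev ω U t S.card S) (ht : t + S.card = l + 1) (hS : ∀ a ∈ S, lev a < S.card)
    (hlink : Linked X lev ω l S) :
    ∃ T : Finset α, T.card = l + 1 ∧ (∀ a ∈ T, lev a ≤ l) ∧ Linked X lev ω l T := by
  induction t generalizing S with
  | zero => exact ⟨S, by omega, fun a ha => by have := hS a ha; omega, hlink⟩
  | succ t ih =>
    obtain ⟨w, hw, -, hjoin, hgrow⟩ := h
    have hwS : w ∉ S := fun hwS => by have := hS w hwS; omega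
    have hcard : (insert w S).card = S.card + 1 := Finset.card_insert_of_notMem hwS
    have hcl := hlink.cluster_of_joinsTo (fun a ha => by have := hS a ha; omega) (by omega) hjoin
    refine ih (S := insert w S) (hcard ▸ hgrow) (by omega) ?_ ?_
    · intro a ha
      rw [hcard]
      rcases Finset.mem_insert.1 ha with rfl | ha
      · omega
      · have := hS a ha; omega
    · intro x hx y hy
      rcases Finset.mem_insert.1 hx with hxw | hxS <;>
        rcases Finset.mem_insert.1 hy with hyw | hyS
      · rw [hxw, hyw]
      · rw [hxw]
        exact Setoid.symm' _ (hcl y hyS)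
      · rw [hyw]
        exact hcl x hxS
      · exact hlink x hxS y hyS

theorem Expands.linked {ω : Ω} {t : ℕ} {S Z : Finset α} (h : Expands X ω S Z)
    (hS : ∀ a ∈ S, lev a ≤ t) (hZ : ∀ a ∈ Z, lev a ≤ t) (hlink : Linked X lev ω t S) :
    Linked X lev ω t Z := by
  classical
  obtain ⟨hblue, hconn, x, hx, z, hz, hxz⟩ := h
  have hstep : ∀ a, levelCluster X lev ω t x a → lev a ≤ t → ∀ b ∈ Z, X (true, s(a, b)) ω →
      levelCluster X lev ω t x b := by
    intro a hxa ha b hb hab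
    obtain ⟨x', hx', hxb⟩ := hblue b hb
    have hax : levelCluster X lev ω t a x' := Setoid.trans' _ (Setoid.symm' _ hxa) (hlink x hx x' hx')
    exact Setoid.trans' _ hxa (levelCluster_join hax ha (hS x' hx') (hZ b hb) hab hxb)
  let A := Z.filter fun z => levelCluster X lev ω t x z
  have hAZ : A = Z := by
    by_contra hne
    obtain ⟨a, ha, b, hb, hbA, hab⟩ := hconn A (Finset.filter_subset _ _)
      ⟨z, Finset.mem_filter.2 ⟨hz, hstep x (Setoid.refl' _ x) (hS x hx) z hz hxz⟩⟩ hne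
    obtain ⟨haZ, hxa⟩ := Finset.mem_filter.1 ha
    exact hbA (Finset.mem_filter.2 ⟨hb, hstep a hxa (hZ a haZ) b hb hab⟩)
  have hall : ∀ z ∈ Z, levelCluster X lev ω t x z := fun z hz => by
    rw [← hAZ] at hz
    exact (Finset.mem_filter.1 hz).2
  exact fun a ha b hb => Setoid.trans' _ (Setoid.symm' _ (hall a ha)) (hall b hb)

theorem expands_congr {ω ω' : Ω} {S Z : Finset α}
    (h : ∀ c a b, a ∈ S ∨ a ∈ Z → b ∈ Z → (X (c, s(a, b)) ω ↔ X (c, s(a, b)) ω')) :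
    Expands X ω S Z ↔ Expands X ω' S Z := by
  refine and_congr ?_ (and_congr (cutConnected_congr fun a ha b hb => h _ a b (Or.inr ha) hb) ?_)
  · exact forall₂_congr fun z hz => exists_congr fun x => and_congr_right fun hx =>
      h _ x z (Or.inl hx) hz
  · exact exists_congr fun x => and_congr_right fun hx => exists_congr fun z =>
      and_congr_right fun hz => h _ x z (Or.inl hx) hz

variable [Fintype α] [DecidableEq α] [MeasurableSpace Ω] {μ : Measure Ω} [IsProbabilityMeasure μ]
  [DiscreteMeasurableSpace Ω]

/-- Two given vertices `u`, `v` are in the same cluster of the jigsaw process on two random graphs,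
up to a small probability: a vertex grows into a small cluster, which expands twice, and `u` and
`v` are joined to the result. The vertices are divided into levels, so that each stage uses fresh
pairs. -/
theorem CoordIndep.not_cluster_le (h : CoordIndep X μ) {l N : ℕ} {q : ℕ → ℝ}
    (hq0 : ∀ i, 0 ≤ q i) (hq1 : ∀ i, q i ≤ 1)
    (hq : ∀ S U : Finset α, 1 ≤ S.card → S.card ≤ l → (∀ a ∈ S, lev a < S.card) → U.card ≤ N →
      μ.real {ω | ∀ w, lev w = S.card → w ∉ U → ¬ JoinsTo X ω S w} ≤ 1 - q S.card)
    (M : Finset α) (hM : ∀ r ∈ M, lev r = 0) (hN : M.card * (l + 1) ≤ N)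
    {p : Bool → ℝ} (hp0 : ∀ c, 0 ≤ p c) (hp1 : ∀ c, p c ≤ 1) (hple : p true ≤ p false)
    (hp : ∀ c a b, a ≠ b → lev a ≤ l + 3 → lev b ≤ l + 3 → p c ≤ μ.real {ω | X (c, s(a, b)) ω})
    {w : ℝ} (hw0 : 0 ≤ w)
    (hw1 : w ≤ ((Finset.univ.filter fun a => lev a = l + 1).card : ℝ))
    (hw2 : w ≤ ((Finset.univ.filter fun a => lev a = l + 2).card : ℝ))
    {g y : ℝ} (hg0 : 0 ≤ g) (hg : g ≤ 1 - (1 - p false) ^ (l + 1)) (hy0 : 0 ≤ y)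
    (hy : y ≤ w * g / 4) (hpy : 11 ≤ p true * y) (hpw : 11 ≤ p true * (w / 8))
    {u v : α} (hu : lev u = l + 3) (hv : lev v = l + 3) :
    μ.real {ω | ¬ levelCluster X lev ω (l + 3) u v} ≤
      (1 - ∏ i ∈ Finset.range l, q (1 + i)) ^ M.card +
      ((3 * Real.exp (-y) + Real.exp (-(p true * (l + 1) * (3 / 4 * y)))) +
      (3 * Real.exp (-(w / 8)) + 5 * Real.exp (-(p true * (3 / 4 * (w / 8)))))) := by
  classical
  set W₁ := Finset.univ.filter fun a => lev a = l + 1 with hW₁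
  set W₂ := Finset.univ.filter fun a => lev a = l + 2 with hW₂
  have hlev₁ : ∀ a ∈ W₁, lev a = l + 1 := fun a ha => (Finset.mem_filter.1 ha).2
  have hlev₂ : ∀ a ∈ W₂, lev a = l + 2 := fun a ha => (Finset.mem_filter.1 ha).2
  let below : ℕ → Set (Bool × Sym2 α) := fun t => {i | ∃ a b, lev a ≤ t ∧ lev b ≤ t ∧ i.2 = s(a, b)}
  let above : ℕ → Set (Bool × Sym2 α) := fun t => {i | ∃ a b, t ≤ lev b ∧ i.2 = s(a, b)}
  have hdisj : ∀ t, Disjoint (below t) (above (t + 1)) := by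
    intro t
    rw [Set.disjoint_left]
    rintro i ⟨a, b, ha, hb, h1⟩ ⟨a', b', hb', h2⟩
    rw [h1, Sym2.eq_iff] at h2
    rcases h2 with ⟨-, rfl⟩ | ⟨rfl, -⟩ <;> omega
  let E₃ : Finset α → Set Ω := fun Z => {ω | ¬ (JoinsTo X ω Z u ∧ JoinsTo X ω Z v)}
  let E₂ : Finset α → Set Ω := fun Z => {ω | ∀ Z', (Z' ⊆ W₂ ∧ 3 / 4 * (w / 8) ≤ (Z'.card : ℝ) ∧
    Expands X ω Z Z') → ω ∈ E₃ Z'}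
  let E₁ : Finset α → Set Ω := fun S => {ω | ∀ Z, (Z ⊆ W₁ ∧ 3 / 4 * y ≤ (Z.card : ℝ) ∧
    Expands X ω S Z) → ω ∈ E₂ Z}
  have hdet₃ : ∀ Z, DetBy X (above (l + 2 + 1)) (E₃ Z) := by
    intro Z ω ω' hω
    refine not_congr (and_congr ?_ ?_)
    · exact forall_congr' fun c => exists_congr fun a => and_congr_right fun _ =>
        hω _ ⟨a, u, by omega, rfl⟩
    · exact forall_congr' fun c => exists_congr fun a => and_congr_right fun _ =>
        hω _ ⟨a, v, by omega, rfl⟩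
  have hdet₂ : ∀ Z, DetBy X (above (l + 1 + 1)) (E₂ Z) := by
    intro Z ω ω' hω
    refine forall_congr' fun Z' => ?_
    by_cases hZ' : Z' ⊆ W₂
    · refine imp_congr (and_congr_right fun _ => and_congr_right fun _ => expands_congr ?_) ?_
      · intro c a b _ hb
        exact hω _ ⟨a, b, (hlev₂ b (hZ' hb)).ge, rfl⟩
      · refine hdet₃ Z' ω ω' fun i hi => hω i ?_
        obtain ⟨a, b, hb, hab⟩ := hi
        exact ⟨a, b, by omega, hab⟩
    · simp [hZ']
  have hdet₁ : ∀ S, DetBy X (above (l + 1)) (E₁ S) := by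
    intro S ω ω' hω
    refine forall_congr' fun Z => ?_
    by_cases hZ : Z ⊆ W₁
    · refine imp_congr (and_congr_right fun _ => and_congr_right fun _ => expands_congr ?_) ?_
      · intro c a b _ hb
        exact hω _ ⟨a, b, (hlev₁ b (hZ hb)).ge, rfl⟩
      · refine hdet₂ Z ω ω' fun i hi => hω i ?_
        obtain ⟨a, b, hb, hab⟩ := hi
        exact ⟨a, b, by omega, hab⟩
    · simp [hZ]
  have hy1 : 0 < y := by
    rcases hy0.eq_or_lt with h0 | h0
    · rw [← h0] at hpy; linarith
    · exact h0
  -- the last stage: `u` and `v` have neighbours of both colours in a large cluster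
  have hE₃ : ∀ Z, Z ⊆ W₂ → 3 / 4 * (w / 8) ≤ (Z.card : ℝ) →
      μ.real (E₃ Z) ≤ 4 * Real.exp (-(p true * (3 / 4 * (w / 8)))) := by
    intro Z hZ hZc
    have hone : ∀ x, lev x = l + 3 → ∀ c, μ.real {ω | ∀ a ∈ Z, ¬ X (c, s(a, x)) ω} ≤
        Real.exp (-(p true * (3 / 4 * (w / 8)))) := by
      intro x hx c
      refine (h.no_neighbor_le c (p := p true) fun a ha => ?_).trans
        ((one_sub_pow_le_exp (hp1 true) _).trans ?_)
      · have h1 := hlev₂ a (hZ ha)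
        have h2 := hp c a x (by rintro rfl; omega) (by omega) (by omega)
        cases c with
        | true => exact h2
        | false => exact hple.trans h2
      · rw [Real.exp_le_exp, neg_le_neg_iff]
        have := hp0 true
        gcongr
    have hsub : E₃ Z ⊆ ({ω | ∀ a ∈ Z, ¬ X (true, s(a, u)) ω} ∪ {ω | ∀ a ∈ Z, ¬ X (false, s(a, u)) ω})
        ∪ ({ω | ∀ a ∈ Z, ¬ X (true, s(a, v)) ω} ∪ {ω | ∀ a ∈ Z, ¬ X (false, s(a, v)) ω}) := by
      intro ω hω
      by_contra hcon
      simp only [Set.mem_union, Set.mem_ofPred_eq, not_or] at hcon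
      push Not at hcon
      obtain ⟨⟨h1, h2⟩, h3, h4⟩ := hcon
      exact hω ⟨fun c => by cases c <;> assumption, fun c => by cases c <;> assumption⟩
    refine (measureReal_mono hsub).trans ((measureReal_union_le _ _).trans ?_)
    have h1 := measureReal_union_le (μ := μ) {ω | ∀ a ∈ Z, ¬ X (true, s(a, u)) ω}
      {ω | ∀ a ∈ Z, ¬ X (false, s(a, u)) ω}
    have h2 := measureReal_union_le (μ := μ) {ω | ∀ a ∈ Z, ¬ X (true, s(a, v)) ω}
      {ω | ∀ a ∈ Z, ¬ X (false, s(a, v)) ω}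
    linarith [hone u hu true, hone u hu false, hone v hv true, hone v hv false]
  have hg1 : g ≤ 1 := hg.trans (by
    have := pow_nonneg (by linarith [hp1 false] : 0 ≤ 1 - p false) (l + 1)
    linarith)
  have hE₂ : ∀ Z, Z ⊆ W₁ → 3 / 4 * y ≤ (Z.card : ℝ) →
      μ.real (E₂ Z) ≤ (3 * Real.exp (-(w / 8)) + Real.exp (-(p true * (3 / 4 * (w / 8))))) +
        4 * Real.exp (-(p true * (3 / 4 * (w / 8)))) := by
    intro Z hZ hZc
    have hZ1 : (1 : ℝ) ≤ Z.card := by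
      have : (0 : ℝ) < Z.card := by linarith
      exact_mod_cast this
    refine h.le_add_of_exists (hdisj (l + 2)) ?_ (fun Z' _ => hdet₃ Z') (by positivity) ?_ ?_
    · intro Z' ω ω' hω
      refine and_congr_right fun hZ' => and_congr_right fun _ => expands_congr ?_
      intro c a b ha hb
      have hb' := hlev₂ b (hZ' hb)
      refine hω _ ⟨a, b, ?_, by omega, rfl⟩
      rcases ha with ha | ha
      · have := hlev₁ a (hZ ha); omega
      · have := hlev₂ a (hZ' ha); omega
    · rintro Z' ⟨-, hZ', hZc', -⟩
      exact hE₃ Z' hZ' hZc'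
    · have hdis : Disjoint Z W₂ := by
        rw [Finset.disjoint_left]
        intro a ha ha'
        have h1 := hlev₁ a (hZ ha)
        have h2 := hlev₂ a ha'
        omega
      refine (h.not_expands_le hdis (p₁ := p true) (p₂ := p false) (g := 1 / 2) (hp0 _) (hp1 _)
        ?_ ?_ (by norm_num) ?_ (by positivity) ?_ hpw).trans ?_
      · intro a ha b hb hab
        refine hp true a b hab ?_ (by have := hlev₂ b hb; omega)
        rcases Finset.mem_union.1 ha with ha | ha
        · have := hlev₁ a (hZ ha); omega
        · have := hlev₂ a ha; omega
      · intro a ha b hb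
        have h1 := hlev₁ a (hZ ha)
        have h2 := hlev₂ b hb
        exact hp false a b (by rintro rfl; omega) (by omega) (by omega)
      · -- the cluster is so large that a fresh vertex has a blue neighbour in it
        have h1 := one_sub_pow_le_exp (hp1 false) Z.card
        have h2 : Real.exp (-(p false * Z.card)) ≤ Real.exp (-1) := by
          rw [Real.exp_le_exp, neg_le_neg_iff]
          have h3 : p true * y ≤ p false * y := by gcongr
          have h4 : p false * (3 / 4 * y) ≤ p false * Z.card :=
            mul_le_mul_of_nonneg_left hZc (hp0 false)
          linarith
        have h3 : Real.exp (-1) ≤ 1 / 2 := by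
          rw [Real.exp_neg, one_div]
          refine inv_anti₀ (by norm_num) ?_
          have := Real.add_one_le_exp (1 : ℝ)
          linarith
        linarith
      · linarith
      · gcongr
        have h1 : p true * 1 ≤ p true * Z.card := mul_le_mul_of_nonneg_left hZ1 (hp0 true)
        have h2 : 0 ≤ 3 / 4 * (w / 8) := by positivity
        nlinarith
  have hE₁ : ∀ S : Finset α, S.card = l + 1 → (∀ a ∈ S, lev a ≤ l) →
      μ.real (E₁ S) ≤ (3 * Real.exp (-y) + Real.exp (-(p true * (l + 1) * (3 / 4 * y)))) +
        ((3 * Real.exp (-(w / 8)) + Real.exp (-(p true * (3 / 4 * (w / 8))))) +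
        4 * Real.exp (-(p true * (3 / 4 * (w / 8))))) := by
    intro S hSc hS
    refine h.le_add_of_exists (hdisj (l + 1)) ?_ (fun Z _ => hdet₂ Z) (by positivity) ?_ ?_
    · intro Z ω ω' hω
      refine and_congr_right fun hZ => and_congr_right fun _ => expands_congr ?_
      intro c a b ha hb
      have hb' := hlev₁ b (hZ hb)
      refine hω _ ⟨a, b, ?_, by omega, rfl⟩
      rcases ha with ha | ha
      · have := hS a ha; omega
      · have := hlev₁ a (hZ ha); omega
    · rintro Z ⟨-, hZ, hZc, -⟩
      exact hE₂ Z hZ hZc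
    · have hdis : Disjoint S W₁ := by
        rw [Finset.disjoint_left]
        intro a ha ha'
        have h1 := hS a ha
        have h2 := hlev₁ a ha'
        omega
      have := h.not_expands_le hdis (p₁ := p true) (p₂ := p false) (g := g) (y := y) (hp0 _) (hp1 _)
        (fun a ha b hb hab => hp true a b hab (by
          rcases Finset.mem_union.1 ha with ha | ha
          · have := hS a ha; omega
          · have := hlev₁ a ha; omega) (by have := hlev₁ b hb; omega))
        (fun a ha b hb => by
          have h1 := hS a ha
          have h2 := hlev₁ b hb
          exact hp false a b (by rintro rfl; omega) (by omega) (by omega))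
        hg1 (by rw [hSc]; exact hg) hy0 (hy.trans (by gcongr)) hpy
      rw [hSc, Nat.cast_add, Nat.cast_one] at this
      exact this
  have hmain := h.le_add_of_exists (hdisj l) (P := fun (S : Finset α) ω => S.card = l + 1 ∧
      (∀ a ∈ S, lev a ≤ l) ∧ Linked X lev ω l S) (F := E₁)
    (δ := (1 - ∏ i ∈ Finset.range l, q (1 + i)) ^ M.card) ?_ (fun S _ => hdet₁ S) ?_
    (fun S ⟨_, h1, h2, _⟩ => hE₁ S h1 h2) ?_
  · refine (measureReal_mono ?_).trans (hmain.trans_eq (by ring))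
    intro ω hω S hS Z hZ Z' hZ' hjoin
    obtain ⟨hSc, hSlev, hSlink⟩ := hS
    obtain ⟨hZW, -, hZexp⟩ := hZ
    obtain ⟨hZW', hZc', hZexp'⟩ := hZ'
    have hZlev : ∀ a ∈ Z, lev a ≤ l + 3 := fun a ha => by have := hlev₁ a (hZW ha); omega
    have hZlev' : ∀ a ∈ Z', lev a ≤ l + 3 := fun a ha => by have := hlev₂ a (hZW' ha); omega
    have hSlev' : ∀ a ∈ S, lev a ≤ l + 3 := fun a ha => by have := hSlev a ha; omega
    have hlink := hZexp'.linked hZlev hZlev' (hZexp.linked hSlev' hZlev (hSlink.mono (by omega)))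
    obtain ⟨z, hz, -⟩ := hjoin.1 true
    have h1 := hlink.cluster_of_joinsTo hZlev' hu.le hjoin.1 z hz
    have h2 := hlink.cluster_of_joinsTo hZlev' hv.le hjoin.2 z hz
    exact hω (Setoid.trans' _ (Setoid.symm' _ h1) h2)
  · intro S ω ω' hω
    refine and_congr_right fun _ => and_congr_right fun _ => linked_congr ?_
    intro c a b ha hb
    exact hω _ ⟨a, b, ha, hb, rfl⟩
  · positivity
  · refine (measureReal_mono ?_).trans
      (h.noSeed_le hq0 hq1 hq M ∅ hM (by rw [Finset.card_empty, zero_add]; exact hN))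
    intro ω hω r hr hgrow
    have hgrow' : Grows X lev ω ∅ l ({r} : Finset α).card {r} := by
      rwa [Finset.card_singleton]
    obtain ⟨S, hS⟩ := hgrow'.exists_linked (l := l) (by simp) (by simp [hM r hr]) (by
      intro x hx y hy
      rw [Finset.mem_singleton] at hx hy
      rw [hx, hy])
    exact hω S hS

end

/-! ### Links of `(j - 1)`-sets -/

/-- A finite set can be divided into levels of prescribed sizes; the other elements get level
`T`. -/
theorem exists_levels {α : Type*} [Fintype α] [DecidableEq α] (F : Finset α) (sz : ℕ → ℕ) (T : ℕ)
    (hT : ∑ i ∈ Finset.range T, sz i ≤ F.card) :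
    ∃ lev : α → ℕ, (∀ i < T, (Finset.univ.filter fun a => lev a = i).card = sz i) ∧
      (∀ a ∉ F, lev a = T) ∧ ∀ a, lev a ≤ T := by
  induction T with
  | zero => exact ⟨fun _ => 0, by simp, by simp, by simp⟩
  | succ T ih =>
    rw [Finset.sum_range_succ] at hT
    obtain ⟨lev, h1, h2, h3⟩ := ih (by omega)
    have hcover : F ⊆ (F.filter fun a => lev a = T) ∪
        (Finset.range T).biUnion fun i => Finset.univ.filter fun a => lev a = i := by
      intro a ha
      rcases (h3 a).lt_or_eq with h | h
      · exact Finset.mem_union_right _ (Finset.mem_biUnion.2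
          ⟨lev a, Finset.mem_range.2 h, by simp⟩)
      · exact Finset.mem_union_left _ (Finset.mem_filter.2 ⟨ha, h⟩)
    have hcard : sz T ≤ (F.filter fun a => lev a = T).card := by
      have e1 := (Finset.card_le_card hcover).trans (Finset.card_union_le _ _)
      have e2 : ((Finset.range T).biUnion fun i => Finset.univ.filter fun a => lev a = i).card ≤
          ∑ i ∈ Finset.range T, sz i :=
        Finset.card_biUnion_le.trans
          (Finset.sum_le_sum fun i hi => (h1 i (Finset.mem_range.1 hi)).le)
      omega
    obtain ⟨D, hD, hDc⟩ := Finset.exists_subset_card_eq hcard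
    have hDlev : ∀ a ∈ D, a ∈ F ∧ lev a = T := fun a ha => Finset.mem_filter.1 (hD ha)
    refine ⟨fun a => if lev a = T then (if a ∈ D then T else T + 1) else lev a, ?_, ?_, ?_⟩
    · intro i hi
      rcases (Nat.lt_succ_iff.1 hi).lt_or_eq with h | h
      · rw [← h1 i h]
        congr 1
        refine Finset.filter_congr fun a _ => ?_
        beta_reduce
        split_ifs <;> omega
      · subst h
        rw [← hDc]
        congr 1
        ext a
        simp only [Finset.mem_filter, Finset.mem_univ, true_and]
        split_ifs with e1 e2
        · simp [e2]
        · simp [e2]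
        · exact ⟨fun h => absurd h e1, fun h => absurd (hDlev a h).2 e1⟩
    · intro a ha
      simp only
      rw [if_pos (h2 a ha), if_neg fun h => ha (hDlev a h).1]
    · intro a
      have := h3 a
      simp only
      split_ifs <;> omega

/-- The edges of colour `c` that contain `L` and whose vertices outside `L ∪ B` are those of the
pair `z`. They are disjoint for different pairs, so that they turn the link of `L` into two
independent binomial random graphs. -/
def linkBundle {n k : ℕ} (L B : Finset (Fin n)) (i : Bool × Sym2 (Fin n)) :
    Set (Bool × KSet (Fin n) k) :=
  {x | x.1 = i.1 ∧ L ⊆ x.2.1 ∧ ∀ v, v ∈ x.2.1 \ (L ∪ B) ↔ v ∈ i.2}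

/-- The pair `z` has colour `c` in the link graph. -/
def linkCoord (k : ℕ) {n : ℕ} (L B : Finset (Fin n)) (i : Bool × Sym2 (Fin n))
    (H : DoubleKGraph (Fin n) k) : Prop :=
  ∃ x ∈ linkBundle (k := k) L B i, edgeCoord x H

theorem linkCoord_coordIndep {k n : ℕ} (p₁ p₂ : I) (L B : Finset (Fin n)) :
    CoordIndep (linkCoord k L B) (binomialDoubleKGraph k n p₁ p₂) := by
  refine (binomialDoubleKGraph_coordIndep p₁ p₂).bundle (linkBundle L B) ?_
  rintro ⟨c, z⟩ ⟨c', z'⟩ hne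
  rw [Function.onFun, Set.disjoint_left]
  rintro x ⟨h1, -, h2⟩ ⟨h3, -, h4⟩
  refine hne (Prod.ext (h1.symm.trans h3) (Sym2.ext fun v => ?_))
  exact (h2 v).symm.trans (h4 v)

theorem linkCoord_prob_ge {j k n : ℕ} (hj : 1 ≤ j) (hjk : j < k) (p₁ p₂ : I) {L B : Finset (Fin n)}
    (hL : L.card = j - 1) (hLB : Disjoint L B) (c : Bool) {a b : Fin n} (hab : a ≠ b)
    (ha : a ∉ L ∪ B) (hb : b ∉ L ∪ B) :
    1 - (1 - ((cond c p₁ p₂ : I) : ℝ)) ^ (B.card.choose (k - j - 1)) ≤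
      (binomialDoubleKGraph k n p₁ p₂).real {H | linkCoord k L B (c, s(a, b)) H} := by
  classical
  set μ := binomialDoubleKGraph k n p₁ p₂
  have hab' : Disjoint (L ∪ B) {a, b} := by
    simp only [Finset.disjoint_insert_right, Finset.disjoint_singleton_right]
    exact ⟨ha, hb⟩
  have hcard : ∀ T ∈ B.powersetCard (k - j - 1), ((L ∪ {a, b}) ∪ T).card = k := by
    intro T hT
    obtain ⟨hTB, hTc⟩ := Finset.mem_powersetCard.1 hT
    have h1 : Disjoint (L ∪ {a, b}) T := by
      rw [Finset.disjoint_union_left]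
      exact ⟨hLB.mono_right hTB, (hab'.mono_left
        (hTB.trans Finset.subset_union_right)).symm⟩
    have h2 : Disjoint L {a, b} := hab'.mono_left Finset.subset_union_left
    rw [Finset.card_union_of_disjoint h1, Finset.card_union_of_disjoint h2, hL, hTc,
      Finset.card_pair hab]
    omega
  let f : {T // T ∈ B.powersetCard (k - j - 1)} → Bool × KSet (Fin n) k :=
    fun T => (c, ⟨(L ∪ {a, b}) ∪ T.1, hcard T.1 T.2⟩)
  have hdisj : ∀ T ∈ B.powersetCard (k - j - 1), ((L ∪ {a, b}) ∪ T) ∩ B = T := by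
    intro T hT
    obtain ⟨hTB, -⟩ := Finset.mem_powersetCard.1 hT
    ext v
    simp only [Finset.mem_inter, Finset.mem_union, Finset.mem_insert, Finset.mem_singleton]
    simp only [Finset.mem_union, not_or] at ha hb
    constructor
    · rintro ⟨(h1 | rfl | rfl) | h1, h2⟩
      · exact absurd h2 (Finset.disjoint_left.1 hLB h1)
      · exact absurd h2 ha.2
      · exact absurd h2 hb.2
      · exact h1
    · exact fun h => ⟨Or.inr h, hTB h⟩
  have hinj : Function.Injective f := by
    intro T T' h
    have h1 : (L ∪ {a, b}) ∪ T.1 = (L ∪ {a, b}) ∪ T'.1 :=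
      congrArg (fun x : Bool × KSet (Fin n) k => x.2.1) h
    exact Subtype.ext (by rw [← hdisj T.1 T.2, h1, hdisj T'.1 T'.2])
  have hmem : ∀ T, f T ∈ linkBundle (k := k) L B (c, s(a, b)) := by
    rintro ⟨T, hT⟩
    obtain ⟨hTB, -⟩ := Finset.mem_powersetCard.1 hT
    refine ⟨rfl, Finset.subset_union_left.trans Finset.subset_union_left, fun v => ?_⟩
    simp only [f, Finset.mem_sdiff, Finset.mem_union, Finset.mem_insert, Finset.mem_singleton,
      Sym2.mem_iff, not_or]
    simp only [Finset.mem_union, not_or] at ha hb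
    constructor
    · rintro ⟨(h1 | h1) | h1, h2, h3⟩
      · exact absurd h1 h2
      · exact h1
      · exact absurd (hTB h1) h3
    · rintro (rfl | rfl)
      · exact ⟨Or.inl (Or.inr (Or.inl rfl)), ha⟩
      · exact ⟨Or.inl (Or.inr (Or.inr rfl)), hb⟩
  have h1 := (binomialDoubleKGraph_coordIndep (k := k) (n := n) p₁ p₂).none_coord_le
    (Finset.univ.map ⟨f, hinj⟩) (p := ((cond c p₁ p₂ : I) : ℝ)) (by
      intro t ht
      obtain ⟨T, -, rfl⟩ := Finset.mem_map.1 ht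
      rw [binomialDoubleKGraph_real_coord]
      rfl)
  rw [Finset.card_map, Finset.card_univ, Fintype.card_coe, Finset.card_powersetCard] at h1
  have h2 : {H | linkCoord k L B (c, s(a, b)) H}ᶜ ⊆
      {H | ∀ t ∈ (Finset.univ.map ⟨f, hinj⟩ : Finset (Bool × KSet (Fin n) k)),
        ¬ edgeCoord t H} := by
    intro H hH t ht hcon
    obtain ⟨T, -, rfl⟩ := Finset.mem_map.1 ht
    exact hH ⟨_, hmem T, hcon⟩
  have h3 := (measureReal_mono (μ := μ) h2).trans h1
  rw [measureReal_compl'] at h3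
  linarith

/-- Vertices in one cluster of the link graph of `L` extend `L` to `j`-sets in one cluster. -/
theorem insert_rel_of_levelCluster {k j n : ℕ} {H : DoubleKGraph (Fin n) k} {L B : Finset (Fin n)}
    {lev : Fin n → ℕ} {t : ℕ} (hlev : ∀ a, lev a ≤ t → a ∉ L ∪ B) {Q : Setoid (KSet (Fin n) j)}
    (hQ : JigsawClosed (EdgeJoined H.1) (EdgeJoined H.2) Q) {u v : Fin n}
    (huv : levelCluster (linkCoord k L B) lev H t u v)
    {Ju Jv : KSet (Fin n) j} (hJu : Ju.1 = insert u L) (hJv : Jv.1 = insert v L)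
    (hu : u ∉ L) (hv : v ∉ L) : Q Ju Jv := by
  have hL : L.card + 1 = j := by
    have := Ju.2
    rwa [hJu, Finset.card_insert_of_notMem hu] at this
  let f : Fin n → KSet (Fin n) j := fun a =>
    if ha : a ∉ L then ⟨insert a L, by rw [Finset.card_insert_of_notMem ha, hL]⟩ else Ju
  have hf : ∀ a ∉ L, (f a).1 = insert a L := by
    intro a ha
    simp only [f]
    rw [dif_pos ha]
  have hjoin : ∀ c a b, levelAdj (linkCoord k L B) lev H t c a b →
      EdgeJoined (cond c H.1 H.2) (f a) (f b) := by
    rintro c a b ⟨ha, hb, ⟨c', e⟩, ⟨hc, hLe, he⟩, hedge⟩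
    simp only at hc hLe he
    subst hc
    have haL : a ∉ L := fun h => hlev a ha (Finset.mem_union_left _ h)
    have hbL : b ∉ L := fun h => hlev b hb (Finset.mem_union_left _ h)
    have hae := (Finset.mem_sdiff.1 ((he a).2 (Sym2.mem_mk_left a b))).1
    have hbe := (Finset.mem_sdiff.1 ((he b).2 (Sym2.mem_mk_right a b))).1
    refine ⟨e, hedge, ?_, ?_⟩
    · rw [hf a haL]
      exact Finset.insert_subset hae hLe
    · rw [hf b hbL]
      exact Finset.insert_subset hbe hLe
  have hclosed : JigsawClosed (levelAdj (linkCoord k L B) lev H t true)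
      (levelAdj (linkCoord k L B) lev H t false) (Setoid.comap f Q) := by
    intro x x' y y' h1 h2 h3 h4
    exact hQ h1 h2 (hjoin true _ _ h3) (hjoin false _ _ h4)
  have huv' : Q (f u) (f v) := jigsawClosure_iff.1 huv _ hclosed
  rwa [show f u = Ju from Subtype.ext ((hf u hu).trans hJu.symm),
    show f v = Jv from Subtype.ext ((hf v hv).trans hJv.symm)] at huv'

/-- An equivalence relation on `j`-sets that is invariant under exchanging one element is
trivial. -/
theorem eq_top_of_exchange {V : Type*} [DecidableEq V] {j : ℕ} {Q : Setoid (KSet V j)}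
    (h : ∀ (L : Finset V) (u v : V) (Ju Jv : KSet V j), u ∉ L → v ∉ L → u ≠ v →
      Ju.1 = insert u L → Jv.1 = insert v L → Q Ju Jv) : Q = ⊤ := by
  have key : ∀ d, ∀ J J' : KSet V j, (J.1 \ J'.1).card = d → Q J J' := by
    intro d
    induction d with
    | zero =>
      intro J J' hd
      rw [Finset.card_eq_zero, Finset.sdiff_eq_empty_iff_subset] at hd
      have : J = J' := Subtype.ext (Finset.eq_of_subset_of_card_le hd (by rw [J.2, J'.2]))
      rw [this]
    | succ d ih =>
      intro J J' hd
      obtain ⟨u, hu⟩ := Finset.card_pos.1 (by omega : 0 < (J.1 \ J'.1).card)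
      have hd' : (J'.1 \ J.1).card = (J.1 \ J'.1).card :=
        Finset.card_sdiff_comm (by rw [J.2, J'.2])
      obtain ⟨v, hv⟩ := Finset.card_pos.1 (by omega : 0 < (J'.1 \ J.1).card)
      rw [Finset.mem_sdiff] at hu hv
      have huv : u ≠ v := by rintro rfl; exact hu.2 hv.1
      have hvL : v ∉ J.1.erase u := fun h => hv.2 (Finset.mem_of_mem_erase h)
      have hcard : (insert v (J.1.erase u)).card = j := by
        rw [Finset.card_insert_of_notMem hvL, Finset.card_erase_add_one hu.1, J.2]
      refine Q.trans (h (J.1.erase u) u v J ⟨insert v (J.1.erase u), hcard⟩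
        (Finset.notMem_erase _ _) hvL huv (Finset.insert_erase hu.1).symm rfl) (ih _ _ ?_)
      have : insert v (J.1.erase u) \ J'.1 = (J.1 \ J'.1).erase u := by
        ext x
        simp only [Finset.mem_sdiff, Finset.mem_insert, Finset.mem_erase]
        constructor
        · rintro ⟨rfl | ⟨h1, h2⟩, h3⟩
          · exact absurd hv.1 h3
          · exact ⟨h1, h2, h3⟩
        · rintro ⟨h1, h2, h3⟩
          exact ⟨Or.inr ⟨h1, h2⟩, h3⟩
      rw [this, Finset.card_erase_of_mem (Finset.mem_sdiff.2 hu), hd]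
      rfl
  rw [eq_top_iff]
  intro J J' _
  exact key _ J J' rfl

/-- If in every link the probability that two given vertices are in different clusters is at most
`δ`, then percolation fails with probability at most `n ^ (j + 1) * δ`. -/
theorem real_not_percolates_le {k j n : ℕ} (hj : 1 ≤ j) (hjn : j ≤ n) (p₁ p₂ : I) {δ : ℝ}
    (h : ∀ (L : Finset (Fin n)) (u v : Fin n), L.card = j - 1 → u ∉ L → v ∉ L → u ≠ v →
      ∃ (B : Finset (Fin n)) (lev : Fin n → ℕ) (t : ℕ), (∀ a, lev a ≤ t → a ∉ L ∪ B) ∧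
        (binomialDoubleKGraph k n p₁ p₂).real
          {H | ¬ levelCluster (linkCoord k L B) lev H t u v} ≤ δ) (hδ : 0 ≤ δ) :
    (binomialDoubleKGraph k n p₁ p₂).real {H | ¬ H.Percolates j} ≤ (n : ℝ) ^ (j + 1) * δ := by
  classical
  let bad : Finset (Fin n) × Fin n × Fin n → Set (DoubleKGraph (Fin n) k) := fun x =>
    {H | ∃ Q : Setoid (KSet (Fin n) j), JigsawClosed (EdgeJoined H.1) (EdgeJoined H.2) Q ∧
      x.2.1 ∉ x.1 ∧ x.2.2 ∉ x.1 ∧ x.2.1 ≠ x.2.2 ∧ ∃ Ju Jv : KSet (Fin n) j,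
        Ju.1 = insert x.2.1 x.1 ∧ Jv.1 = insert x.2.2 x.1 ∧ ¬ Q Ju Jv}
  let idx : Finset (Finset (Fin n) × Fin n × Fin n) :=
    Finset.univ.powersetCard (j - 1) ×ˢ (Finset.univ ×ˢ Finset.univ)
  have hne : Nonempty (KSet (Fin n) j) := by
    obtain ⟨s, -, hs⟩ := Finset.exists_subset_card_eq (s := (Finset.univ : Finset (Fin n)))
      (n := j) (by simpa using hjn)
    exact ⟨⟨s, hs⟩⟩
  have hsub : {H : DoubleKGraph (Fin n) k | ¬ H.Percolates j} ⊆ ⋃ x ∈ idx, bad x := by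
    intro H hH
    by_contra hcon
    simp only [Set.mem_iUnion, not_exists] at hcon
    refine hH ((H.percolates_iff).2 fun Q hQ => eq_top_of_exchange ?_)
    intro L u v Ju Jv hu hv huv hJu hJv
    by_contra hJ
    refine hcon (L, u, v) ?_ ⟨Q, hQ, hu, hv, huv, Ju, Jv, hJu, hJv, hJ⟩
    simp only [idx, Finset.mem_product, Finset.mem_powersetCard, Finset.subset_univ, true_and,
      Finset.mem_univ, and_true]
    have := Ju.2
    rw [hJu, Finset.card_insert_of_notMem hu] at this
    omega
  have hbad : ∀ x ∈ idx, (binomialDoubleKGraph k n p₁ p₂).real (bad x) ≤ δ := by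
    rintro ⟨L, u, v⟩ hx
    simp only [idx, Finset.mem_product, Finset.mem_powersetCard, Finset.subset_univ, true_and,
      Finset.mem_univ, and_true] at hx
    by_cases hgood : u ∉ L ∧ v ∉ L ∧ u ≠ v
    · obtain ⟨hu, hv, huv⟩ := hgood
      obtain ⟨B, lev, t, hlev, hle⟩ := h L u v hx hu hv huv
      refine (measureReal_mono ?_).trans hle
      rintro H ⟨Q, hQ, -, -, -, Ju, Jv, hJu, hJv, hJ⟩ hcl
      exact hJ (insert_rel_of_levelCluster hlev hQ hcl hJu hJv hu hv)
    · have : bad (L, u, v) = ∅ := by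
        ext H
        simp only [bad, Set.mem_ofPred_eq, Set.mem_empty_iff_false, iff_false]
        rintro ⟨Q, -, h1, h2, h3, -⟩
        exact hgood ⟨h1, h2, h3⟩
      rw [this, measureReal_empty]
      exact hδ
  refine (measureReal_mono hsub (measure_ne_top _ _)).trans
    ((measureReal_biUnion_finset_le _ _).trans ((Finset.sum_le_sum hbad).trans ?_))
  rw [Finset.sum_const, nsmul_eq_mul]
  refine mul_le_mul_of_nonneg_right ?_ hδ
  simp only [idx, Finset.card_product, Finset.card_powersetCard, Finset.card_univ,
    Fintype.card_fin]
  have h1 : n.choose (j - 1) * (n * n) ≤ n ^ (j + 1) := by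
    calc n.choose (j - 1) * (n * n) ≤ n ^ (j - 1) * (n * n) := by
          gcongr
          exact Nat.choose_le_pow _ _
      _ = n ^ (j + 1) := by
          rw [← pow_two, ← pow_add]
          congr 1
          omega
  exact_mod_cast h1

/-! ### Exchanging the colours -/

theorem jigsawClosure_swap {β : Type*} (r b : β → β → Prop) :
    jigsawClosure r b = jigsawClosure b r := by
  have : {Q | JigsawClosed r b Q} = {Q | JigsawClosed b r Q} :=
    Set.ext fun Q => ⟨JigsawClosed.swap, JigsawClosed.swap⟩
  rw [jigsawClosure, jigsawClosure, this]

theorem levelCluster_swap {Ω α : Type*} (X : Bool × Sym2 α → Ω → Prop) (lev : α → ℕ) (ω : Ω)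
    (t : ℕ) : levelCluster (fun i : Bool × Sym2 α => X (!i.1, i.2)) lev ω t = levelCluster X lev ω t :=
  jigsawClosure_swap _ _

theorem CoordIndep.swap {Ω κ : Type*} {X : Bool × κ → Ω → Prop} [MeasurableSpace Ω]
    {μ : Measure Ω} (h : CoordIndep X μ) : CoordIndep (fun i : Bool × κ => X (!i.1, i.2)) μ := by
  have := h.bundle (fun i : Bool × κ => {(!i.1, i.2)}) (by
    rintro ⟨c, x⟩ ⟨c', x'⟩ hne
    simp only [Function.onFun, Set.disjoint_singleton]
    intro h
    simp only [Prod.mk.injEq, Bool.not_inj_iff] at h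
    exact hne (Prod.ext h.1 h.2))
  simpa using this

/-! ### Two vertices of a random link are in one cluster -/

theorem exp_neg_le_one_sub_half {x : ℝ} (h0 : 0 ≤ x) (h1 : x ≤ 1) :
    Real.exp (-x) ≤ 1 - x / 2 := by
  rw [Real.exp_neg]
  have h2 : x + 1 ≤ Real.exp x := Real.add_one_le_exp x
  calc (Real.exp x)⁻¹ ≤ (x + 1)⁻¹ := inv_anti₀ (by linarith) h2
    _ ≤ 1 - x / 2 := by
      rw [inv_le_iff_one_le_mul₀ (by linarith)]
      nlinarith

theorem min_div_two_le_one_sub_pow {p : ℝ} (hp0 : 0 ≤ p) (hp1 : p ≤ 1) (s : ℕ) :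
    min 1 (s * p) / 2 ≤ 1 - (1 - p) ^ s := by
  have h0 : 0 ≤ min 1 (s * p) := le_min zero_le_one (by positivity)
  have h1 := exp_neg_le_one_sub_half h0 (min_le_left _ _)
  have h2 := one_sub_pow_le_exp hp1 s
  have h3 : Real.exp (-(p * s)) ≤ Real.exp (-min 1 (s * p)) := by
    rw [Real.exp_le_exp, neg_le_neg_iff, mul_comm]
    exact min_le_right _ _
  linarith

/-- If adding a vertex to a cluster with `s` vertices succeeds with probability `(s / l) ^ 2 / 2`,
then reaching `l + 1` vertices succeeds with probability at least `exp (-3 * l)`. -/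
theorem exp_le_prod_growth (l : ℕ) :
    Real.exp (-(3 * l)) ≤ ∏ i ∈ Finset.range l, min 1 (((1 + i : ℕ) : ℝ) / l) ^ 2 / 2 := by
  rcases Nat.eq_zero_or_pos l with rfl | hl
  · simp
  have hl' : (0 : ℝ) < l := by exact_mod_cast hl
  have h1 : ∏ i ∈ Finset.range l, min 1 (((1 + i : ℕ) : ℝ) / l) ^ 2 / 2 =
      ((l.factorial : ℝ) / (l : ℝ) ^ l) ^ 2 / 2 ^ l := by
    rw [Finset.prod_congr rfl (g := fun i : ℕ => (((i + 1 : ℕ) : ℝ) / l) ^ 2 / 2) (by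
      intro i hi
      rw [Finset.mem_range] at hi
      rw [min_eq_right, add_comm]
      rw [div_le_one hl']
      exact_mod_cast (by omega : 1 + i ≤ l))]
    rw [Finset.prod_div_distrib, Finset.prod_pow, Finset.prod_div_distrib, Finset.prod_const,
      Finset.prod_const, Finset.card_range, ← Nat.cast_prod, Finset.prod_range_add_one_eq_factorial]
  rw [h1]
  have h2 : Real.exp (-l) ≤ (l.factorial : ℝ) / (l : ℝ) ^ l := by
    rw [le_div_iff₀ (by positivity), Real.exp_neg, inv_mul_le_iff₀ (Real.exp_pos _)]
    exact pow_le_exp_mul_factorial l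
  have h3 : (2 : ℝ) ^ l ≤ Real.exp l := by
    rw [← mul_one (l : ℝ), Real.exp_nat_mul]
    have := Real.add_one_le_exp (1 : ℝ)
    gcongr
    linarith
  calc Real.exp (-(3 * l)) = Real.exp (-l) ^ 2 / Real.exp l := by
        rw [← Real.exp_nat_mul, ← Real.exp_sub]
        congr 1
        push_cast
        ring
    _ ≤ _ := by gcongr

/-- The arithmetic behind the growth of a cluster with `s` vertices, where `D` is the number of
fresh vertices. -/
theorem sq_le_growth {s l : ℕ} (hsl : s ≤ l) {p₁ p₂ D : ℝ} (h₁0 : 0 ≤ p₁)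
    (h₁1 : p₁ ≤ 1) (h₂0 : 0 ≤ p₂) (h₂1 : p₂ ≤ 1) (hD : 4 ≤ D) (h₁ : 4 ≤ p₁ * (l * D))
    (h₂ : 4 ≤ p₂ * (l * D)) (h₁₂ : 4 ≤ p₁ * p₂ * (l ^ 2 * D)) :
    min 1 ((s : ℝ) / l) ^ 2 ≤ (1 - (1 - p₁) ^ s) * (1 - (1 - p₂) ^ s) * D := by
  have hl : 0 < (l : ℝ) := by
    rcases (Nat.cast_nonneg (α := ℝ) l).eq_or_lt with h | h
    · rw [← h] at h₁; linarith
    · exact h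
  set r : ℝ := (s : ℝ) / l with hr
  have hr0 : 0 ≤ r := by positivity
  have hr1 : r ≤ 1 := (div_le_one hl).2 (by exact_mod_cast hsl)
  have hs : (s : ℝ) = r * l := by rw [hr]; field_simp
  have g₁ := min_div_two_le_one_sub_pow h₁0 h₁1 s
  have g₂ := min_div_two_le_one_sub_pow h₂0 h₂1 s
  have n₁ : 0 ≤ min 1 (s * p₁) := le_min zero_le_one (by positivity)
  have n₂ : 0 ≤ min 1 (s * p₂) := le_min zero_le_one (by positivity)
  have hgoal : 4 * r ^ 2 ≤ min 1 (s * p₁) * min 1 (s * p₂) * D := by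
    have e : r ^ 2 ≤ r := by nlinarith
    rcases min_cases 1 (s * p₁) with ⟨m₁, -⟩ | ⟨m₁, -⟩ <;>
      rcases min_cases 1 (s * p₂) with ⟨m₂, -⟩ | ⟨m₂, -⟩ <;> rw [m₁, m₂]
    · nlinarith
    · rw [hs]
      nlinarith [mul_le_mul_of_nonneg_left h₂ hr0]
    · rw [hs]
      nlinarith [mul_le_mul_of_nonneg_left h₁ hr0]
    · rw [hs]
      nlinarith [mul_le_mul_of_nonneg_left h₁₂ (sq_nonneg r)]
  rw [min_eq_right hr1]
  calc r ^ 2 ≤ (min 1 (s * p₁) / 2) * (min 1 (s * p₂) / 2) * D := by linarith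
    _ ≤ _ := mul_le_mul_of_nonneg_right
      (mul_le_mul g₁ g₂ (by positivity) (by linarith)) (by linarith)

section

variable {Ω α : Type*} {X : Bool × Sym2 α → Ω → Prop} {lev : α → ℕ} [Fintype α] [DecidableEq α]
  [MeasurableSpace Ω] {μ : Measure Ω} [IsProbabilityMeasure μ] [DiscreteMeasurableSpace Ω]

/-- Two given vertices are in the same cluster up to probability `O (exp (-a * L))`, where `x` stands
for the number of vertices and `L` for its logarithm, if each pair has colour `c` with probability
at least `p c` and each stage of the argument has a constant proportion of the vertices at its
disposal. The first cluster has about `L / 12` vertices: growing it succeeds with probability at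
least `exp (-L / 4)`, which the number `m` of attempts makes up for. The constant `24576` is what
the red edge between the first two clusters needs. -/
theorem CoordIndep.not_cluster_le_exp (h : CoordIndep X μ) {l : ℕ} {a x L : ℝ} (ha : 1 ≤ a)
    (hL : 1 ≤ L) (hl1 : L / 24 ≤ l) (hl2 : l ≤ L / 12) (hl3 : L / 12 ≤ l + 1)
    {p : Bool → ℝ} (hp1 : ∀ c, p c ≤ 1)
    (hpL : ∀ c, 24576 * a * L / x ≤ p c) (hpp : 24576 * a / (x * L) ≤ p true * p false)
    (hp : ∀ c a b, a ≠ b → lev a ≤ l + 3 → lev b ≤ l + 3 → p c ≤ μ.real {ω | X (c, s(a, b)) ω})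
    {m : ℕ} (hm : (Finset.univ.filter fun a => lev a = 0).card = m)
    (hroot : a * L ≤ Real.exp (-(L / 4)) * m)
    (hlev : ∀ i, 1 ≤ i → i ≤ l →
      x / (32 * l) + m * (l + 1) ≤ ((Finset.univ.filter fun a => lev a = i).card : ℝ))
    (hw1 : x / 16 ≤ ((Finset.univ.filter fun a => lev a = l + 1).card : ℝ))
    (hw2 : x / 16 ≤ ((Finset.univ.filter fun a => lev a = l + 2).card : ℝ))
    (hx : 128 * a * L ≤ x) {u v : α} (hu : lev u = l + 3) (hv : lev v = l + 3) :
    μ.real {ω | ¬ levelCluster X lev ω (l + 3) u v} ≤ 13 * Real.exp (-(a * L)) := by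
  -- the sparser graph is called red
  wlog hple : p true ≤ p false generalizing X p with H
  · have := H h.swap (p := fun c => p !c) (fun c => hp1 _) (fun c => hpL _)
      (hpp.trans_eq (mul_comm _ _)) (fun c => hp !c) (le_of_not_ge hple)
    refine (measureReal_mono ?_).trans this
    intro ω hω hcon
    rw [levelCluster_swap] at hcon
    exact hω hcon
  have haL : 1 ≤ a * L := one_le_mul_of_one_le_of_one_le ha hL
  have hx0 : 0 < x := by linarith
  have hL0 : 0 < L := by linarith
  have hl0 : (0 : ℝ) < l := by linarith
  have hpL' : ∀ c, 24576 * (a * L) ≤ p c * x := by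
    intro c
    have := (div_le_iff₀ hx0).1 (hpL c)
    linarith
  have hpp' : 24576 * a ≤ p true * p false * (x * L) := (div_le_iff₀ (by positivity)).1 hpp
  have hp0 : ∀ c, 0 ≤ p c := fun c => le_trans (by positivity) (hpL c)
  have hpp0 : 0 ≤ p true * p false := mul_nonneg (hp0 _) (hp0 _)
  set D : ℝ := x / (32 * l) with hD
  have hlD : l * D = x / 32 := by rw [hD]; field_simp
  have hDL : 3 / 8 * x ≤ D * L := by
    have h1 : D * (12 * l) ≤ D * L := mul_le_mul_of_nonneg_left (by linarith) (by positivity)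
    linarith
  have hD4 : 4 ≤ D := by
    by_contra hcon
    push Not at hcon
    have : D * L ≤ 4 * L := by gcongr
    nlinarith
  let q : ℕ → ℝ := fun i => min 1 ((i : ℝ) / l) ^ 2 / 2
  have hq0 : ∀ i, 0 ≤ q i := fun i => by positivity
  have hmin0 : ∀ i : ℕ, 0 ≤ min 1 ((i : ℝ) / l) := fun i => le_min zero_le_one (by positivity)
  have hmin1 : ∀ i : ℕ, min 1 ((i : ℝ) / l) ^ 2 ≤ 1 := fun i =>
    pow_le_one₀ (hmin0 i) (min_le_left _ _)
  have hq1 : ∀ i, q i ≤ 1 := fun i => by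
    simp only [q]
    linarith [hmin1 i]
  have hq : ∀ S U : Finset α, 1 ≤ S.card → S.card ≤ l → (∀ a ∈ S, lev a < S.card) →
      U.card ≤ m * (l + 1) →
      μ.real {ω | ∀ w, lev w = S.card → w ∉ U → ¬ JoinsTo X ω S w} ≤ 1 - q S.card := by
    intro S U hS1 hSl hSlev hU
    set W := (Finset.univ.filter fun a => lev a = S.card) \ U with hW
    have hWlev : ∀ w ∈ W, lev w = S.card := fun w hw =>
      (Finset.mem_filter.1 (Finset.mem_sdiff.1 hw).1).2
    have hSW : Disjoint S W := by
      rw [Finset.disjoint_left]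
      intro a ha haW
      have h1 := hSlev a ha
      have h2 := hWlev a haW
      omega
    have hWc : D ≤ W.card := by
      have h1 := hlev S.card hS1 hSl
      have h2 : (Finset.univ.filter fun a => lev a = S.card).card ≤ W.card + U.card := by
        have := Finset.card_le_card_sdiff_add_card (t := U)
          (s := Finset.univ.filter fun a => lev a = S.card)
        omega
      have h3 : ((Finset.univ.filter fun a => lev a = S.card).card : ℝ) ≤
          W.card + m * (l + 1) := by exact_mod_cast h2.trans (by omega)
      linarith
    have hmain := h.no_joinsTo_le hSW hp0 hp1 fun c a ha w hw =>
      hp c a w (by rintro rfl; exact Finset.disjoint_left.1 hSW ha hw)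
        (by have := hSlev a ha; omega) (by have := hWlev w hw; omega)
    refine (measureReal_mono ?_).trans (hmain.trans ?_)
    · intro ω hω w hw
      exact hω w (hWlev w hw) (Finset.mem_sdiff.1 hw).2
    set G := (1 - (1 - p true) ^ S.card) * (1 - (1 - p false) ^ S.card) with hG
    have hpow : ∀ c, 0 ≤ (1 - p c) ^ S.card ∧ (1 - p c) ^ S.card ≤ 1 := fun c =>
      ⟨pow_nonneg (by linarith [hp1 c]) _, pow_le_one₀ (by linarith [hp1 c]) (by linarith [hp0 c])⟩
    have hG0 : 0 ≤ G := mul_nonneg (by linarith [hpow true]) (by linarith [hpow false])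
    have hG1 : G ≤ 1 := mul_le_one₀ (by linarith [hpow true]) (by linarith [hpow false])
      (by linarith [hpow false])
    have hGD : min 1 ((S.card : ℝ) / l) ^ 2 ≤ G * D := by
      refine sq_le_growth hSl (hp0 _) (hp1 _) (hp0 _) (hp1 _) hD4 ?_ ?_ ?_
      · rw [hlD]; linarith [hpL' true]
      · rw [hlD]; linarith [hpL' false]
      · have h1 : p true * p false * ((l : ℝ) ^ 2 * D) = p true * p false * x * l / 32 := by
          rw [pow_two, mul_assoc (l : ℝ), hlD]; ring
        have h2 : p true * p false * x * (L / 24) ≤ p true * p false * x * l := by gcongr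
        rw [h1]
        linarith
    calc (1 - G) ^ W.card ≤ Real.exp (-(G * W.card)) := one_sub_pow_le_exp hG1 _
      _ ≤ Real.exp (-(min 1 ((S.card : ℝ) / l) ^ 2)) := by
        rw [Real.exp_le_exp, neg_le_neg_iff]
        exact hGD.trans (by gcongr)
      _ ≤ 1 - q S.card := exp_neg_le_one_sub_half (by positivity) (hmin1 _)
  -- the number of vertices of the second cluster is about `min 1 (l * p false) * x`
  set g : ℝ := min 1 (((l + 1 : ℕ) : ℝ) * p false) / 2 with hg
  have hg' := min_div_two_le_one_sub_pow (hp0 false) (hp1 false) (l + 1)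
  have hg0 : 0 ≤ g := by
    have : 0 ≤ min 1 (((l + 1 : ℕ) : ℝ) * p false) :=
      le_min zero_le_one (mul_nonneg (by positivity) (hp0 _))
    positivity
  set y : ℝ := x / 16 * g / 4 with hy
  have hcase : y = x / 128 ∨ y = x * ((l + 1) * p false) / 128 := by
    rw [hy, hg]
    rcases min_cases 1 (((l + 1 : ℕ) : ℝ) * p false) with ⟨h1, -⟩ | ⟨h1, -⟩
    · left; rw [h1]; ring
    · right; rw [h1]; push_cast; ring
  have hLl : ∀ z : ℝ, 0 ≤ z → z * (L / 12) ≤ z * (l + 1) := fun z hz => by gcongr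
  have hLl2 : (L / 12) * (L / 12) ≤ ((l : ℝ) + 1) * (l + 1) := by gcongr
  have hpx := fun c => mul_nonneg (hp0 c) hx0.le
  have hppx := mul_nonneg hpp0 hx0.le
  have hya : a * L ≤ y := by
    rcases hcase with h1 | h1
    · linarith
    · have h2 := hLl _ (hpx false)
      have h3 := mul_le_mul_of_nonneg_right (hpL' false) hL0.le
      have h4 : a * L ≤ a * L * L := le_mul_of_one_le_right (by positivity) hL
      rw [h1]
      linarith
  have hpy : 11 ≤ p true * y := by
    rcases hcase with h1 | h1
    · rw [h1]; linarith [hpL' true]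
    · have h2 := hLl _ hppx
      rw [h1]
      linarith
  have hply : a * L ≤ p true * (l + 1) * (3 / 4 * y) := by
    rcases hcase with h1 | h1
    · have h2 := hpL' true
      have h3 : p true * x * 1 ≤ p true * x * (l + 1) := mul_le_mul_of_nonneg_left (by linarith) (hpx _)
      rw [h1]
      linarith
    · have h2 := mul_le_mul_of_nonneg_left hLl2 hppx
      have h3 := mul_le_mul_of_nonneg_right hpp' hL0.le
      rw [h1]
      linarith
  have hmain := h.not_cluster_le hq0 hq1 hq (Finset.univ.filter fun a => lev a = 0)
    (fun r hr => (Finset.mem_filter.1 hr).2) (by rw [hm]) hp0 hp1 hple hp (w := x / 16)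
    (by positivity) hw1 hw2 hg0 hg' (by positivity : 0 ≤ y) le_rfl hpy
    (by linarith [hpL' true]) hu hv
  rw [hm] at hmain
  refine hmain.trans ?_
  have e1 : (1 - ∏ i ∈ Finset.range l, q (1 + i)) ^ m ≤ Real.exp (-(a * L)) := by
    have hQ := exp_le_prod_growth l
    have hQ1 : ∏ i ∈ Finset.range l, q (1 + i) ≤ 1 :=
      Finset.prod_le_one (fun _ _ => hq0 _) fun _ _ => hq1 _
    refine (one_sub_pow_le_exp hQ1 m).trans ?_
    rw [Real.exp_le_exp, neg_le_neg_iff]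
    refine hroot.trans (mul_le_mul_of_nonneg_right (le_trans ?_ hQ) (Nat.cast_nonneg m))
    rw [Real.exp_le_exp]
    linarith
  have e2 : Real.exp (-y) ≤ Real.exp (-(a * L)) := Real.exp_le_exp.2 (by linarith)
  have e3 : Real.exp (-(p true * (l + 1) * (3 / 4 * y))) ≤ Real.exp (-(a * L)) :=
    Real.exp_le_exp.2 (by linarith)
  have e4 : Real.exp (-(x / 16 / 8)) ≤ Real.exp (-(a * L)) := Real.exp_le_exp.2 (by linarith)
  have e5 : Real.exp (-(p true * (3 / 4 * (x / 16 / 8)))) ≤ Real.exp (-(a * L)) :=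
    Real.exp_le_exp.2 (by linarith [hpL' true])
  linarith

end

/-! ### The supercritical case -/

/-- If `M` is of order `x ^ d` and `p₁`, `p₂` satisfy the conditions of the supercritical case, then
the probabilities that at least one of `M` edges is present satisfy the conditions of the
supercritical case for graphs. -/
theorem bundle_supercritical {d M : ℕ} {κ x L c C p₁ p₂ : ℝ} (hκ : 1 ≤ κ) (hL : 1 ≤ L) (hC : 1 ≤ C)
    (hM : x ^ d ≤ κ * M) (hx : 4 * C * L ≤ x) (hc : 4 * κ ^ 2 * C ≤ c) (h₁1 : p₁ ≤ 1)
    (h₂1 : p₂ ≤ 1) (h₁ : c * L / x ^ (d + 1) ≤ p₁) (h₂ : c * L / x ^ (d + 1) ≤ p₂)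
    (h₁₂ : c / (x ^ (2 * d + 1) * L) ≤ p₁ * p₂) :
    C * L / x ≤ 1 - (1 - p₁) ^ M ∧ C * L / x ≤ 1 - (1 - p₂) ^ M ∧
      C / (x * L) ≤ (1 - (1 - p₁) ^ M) * (1 - (1 - p₂) ^ M) := by
  have hCL : 1 ≤ C * L := one_le_mul_of_one_le_of_one_le hC hL
  have hx0 : 0 < x := by linarith
  have hκ2 : κ ≤ κ ^ 2 := by nlinarith
  have hc' : 4 * κ * C ≤ c := le_trans (by gcongr) hc
  have hc0 : 0 < c := lt_of_lt_of_le (by positivity) hc'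
  have h₁0 : 0 ≤ p₁ := le_trans (by positivity) h₁
  have h₂0 : 0 ≤ p₂ := le_trans (by positivity) h₂
  have hMx : x ^ d / κ ≤ M := by
    rw [div_le_iff₀ (by linarith), mul_comm]
    exact hM
  have hone : ∀ p, c * L / x ^ (d + 1) ≤ p → 4 * (C * L / x) ≤ M * p := by
    intro p hp
    calc 4 * (C * L / x) ≤ x ^ d / κ * (c * L / x ^ (d + 1)) := by
          rw [pow_succ, show x ^ d / κ * (c * L / (x ^ d * x)) = c / κ * (L / x) by field_simp,
            show 4 * (C * L / x) = 4 * C * (L / x) by ring]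
          refine mul_le_mul_of_nonneg_right ?_ (by positivity)
          rw [le_div_iff₀ (by linarith)]
          linarith
      _ ≤ M * p := by gcongr
  have hboth : 4 * (C / (x * L)) ≤ M * p₁ * (M * p₂) := by
    calc 4 * (C / (x * L)) ≤ (x ^ d / κ) * (x ^ d / κ) * (c / (x ^ (2 * d + 1) * L)) := by
          rw [show (x ^ d / κ) * (x ^ d / κ) * (c / (x ^ (2 * d + 1) * L)) =
            c / κ ^ 2 * (1 / (x * L)) by rw [pow_succ, pow_mul']; field_simp,
            show 4 * (C / (x * L)) = 4 * C * (1 / (x * L)) by ring]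
          refine mul_le_mul_of_nonneg_right ?_ (by positivity)
          rw [le_div_iff₀ (by positivity)]
          linarith
      _ ≤ M * M * (p₁ * p₂) := by gcongr
      _ = _ := by ring
  have hsmall : 4 * (C / (x * L)) ≤ 4 * (C * L / x) := by
    have : C / (x * L) ≤ C * L / x := by
      rw [div_le_div_iff₀ (by positivity) hx0]
      have : C * x * 1 ≤ C * x * (L * L) := by
        gcongr
        nlinarith
      linarith
    linarith
  have hquarter : 4 * (C * L / x) ≤ 1 := by
    rw [← mul_div_assoc, div_le_one hx0]
    linarith
  have g₁ := min_div_two_le_one_sub_pow h₁0 h₁1 M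
  have g₂ := min_div_two_le_one_sub_pow h₂0 h₂1 M
  have hCx : 0 ≤ C * L / x := by positivity
  have m₁ : 2 * (C * L / x) ≤ min 1 (M * p₁) := le_min (by linarith) (by linarith [hone p₁ h₁])
  have m₂ : 2 * (C * L / x) ≤ min 1 (M * p₂) := le_min (by linarith) (by linarith [hone p₂ h₂])
  refine ⟨by linarith, by linarith, ?_⟩
  have hmain : 4 * (C / (x * L)) ≤ min 1 (M * p₁) * min 1 (M * p₂) := by
    rcases min_cases 1 (M * p₁) with ⟨e₁, -⟩ | ⟨e₁, -⟩ <;>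
      rcases min_cases 1 (M * p₂) with ⟨e₂, -⟩ | ⟨e₂, -⟩ <;> rw [e₁, e₂]
    · linarith
    · linarith [hone p₂ h₂]
    · linarith [hone p₁ h₁]
    · exact hboth
  calc C / (x * L) ≤ (min 1 (M * p₁) / 2) * (min 1 (M * p₂) / 2) := by linarith
    _ ≤ _ := mul_le_mul g₁ g₂ (by linarith) (by linarith)

/-- The sizes of the levels: `m` roots, `l` levels with `s` vertices for growing a cluster, and
levels of size `w` for its expansion. -/
theorem eventually_level_sizes (j : ℕ) {a : ℝ} (ha : 1 ≤ a) :
    ∀ᶠ n : ℕ in atTop, ∃ l m s w : ℕ, 1 ≤ Real.log n ∧ Real.log n / 24 ≤ l ∧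
      l ≤ Real.log n / 12 ∧ Real.log n / 12 ≤ l + 1 ∧
      a * Real.log n ≤ Real.exp (-(Real.log n / 4)) * m ∧ n / (32 * l) + m * (l + 1) ≤ (s : ℝ) ∧
      (n : ℝ) / 16 ≤ w ∧ m + l * s + 3 * w + (j + 1) ≤ n := by
  have hlog : Tendsto (fun n : ℕ => Real.log n) atTop atTop :=
    Real.tendsto_log_atTop.comp tendsto_natCast_atTop_atTop
  have hexp : ∀ᶠ n : ℕ in atTop, a * Real.log n ≤ Real.exp (Real.log n / 4) := by
    filter_upwards [hlog.eventually_ge_atTop (32 * a)] with n hn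
    have h1 : 0 ≤ Real.log n := by linarith
    have h2 := Real.quadratic_le_exp_of_nonneg (by positivity : 0 ≤ Real.log n / 4)
    have h3 : 32 * a * Real.log n ≤ Real.log n * Real.log n := by gcongr
    linarith
  have hsq : ∀ᶠ n : ℕ in atTop, Real.log n ^ 2 ≤ √n := by
    have h1 := ((Real.isLittleO_pow_log_id_atTop (n := 4)).comp_tendsto
      tendsto_natCast_atTop_atTop).bound one_pos
    filter_upwards [h1] with n hn
    simp only [Function.comp, id, one_mul, Real.norm_eq_abs, Nat.abs_cast] at hn
    refine Real.le_sqrt_of_sq_le ?_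
    rw [← pow_mul]
    exact (le_abs_self _).trans hn
  filter_upwards [hexp, hsq, hlog.eventually_ge_atTop 24, eventually_mul_log_le 128,
    eventually_ge_atTop (4 * (j + 1)), eventually_ge_atTop 64] with n h1 h2 h3 h4 h5 h6
  set L := Real.log n with hL
  have hn : (64 : ℝ) ≤ n := by exact_mod_cast h6
  have hl1 : (⌊L / 12⌋₊ : ℝ) ≤ L / 12 := Nat.floor_le (by linarith)
  have hl2 : L / 12 < ⌊L / 12⌋₊ + 1 := Nat.lt_floor_add_one _
  set l := ⌊L / 12⌋₊ with hl
  have hl0 : (1 : ℝ) ≤ l := by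
    have : (0 : ℝ) < l := by linarith
    exact_mod_cast this
  have hm1 : √n ≤ ⌈√(n : ℝ)⌉₊ := Nat.le_ceil _
  have hm2 : (⌈√(n : ℝ)⌉₊ : ℝ) < √n + 1 := Nat.ceil_lt_add_one (Real.sqrt_nonneg _)
  set m := ⌈√(n : ℝ)⌉₊ with hm
  have hsqrt : √(n : ℝ) * √n = n := Real.mul_self_sqrt (by linarith)
  have hs8 : 8 ≤ √(n : ℝ) := Real.le_sqrt_of_sq_le (by linarith)
  have hw : (n : ℝ) / 8 - 1 ≤ (n / 8 : ℕ) := by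
    have : n ≤ 8 * (n / 8) + 8 := by omega
    have : (n : ℝ) ≤ 8 * (n / 8 : ℕ) + 8 := by exact_mod_cast this
    linarith
  have hs : ((n / 8 : ℕ) : ℝ) ≤ l * ((n / 8 / l : ℕ) : ℝ) + l := by
    have h7 : n / 8 ≤ l * (n / 8 / l) + l := by
      have h8 := Nat.div_add_mod (n / 8) l
      have h9 := Nat.mod_lt (n / 8) (by exact_mod_cast hl0 : l > 0)
      omega
    exact_mod_cast h7
  refine ⟨l, m, n / 8 / l, n / 8, by linarith, by linarith, hl1, hl2.le, ?_, ?_, by linarith, ?_⟩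
  · refine h1.trans ?_
    have : Real.exp (L / 4) = Real.exp (-(L / 4)) * √n := by
      rw [Real.sqrt_eq_rpow, Real.rpow_def_of_pos (by linarith), ← Real.exp_add]
      congr 1
      ring
    rw [this]
    gcongr
  · set s := ((n / 8 / l : ℕ) : ℝ)
    have e1 : (n : ℝ) / (32 * l) = n / 32 / l := by field_simp
    rw [e1, ← le_sub_iff_add_le, div_le_iff₀ (by linarith)]
    have e2 : (m : ℝ) * ((l + 1) * l) ≤ 2 * √n * (L / 8 * (L / 8)) := by
      gcongr <;> linarith
    have e3 : 2 * √n * (L / 8 * (L / 8)) ≤ n / 32 := by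
      have : √n * L ^ 2 ≤ √n * √n := by gcongr
      linarith
    nlinarith
  · have e1 : l * (n / 8 / l) ≤ n / 8 := Nat.mul_div_le _ _
    have e2 : 4 * m ≤ n := by
      have : (4 * m : ℝ) ≤ n := by nlinarith
      exact_mod_cast this
    omega

/-- Choosing the levels in the link of a `(j - 1)`-set `S`: the last one is the set `B` of vertices
that complete a pair to an edge. -/
theorem not_cluster_link_le {j k n : ℕ} (hj : 1 ≤ j) (hjk : j < k) {p₁ p₂ : I} {l m s w : ℕ}
    {a : ℝ} (ha : 1 ≤ a) (hL : 1 ≤ Real.log n) (hl1 : Real.log n / 24 ≤ l)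
    (hl2 : l ≤ Real.log n / 12) (hl3 : Real.log n / 12 ≤ l + 1)
    (hm : a * Real.log n ≤ Real.exp (-(Real.log n / 4)) * m)
    (hs : n / (32 * l) + m * (l + 1) ≤ (s : ℝ)) (hw : (n : ℝ) / 16 ≤ w)
    (hsum : m + l * s + 3 * w + (j + 1) ≤ n) (hn : 128 * a * Real.log n ≤ n)
    (hpL : ∀ c, 24576 * a * Real.log n / n ≤
      1 - (1 - ((cond c p₁ p₂ : I) : ℝ)) ^ (w.choose (k - j - 1)))
    (hpp : 24576 * a / (n * Real.log n) ≤ (1 - (1 - (p₁ : ℝ)) ^ (w.choose (k - j - 1))) *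
      (1 - (1 - (p₂ : ℝ)) ^ (w.choose (k - j - 1))))
    {S : Finset (Fin n)} (hS : S.card = j - 1) {u v : Fin n} (hu : u ∉ S) (hv : v ∉ S) :
    ∃ (B : Finset (Fin n)) (lev : Fin n → ℕ) (t : ℕ), (∀ a, lev a ≤ t → a ∉ S ∪ B) ∧
      (binomialDoubleKGraph k n p₁ p₂).real
        {H | ¬ levelCluster (linkCoord k S B) lev H t u v} ≤
        13 * Real.exp (-(a * Real.log n)) := by
  classical
  let sz : ℕ → ℕ := fun i => if i = 0 then m else if i ≤ l then s else w
  have hsz : ∑ i ∈ Finset.range (l + 4), sz i = m + l * s + 3 * w := by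
    have h1 : ∀ i ∈ Finset.range l, sz (i + 1) = s := fun i hi => by
      have := Finset.mem_range.1 hi
      simp only [sz]
      rw [if_neg (by omega), if_pos (by omega)]
    have h2 : ∀ i, l < i → sz i = w := fun i hi => by
      simp only [sz]
      rw [if_neg (by omega), if_neg (by omega)]
    rw [Finset.sum_range_succ, Finset.sum_range_succ, Finset.sum_range_succ,
      Finset.sum_range_succ', Finset.sum_congr rfl h1, h2 (l + 1) (by omega),
      h2 (l + 2) (by omega), h2 (l + 3) (by omega), Finset.sum_const, Finset.card_range, smul_eq_mul]
    simp only [sz]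
    rw [if_pos trivial]
    omega
  have hcard : ∑ i ∈ Finset.range (l + 4), sz i ≤ (Finset.univ \ (S ∪ {u, v})).card := by
    have h1 := Finset.card_le_card_sdiff_add_card (s := (Finset.univ : Finset (Fin n)))
      (t := S ∪ {u, v})
    have h2 := Finset.card_union_le S {u, v}
    have h3 := Finset.card_le_two (a := u) (b := v)
    rw [Finset.card_univ, Fintype.card_fin] at h1
    rw [hsz]
    omega
  obtain ⟨lev₀, hlev, hout, -⟩ := exists_levels _ sz (l + 4) hcard
  have hout' : ∀ a ∈ S ∪ {u, v}, lev₀ a = l + 4 := fun a ha =>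
    hout a fun h => (Finset.mem_sdiff.1 h).2 ha
  have hlu : lev₀ u = l + 4 := hout' u (by simp)
  have hlv : lev₀ v = l + 4 := hout' v (by simp)
  have hlS : ∀ a ∈ S, lev₀ a = l + 4 := fun a ha => hout' a (Finset.mem_union_left _ ha)
  set B := Finset.univ.filter fun a => lev₀ a = l + 3 with hB
  have hBmem : ∀ a, a ∈ B ↔ lev₀ a = l + 3 := fun a => by simp [hB]
  have hBc : B.card = w := by
    rw [hB, hlev (l + 3) (by omega)]
    simp only [sz]
    rw [if_neg (by omega), if_neg (by omega)]
  have hSB : Disjoint S B := by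
    rw [Finset.disjoint_left]
    intro a ha haB
    rw [hBmem, hlS a ha] at haB
    omega
  let lev : Fin n → ℕ := fun a => if a = u ∨ a = v then l + 3 else if lev₀ a < l + 3 then lev₀ a
    else l + 4
  have hlevu : lev u = l + 3 := if_pos (Or.inl rfl)
  have hlevv : lev v = l + 3 := if_pos (Or.inr rfl)
  have hsmall : ∀ i < l + 3, (Finset.univ.filter fun a => lev a = i).card = sz i := by
    intro i hi
    rw [← hlev i (by omega)]
    congr 1
    refine Finset.filter_congr fun a _ => ?_
    simp only [lev]
    split_ifs with h1 h2
    · rcases h1 with rfl | rfl <;> omega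
    · exact Iff.rfl
    · omega
  have havoid : ∀ a, lev a ≤ l + 3 → a ∉ S ∪ B := by
    intro a ha
    rw [Finset.mem_union, hBmem, not_or]
    simp only [lev] at ha
    split_ifs at ha with h1 h2
    · rcases h1 with rfl | rfl
      · exact ⟨hu, by omega⟩
      · exact ⟨hv, by omega⟩
    · exact ⟨fun h => by have := hlS a h; omega, by omega⟩
    · omega
  refine ⟨B, lev, l + 3, havoid, ?_⟩
  refine (linkCoord_coordIndep p₁ p₂ S B).not_cluster_le_exp ha hL hl1 hl2 hl3
    (m := m) (p := fun c => 1 - (1 - ((cond c p₁ p₂ : I) : ℝ)) ^ (w.choose (k - j - 1))) (fun c => ?_) hpL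
    hpp (fun c a b hab h1 h2 => ?_) (hsmall 0 (by omega)) hm (fun i hi1 hi2 => ?_) ?_ ?_ hn
    hlevu hlevv
  · have := pow_nonneg (sub_nonneg.2 (cond c p₁ p₂ : I).2.2) (w.choose (k - j - 1))
    linarith
  · have := linkCoord_prob_ge hj hjk p₁ p₂ hS hSB c hab (havoid a h1) (havoid b h2)
    rwa [hBc] at this
  · rw [hsmall i (by omega)]
    simp only [sz]
    rw [if_neg (by omega), if_pos hi2]
    exact hs
  · rw [hsmall _ (by omega)]
    simp only [sz]
    rw [if_neg (by omega), if_neg (by omega)]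
    exact hw
  · rw [hsmall _ (by omega)]
    simp only [sz]
    rw [if_neg (by omega), if_neg (by omega)]
    exact hw

/-- Above the threshold the process percolates with high probability. -/
theorem percolates_of_supercritical {j k : ℕ} (hj : 1 ≤ j) (hjk : j < k) :
    ∃ c₀ : ℝ, 0 < c₀ ∧ ∀ c, c₀ ≤ c → ∀ p₁ p₂ : ℕ → I,
      (∀ᶠ n : ℕ in atTop,
          c / ((n : ℝ) ^ (2 * k - 2 * j - 1) * Real.log n) ≤ (p₁ n : ℝ) * (p₂ n : ℝ) ∧
          c * Real.log n / (n : ℝ) ^ (k - j) ≤ min (p₁ n : ℝ) (p₂ n : ℝ)) →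
        Tendsto (fun n : ℕ => binomialDoubleKGraph k n (p₁ n) (p₂ n) {H | H.Percolates j})
          atTop (𝓝 1) := by
  set d := k - j - 1 with hd
  set κ : ℝ := 16 ^ d * (2 ^ d * d.factorial : ℕ) with hκdef
  have hκ : 1 ≤ κ := by
    have h1 : (1 : ℝ) ≤ 16 ^ d := one_le_pow₀ (by norm_num)
    have h2 : (1 : ℝ) ≤ (2 ^ d * d.factorial : ℕ) := by
      exact_mod_cast Nat.mul_pos (by positivity) (Nat.factorial_pos d)
    exact one_le_mul_of_one_le_of_one_le h1 h2
  set a : ℝ := j + 2 with hadef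
  have ha : 1 ≤ a := by
    have : (0 : ℝ) ≤ j := Nat.cast_nonneg j
    linarith
  set C : ℝ := 24576 * a with hCdef
  refine ⟨4 * κ ^ 2 * C, by positivity, fun c hc p₁ p₂ hp => ?_⟩
  refine tendsto_real_one_of_le (δ := fun n : ℕ => 13 * (n : ℝ)⁻¹) ?_ ?_
  · simpa using tendsto_inv_atTop_nhds_zero_nat.const_mul (13 : ℝ)
  filter_upwards [hp, eventually_level_sizes j ha, eventually_mul_log_le (4 * C),
    eventually_ge_atTop j, eventually_ge_atTop (32 * d + 1)] with n hpn hsz hn hnj hnd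
  obtain ⟨l, m, s, w, hL, hl1, hl2, hl3, hm, hs, hw, hsum⟩ := hsz
  obtain ⟨hprod, hmin⟩ := hpn
  have hn0 : (0 : ℝ) < n := by exact_mod_cast (by omega : 0 < n)
  have hM : (n : ℝ) ^ d ≤ κ * (w.choose d : ℕ) := by
    have h1 : n ≤ 16 * w := by
      have : (n : ℝ) ≤ 16 * w := by linarith
      exact_mod_cast this
    calc (n : ℝ) ^ d ≤ (16 * w) ^ d := by gcongr; exact_mod_cast h1
      _ = 16 ^ d * (w : ℝ) ^ d := mul_pow _ _ _
      _ ≤ 16 ^ d * ((2 ^ d * d.factorial : ℕ) * (w.choose d : ℕ)) := by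
        gcongr
        exact pow_le_mul_choose (by omega)
      _ = _ := by rw [hκdef]; ring
  rw [show 2 * k - 2 * j - 1 = 2 * d + 1 by omega] at hprod
  rw [show k - j = d + 1 by omega] at hmin
  obtain ⟨b₁, b₂, b₃⟩ := bundle_supercritical hκ hL (by linarith) hM hn hc (p₁ n).2.2 (p₂ n).2.2
    (hmin.trans (min_le_left _ _)) (hmin.trans (min_le_right _ _)) hprod
  have hset : {H : DoubleKGraph (Fin n) k | H.Percolates j}ᶜ = {H | ¬ H.Percolates j} := rfl
  rw [hset]
  refine (real_not_percolates_le hj hnj (p₁ n) (p₂ n) (δ := 13 * Real.exp (-(a * Real.log n)))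
    (fun S u v hS hu hv _ => not_cluster_link_le hj hjk ha hL hl1 hl2 hl3 hm hs hw hsum ?_ ?_ b₃ hS hu hv)
    (by positivity)).trans_eq ?_
  · have : 0 ≤ a * Real.log n := by positivity
    linarith
  · intro c'
    cases c'
    · exact b₂
    · exact b₁
  · have h1 : Real.exp (-(a * Real.log n)) = ((n : ℝ) ^ (j + 2))⁻¹ := by
      rw [Real.exp_neg, mul_comm, ← Real.rpow_def_of_pos hn0, hadef]
      congr 1
      exact_mod_cast Real.rpow_natCast (n : ℝ) (j + 2)
    rw [h1]
    field_simp
    ring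

theorem theorem1p2 (k j : ℕ) (hj : 1 ≤ j) (hjk : j < k) :
    ∃ c : ℝ, 0 < c ∧ ∀ p₁ p₂ : ℕ → I,
      ((∀ᶠ n : ℕ in atTop,
          (p₁ n : ℝ) * (p₂ n : ℝ) ≤ 1 / (c * (n : ℝ) ^ (2 * k - 2 * j - 1) * Real.log n)) →
        Tendsto (fun n : ℕ => binomialDoubleKGraph k n (p₁ n) (p₂ n) {H | ¬ H.Percolates j})
          atTop (𝓝 1)) ∧
      ((∀ᶠ n : ℕ in atTop,
          c / ((n : ℝ) ^ (2 * k - 2 * j - 1) * Real.log n) ≤ (p₁ n : ℝ) * (p₂ n : ℝ) ∧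
          c * Real.log n / (n : ℝ) ^ (k - j) ≤ min (p₁ n : ℝ) (p₂ n : ℝ)) →
        Tendsto (fun n : ℕ => binomialDoubleKGraph k n (p₁ n) (p₂ n) {H | H.Percolates j})
          atTop (𝓝 1)) := by
  obtain ⟨c₁, hc₁, h₁⟩ := not_percolates_of_subcritical hj hjk
  obtain ⟨c₂, -, h₂⟩ := percolates_of_supercritical hj hjk
  exact ⟨max c₁ c₂, lt_max_of_lt_left hc₁, fun p₁ p₂ =>
    ⟨h₁ _ (le_max_left _ _) p₁ p₂, h₂ _ (le_max_right _ _) p₁ p₂⟩⟩
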